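/- Let $n\ge 1$. Let $(P_\theta)_{\theta\in\mathbb{R}^n}$ be a family of probability measures on a measurable space $\mathcal X$ with densities $dP_\theta(x)=f(x;\theta)\,d\lambda(x)$ with respect to a $\sigma$-finite measure $\lambda$, where $f\ge 0$ is jointly measurable and, for $\lambda$-a.e. $x$, the function $\theta\mapsto f(x;\theta)$ is weakly differentiable on $\mathbb{R}^n$ with (jointly measurable) gradient $\nabla_\theta f(x;\theta)$. Assume that $\nabla_\theta f(\cdot\,;\theta)$ is $\lambda$-integrable with $\int_{\mathcal X}\nabla_\theta f(x;\theta)\,d\lambda(x)=0$ for Lebesgue-a.e. $\theta$ (equivalently, for a.e. $\theta$ with respect to the standard Gaussian measure). Let $\pi$ be a probability measure on $\mathbb{R}^n$ with Lebesgue density $\rho$, let $\theta\sim\pi$ and, given $\theta$, $X\sim P_\theta$. Put $$\mathcal I(\theta)=\int_{\mathcal X}\frac{|\nabla_\theta f(x;\theta)|^2}{f(x;\theta)}\,d\lambda(x),\qquad \mathcal J(\pi)=\int_{\mathbb{R}^n}\frac{|\nabla\rho|^2}{\rho}\,d\theta,\qquad S=\mathcal J(\pi)+\int_{\mathbb{R}^n}\mathcal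 I(\theta)\,d\pi(\theta)\in[0,\infty],$$ with weak gradients, $0/0=0$, and $\mathcal J(\pi)=+\infty$ if $\rho$ is not weakly differentiable. Let $$h(\theta|X)=\mathbb E\left[-\log p(\theta|X)\right]\in[-\infty,\infty],\qquad p(\theta|x)=\frac{\rho(\theta)f(x;\theta)}{\int f(x;\theta')\,d\pi(\theta')},$$ be the conditional differential entropy (set to $-\infty$ if both the positive and the negative part of $-\log p(\theta|X)$ have infinite expectation). Then: 1. If $S<\infty$, then the negative part of $-\log p(\theta|X)$ has finite expectation, so that $h(\theta|X)$ is well defined and $h(\theta|X)>-\infty$. 2. If $S<\infty$ or $h(\theta|X)>-\infty$, then $$1+\log(2\pi e)\le\frac2n h(\theta|X)+\frac1n\Big(\mathcal J(\pi)+\int\mathcal I\,d\pi\Big),$$ and in particular $1+\log(2\pi e)\le\frac2n h(\theta|X)+\mathcal J(\pi)+\int\mathcal I\,d\pi$. 3. (Multidimensional Efroimovich inequality) $$\frac1{2\pi e}\exp\Big(\frac2n h(\theta|X)\Big)\ge\frac{n}{\mathcal J(\pi)+\int\mathcal I\,d\pi},$$ where the right-hand side is $0$ if $S=\infty$. 4.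 This implies the van Trees inequality: for every measurable estimator $\hat\theta:\mathcal X\to\mathbb{R}^n$, $$\frac1n\,\mathbb E|\theta-\hat\theta(X)|^2\ge\frac1{2\pi e}\exp\Big(\frac2n h(\theta|X)\Big),\qquad\text{hence}\qquad \mathbb E|\theta-\hat\theta(X)|^2\ge\frac{n^2}{\mathcal J(\pi)+\int\mathcal I\,d\pi}.$$ For $n=1$ the last inequality is $\mathbb E(\theta-\hat\theta(X))^2\ge 1/(\mathcal J(\pi)+\int\mathcal I\,d\pi)$. -/

import Mathlib

open MeasureTheory
open scoped ENNReal ContDiff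

namespace BayesCR

/-- `g` is the (weak, i.e. distributional) gradient of `u : ℝⁿ → ℝ`: both are locally integrable and
`∫ u ∂ᵥφ = - ∫ φ ⟪g, v⟫` for every test function `φ ∈ C_c^∞(ℝⁿ)` and every direction `v`. -/
def HasWeakGradient {n : ℕ} (u : EuclideanSpace ℝ (Fin n) → ℝ)
    (g : EuclideanSpace ℝ (Fin n) → EuclideanSpace ℝ (Fin n)) : Prop :=
  LocallyIntegrable u volume ∧ LocallyIntegrable g volume ∧
    ∀ φ : EuclideanSpace ℝ (Fin n) → ℝ, ContDiff ℝ ∞ φ → HasCompactSupport φ →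
      ∀ v : EuclideanSpace ℝ (Fin n),
        ∫ θ, u θ * fderiv ℝ φ θ v = - ∫ θ, φ θ * inner ℝ (g θ) v

/-- A weak gradient is unique almost everywhere. -/
theorem HasWeakGradient.ae_eq {n : ℕ} {u : EuclideanSpace ℝ (Fin n) → ℝ}
    {g g' : EuclideanSpace ℝ (Fin n) → EuclideanSpace ℝ (Fin n)}
    (h : HasWeakGradient u g) (h' : HasWeakGradient u g') : g =ᵐ[volume] g' := by
  have key : ∀ᵐ θ ∂(volume : Measure (EuclideanSpace ℝ (Fin n))), g θ - g' θ = 0 := by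
    refine ae_eq_zero_of_integral_contDiff_smul_eq_zero (h.2.1.sub h'.2.1) ?_
    intro φ hφ hc
    have i1 : Integrable (fun θ => φ θ • g θ) volume :=
      h.2.1.integrable_smul_left_of_hasCompactSupport hφ.continuous hc
    have i2 : Integrable (fun θ => φ θ • g' θ) volume :=
      h'.2.1.integrable_smul_left_of_hasCompactSupport hφ.continuous hc
    have e : ∫ θ, φ θ • g θ = ∫ θ, φ θ • g' θ := by
      refine ext_inner_left ℝ fun v => ?_
      rw [← integral_inner i1, ← integral_inner i2]
      have a := h.2.2 φ hφ hc v
      have b := h'.2.2 φ hφ hc v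
      simp only [inner_smul_right, real_inner_comm] at *
      linarith
    simp only [smul_sub]
    rw [integral_sub i1 i2, e, sub_self]
  filter_upwards [key] with θ hθ using sub_eq_zero.mp hθ

/-- A density of `π` with respect to Lebesgue measure on `ℝⁿ` (for `π ≪ volume`). -/
noncomputable def priorDensity {n : ℕ} (π : Measure (EuclideanSpace ℝ (Fin n)))
    (θ : EuclideanSpace ℝ (Fin n)) : ℝ :=
  (π.rnDeriv volume θ).toReal

/-- The Fisher information `𝒥(π) = ∫ |∇ρ|² / ρ ∈ [0, ∞]` of a measure `π` on `ℝⁿ` with Lebesgue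
density `ρ`, where `∇ρ` is the weak gradient. As the weak gradient is unique almost everywhere, the
infimum is over a single value, and it is `∞` if `ρ` is not weakly differentiable. In `[0, ∞]` one
has `0 / 0 = 0` and `a / 0 = ∞` for `a > 0`. -/
noncomputable def priorFisherInfo {n : ℕ} (π : Measure (EuclideanSpace ℝ (Fin n))) : ℝ≥0∞ :=
  ⨅ (g : EuclideanSpace ℝ (Fin n) → EuclideanSpace ℝ (Fin n))
    (_ : HasWeakGradient (priorDensity π) g),
    ∫⁻ θ, ENNReal.ofReal (‖g θ‖ ^ 2) / ENNReal.ofReal (priorDensity π θ)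

theorem priorFisherInfo_eq {n : ℕ} (π : Measure (EuclideanSpace ℝ (Fin n)))
    (g : EuclideanSpace ℝ (Fin n) → EuclideanSpace ℝ (Fin n))
    (hg : HasWeakGradient (priorDensity π) g) :
    priorFisherInfo π =
      ∫⁻ θ, ENNReal.ofReal (‖g θ‖ ^ 2) / ENNReal.ofReal (priorDensity π θ) := by
  refine le_antisymm (iInf₂_le g hg) (le_iInf₂ fun g' hg' => le_of_eq ?_)
  refine lintegral_congr_ae ?_
  filter_upwards [hg.ae_eq hg'] with θ hθ
  rw [hθ]

section Family

variable {n : ℕ} {𝓧 : Type*} [MeasurableSpace 𝓧]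

/-- The Fisher information `𝓘(θ) = ∫ |∇_θ f(x;θ)|² / f(x;θ) dλ(x) ∈ [0, ∞]` of the parametric family
with densities `f` with respect to `lam`, where `g x θ = ∇_θ f(x;θ)`. -/
noncomputable def familyFisherInfo (lam : Measure 𝓧) (f : 𝓧 → EuclideanSpace ℝ (Fin n) → ℝ)
    (g : 𝓧 → EuclideanSpace ℝ (Fin n) → EuclideanSpace ℝ (Fin n))
    (θ : EuclideanSpace ℝ (Fin n)) : ℝ≥0∞ :=
  ∫⁻ x, ENNReal.ofReal (‖g x θ‖ ^ 2) / ENNReal.ofReal (f x θ) ∂lam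

/-- The total information `𝒥(π) + ∫ 𝓘(θ) dπ(θ) ∈ [0, ∞]`. -/
noncomputable def totalInfo (lam : Measure 𝓧) (f : 𝓧 → EuclideanSpace ℝ (Fin n) → ℝ)
    (g : 𝓧 → EuclideanSpace ℝ (Fin n) → EuclideanSpace ℝ (Fin n))
    (π : Measure (EuclideanSpace ℝ (Fin n))) : ℝ≥0∞ :=
  priorFisherInfo π + ∫⁻ θ, familyFisherInfo lam f g θ ∂π

/-- The conditional Lebesgue density of `θ` given `X = x`,
`p(θ|x) = ρ(θ) f(x;θ) / ∫ f(x;θ') dπ(θ')`. -/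
noncomputable def posteriorDensity (f : 𝓧 → EuclideanSpace ℝ (Fin n) → ℝ)
    (π : Measure (EuclideanSpace ℝ (Fin n))) (x : 𝓧) (θ : EuclideanSpace ℝ (Fin n)) : ℝ :=
  priorDensity π θ * f x θ / ∫ θ', f x θ' ∂π

/-- The positive part `𝔼 [(- log p(θ|X))⁺]` of the conditional entropy, under the joint law
`f(x;θ) dλ(x) dπ(θ)` of `(θ, X)`. -/
noncomputable def condEntropyPos (lam : Measure 𝓧) (f : 𝓧 → EuclideanSpace ℝ (Fin n) → ℝ)
    (π : Measure (EuclideanSpace ℝ (Fin n))) : ℝ≥0∞ :=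
  ∫⁻ x, ∫⁻ θ, ENNReal.ofReal (f x θ) *
    ENNReal.ofReal (- Real.log (posteriorDensity f π x θ)) ∂π ∂lam

/-- The negative part `𝔼 [(- log p(θ|X))⁻]` of the conditional entropy. -/
noncomputable def condEntropyNeg (lam : Measure 𝓧) (f : 𝓧 → EuclideanSpace ℝ (Fin n) → ℝ)
    (π : Measure (EuclideanSpace ℝ (Fin n))) : ℝ≥0∞ :=
  ∫⁻ x, ∫⁻ θ, ENNReal.ofReal (f x θ) *
    ENNReal.ofReal (Real.log (posteriorDensity f π x θ)) ∂π ∂lam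

/-- The conditional differential entropy `h(θ|X) = 𝔼 [- log p(θ|X)] ∈ [-∞, ∞]`. If the positive and
the negative part are both infinite, the value is `-∞`. -/
noncomputable def condEntropy (lam : Measure 𝓧) (f : 𝓧 → EuclideanSpace ℝ (Fin n) → ℝ)
    (π : Measure (EuclideanSpace ℝ (Fin n))) : EReal :=
  (condEntropyPos lam f π : EReal) - (condEntropyNeg lam f π : EReal)

/-- The entropy power `(1 / (2πe)) exp ((2 / n) h(θ|X)) ∈ [0, ∞]`. -/
noncomputable def condEntropyPower (lam : Measure 𝓧) (f : 𝓧 → EuclideanSpace ℝ (Fin n) → ℝ)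
    (π : Measure (EuclideanSpace ℝ (Fin n))) : ℝ≥0∞ :=
  ENNReal.ofReal (1 / (2 * Real.pi * Real.exp 1)) *
    EReal.exp (((2 / n : ℝ) : EReal) * condEntropy lam f π)

/-- The Bayes mean square error `𝔼 |θ - T(X)|² ∈ [0, ∞]` of an estimator `T`. -/
noncomputable def bayesMSE (lam : Measure 𝓧) (f : 𝓧 → EuclideanSpace ℝ (Fin n) → ℝ)
    (π : Measure (EuclideanSpace ℝ (Fin n))) (T : 𝓧 → EuclideanSpace ℝ (Fin n)) : ℝ≥0∞ :=
  ∫⁻ θ, ∫⁻ x, ENNReal.ofReal (‖θ - T x‖ ^ 2) * ENNReal.ofReal (f x θ) ∂lam ∂π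

end Family

end BayesCR

namespace BayesCR

open Filter Topology Set

/-! ### The one-dimensional Euclidean logarithmic Sobolev inequality -/

/-! Write `q_x(θ) = ρ(θ) f(x;θ)` for the joint density and `m(x)` for its mass in `θ`, so that `q_x
/ m(x)` is the posterior density. The lower bound on the entropy is the Euclidean logarithmic
Sobolev inequality, applied to the posterior for almost every `x` and averaged over `x`. It is used
in a linearised form: a probability density `p` on `ℝⁿ` with Fisher information `J` satisfies `∫ p
log p ≤ b² J / 2 - n · lsiConst b` for every scale `b > 0`. Linearity in `J` is what makes averaging
possible; choosing `b` only after averaging gives the sharp power form.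

The averaged Fisher information of `q_x` is exactly `S` (`lintegral_joint_fisher`). The gradient of
`q_x` is `f ∇ρ + ρ ∇f`; the two squares give `𝒥(π)` and `∫ 𝓘 dπ`, and the cross term `2 ⟪∇ρ, ∫ ∇f
dλ⟫` vanishes by the regularity condition.

The logarithmic Sobolev inequality is proved in dimension one by monotone transport to the standard
Gaussian (`integral_mul_log_div_le`). It is tensorised by the chain rule for entropy and the
decrease of Fisher information under marginalisation (`HasCompactPartials.integral_mul_log_le`),
then extended to weakly differentiable densities by mollification and cutoff
(`HasFiniteFisherInfo.integral_mul_log_le`). This last form needs `p log p` to be integrable. The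
part where `log p > 0` is controlled by `J` alone (`HasFiniteFisherInfo.integral_mul_posLog_le`),
which also gives the finiteness of the negative part of the entropy; if the part where `log p < 0`
diverges, the inequality is trivial.

The upper bound on the entropy is Gibbs' inequality against a Gaussian centred at the estimator
(`condEntropy_le`). Together the two bounds give the van Trees inequality.

Signed quantities are split into positive and negative parts in `[0, ∞]`, each placed on the side
where it enters with a plus sign. Averages over `x` then need only monotonicity and Tonelli, and
cancellations are postponed until finiteness is known. -/

theorem setIntegral_Iic_eq_add_intervalIntegral {h : ℝ → ℝ} (hi : Integrable h) (x : ℝ) :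
    ∫ t in Iic x, h t = (∫ t in Iic 0, h t) + ∫ t in (0 : ℝ)..x, h t := by
  have := intervalIntegral.integral_Iic_sub_Iic (a := 0) (b := x) hi.integrableOn hi.integrableOn
  linarith

theorem hasDerivAt_setIntegral_Iic {h : ℝ → ℝ} (hc : Continuous h) (hi : Integrable h) (x : ℝ) :
    HasDerivAt (fun x => ∫ t in Iic x, h t) (h x) x := by
  rw [funext (setIntegral_Iic_eq_add_intervalIntegral hi)]
  exact (intervalIntegral.integral_hasDerivAt_right (hc.intervalIntegrable _ _)
    (hc.stronglyMeasurableAtFilter _ _) hc.continuousAt).const_add _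

theorem tendsto_setIntegral_Iic_atTop {h : ℝ → ℝ} (hi : Integrable h) :
    Tendsto (fun x => ∫ t in Iic x, h t) atTop (𝓝 (∫ t, h t)) := by
  rw [funext (setIntegral_Iic_eq_add_intervalIntegral hi),
    ← intervalIntegral.integral_Iic_add_Ioi (b := 0) hi.integrableOn hi.integrableOn]
  exact tendsto_const_nhds.add
    (intervalIntegral_tendsto_integral_Ioi 0 hi.integrableOn tendsto_id)

theorem tendsto_setIntegral_Iic_atBot {h : ℝ → ℝ} (hi : Integrable h) :
    Tendsto (fun x => ∫ t in Iic x, h t) atBot (𝓝 0) := by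
  rw [funext (setIntegral_Iic_eq_add_intervalIntegral hi)]
  have := (intervalIntegral_tendsto_integral_Iic 0 (hi.integrableOn (s := Iic 0)) tendsto_id).neg
  have h2 := this.const_add (∫ t in Iic 0, h t)
  rw [add_neg_cancel] at h2
  refine h2.congr fun x => ?_
  rw [← intervalIntegral.integral_symm]; rfl

/-- The quantile function of a strictly positive continuous probability density. -/
theorem exists_quantile {w : ℝ → ℝ} (hc : Continuous w) (hi : Integrable w) (h1 : ∫ t, w t = 1)
    (hpos : ∀ x, 0 < w x) :
    ∃ G : ℝ → ℝ, ∀ u ∈ Ioo (0 : ℝ) 1, HasDerivAt G (w (G u))⁻¹ u := by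
  set Φ : ℝ → ℝ := fun x => ∫ t in Iic x, w t with hΦ
  have hd : ∀ x, HasDerivAt Φ (w x) x := hasDerivAt_setIntegral_Iic hc hi
  have hmono : StrictMono Φ := strictMono_of_hasDerivAt_pos hd hpos
  have hcont : Continuous Φ := continuous_iff_continuousAt.2 fun x => (hd x).continuousAt
  have htop : Tendsto Φ atTop (𝓝 1) := h1 ▸ tendsto_setIntegral_Iic_atTop hi
  have hbot : Tendsto Φ atBot (𝓝 0) := tendsto_setIntegral_Iic_atBot hi
  have hsurj : ∀ u ∈ Ioo (0 : ℝ) 1, ∃ x, Φ x = u := by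
    intro u hu
    obtain ⟨a, ha⟩ := (hbot.eventually (gt_mem_nhds hu.1)).exists
    obtain ⟨b, hb⟩ := (htop.eventually (lt_mem_nhds hu.2)).exists
    exact mem_range_of_exists_le_of_exists_ge hcont ⟨a, ha.le⟩ ⟨b, hb.le⟩
  have hrange : ∀ x, Φ x ∈ Ioo (0 : ℝ) 1 := by
    intro x
    constructor
    · have : 0 ≤ Φ (x - 1) := setIntegral_nonneg measurableSet_Iic fun t _ => (hpos t).le
      exact this.trans_lt (hmono (by linarith))
    · have h2 := hmono.monotone.ge_of_tendsto htop (x + 1)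
      exact (hmono (by linarith : x < x + 1)).trans_le h2
  choose! G hG using hsurj
  have hGmono : StrictMonoOn G (Ioo 0 1) := fun u hu v hv huv => by
    rw [← hmono.lt_iff_lt, hG u hu, hG v hv]; exact huv
  have himg : G '' Ioo 0 1 = univ := by
    refine eq_univ_of_forall fun x => ⟨Φ x, hrange x, hmono.injective (hG _ (hrange x))⟩
  -- `G` is strictly increasing on `(0, 1)` and its image is all of `ℝ`, so it has no jumps;
  -- continuity is all that the inverse function rule still needs.
  refine ⟨G, fun u hu => ?_⟩
  have hn : Ioo (0 : ℝ) 1 ∈ 𝓝 u := Ioo_mem_nhds hu.1 hu.2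
  refine HasDerivAt.of_local_left_inverse ?_ (hd (G u)) (hpos _).ne' ?_
  · exact hGmono.continuousAt_of_image_mem_nhds hn (by rw [himg]; exact univ_mem)
  · filter_upwards [hn] with y hy using hG y hy

/-- The constant `1 + (1/2) log (2 π b²)` of the one-dimensional Euclidean logarithmic Sobolev
inequality at scale `b`. -/
noncomputable def lsiConst (b : ℝ) : ℝ := 1 + Real.log (2 * Real.pi) / 2 + Real.log b

/-- A zero of a nonnegative function is a minimum. This makes the convention `0 / 0 = 0` harmless in
`q'² / q`. -/
theorem eq_zero_of_hasDerivAt_of_nonneg {q : ℝ → ℝ} {q' x : ℝ} (h0 : ∀ t, 0 ≤ q t)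
    (hd : HasDerivAt q q' x) (hx : q x = 0) : q' = 0 :=
  IsLocalMin.hasDerivAt_eq_zero (Eventually.of_forall fun t => by rw [hx]; exact h0 t) hd

/-- Let `T` be the increasing map pushing `q / m` to the Gaussian density `w`, up to the loss `δ`.
Then `w(T) T' = (1 - 2δ) q / m`, so `log (q / m)` is `log w(T) + log T'` up to a constant. The
tangent-line bound on `log T'`, integration by parts and Young's inequality turn the terms in `T`
into `∫ q'² / q`. -/
theorem integral_mul_log_div_le_aux {q q' : ℝ → ℝ} {b δ : ℝ} (hb : 0 < b) (hδ : 0 < δ)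
    (hδ' : δ < 1 / 2)
    (h0 : ∀ t, 0 ≤ q t) (hd : ∀ t, HasDerivAt q (q' t) t) (hc : HasCompactSupport q)
    (hq' : Continuous q') (hF : Integrable fun t => q' t ^ 2 / q t) (hm : 0 < ∫ t, q t) :
    ∫ t, q t * Real.log (q t / ∫ s, q s) ≤
      b ^ 2 / 2 * (∫ t, q' t ^ 2 / q t) - (lsiConst b + Real.log (1 - 2 * δ)) * ∫ t, q t := by
  set m := ∫ s, q s with hmdef
  have hqc : Continuous q := continuous_iff_continuousAt.2 fun x => (hd x).continuousAt
  have hqi : Integrable q := hqc.integrable_of_hasCompactSupport hc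
  set w : ℝ → ℝ := ProbabilityTheory.gaussianPDFReal 0 1 with hw
  have hwc : Continuous w := by
    rw [hw, ProbabilityTheory.gaussianPDFReal_def]; fun_prop
  have hwpos : ∀ x, 0 < w x := fun x => ProbabilityTheory.gaussianPDFReal_pos 0 1 x one_ne_zero
  have hwlog : ∀ x, Real.log (w x) = - (Real.log (2 * Real.pi) / 2) - x ^ 2 / 2 := by
    intro x
    rw [hw, ProbabilityTheory.gaussianPDFReal_def]
    simp only [NNReal.coe_one, mul_one, sub_zero]
    rw [Real.log_mul (by positivity) (by positivity), Real.log_exp, Real.log_inv,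
      Real.log_sqrt (by positivity)]
    ring
  obtain ⟨G, hG⟩ := exists_quantile hwc (ProbabilityTheory.integrable_gaussianPDFReal 0 1)
    (ProbabilityTheory.integral_gaussianPDFReal_eq_one 0 one_ne_zero) hwpos
  have hcoef : 0 < 1 - 2 * δ := by linarith
  set Q : ℝ → ℝ := fun x => ∫ t in Iic x, q t with hQ
  have hQd : ∀ x, HasDerivAt Q (q x) x := hasDerivAt_setIntegral_Iic hqc hqi
  have hQ0 : ∀ x, 0 ≤ Q x := fun x => setIntegral_nonneg measurableSet_Iic fun t _ => h0 t
  have hQ1 : ∀ x, Q x ≤ m := fun x =>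
    setIntegral_le_integral hqi (Eventually.of_forall h0)
  -- Squeezing the distribution function into `[δ, 1 - δ]` keeps the Gaussian quantile finite, also
  -- outside the support of `q`. Hence `T` is `C¹` on the whole line and the integration by parts
  -- has no boundary terms.
  set U : ℝ → ℝ := fun x => δ + (1 - 2 * δ) / m * Q x with hU
  have hUd : ∀ x, HasDerivAt U ((1 - 2 * δ) / m * q x) x := fun x =>
    ((hQd x).const_mul _).const_add _
  have hUmem : ∀ x, U x ∈ Ioo (0 : ℝ) 1 := by
    intro x
    have h1 : 0 ≤ (1 - 2 * δ) / m * Q x := by have := hQ0 x; positivity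
    have h2 : (1 - 2 * δ) / m * Q x ≤ 1 - 2 * δ := by
      rw [div_mul_eq_mul_div, div_le_iff₀ hm]
      exact mul_le_mul_of_nonneg_left (hQ1 x) hcoef.le
    constructor <;> simp only [hU] <;> linarith
  set T : ℝ → ℝ := fun x => G (U x) with hT
  set T' : ℝ → ℝ := fun x => (w (T x))⁻¹ * ((1 - 2 * δ) / m * q x) with hT'
  have hTd : ∀ x, HasDerivAt T (T' x) x := fun x => (hG _ (hUmem x)).comp x (hUd x)
  have hTc : Continuous T := continuous_iff_continuousAt.2 fun x => (hTd x).continuousAt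
  have hT'c : Continuous T' :=
    ((hwc.comp hTc).inv₀ fun x => (hwpos _).ne').mul (continuous_const.mul hqc)
  have hq'c : HasCompactSupport q' := by
    have : q' = deriv q := funext fun t => (hd t).deriv.symm
    rw [this]; exact hc.deriv
  have i1 : Integrable (fun x => q x * T' x) :=
    (hqc.mul hT'c).integrable_of_hasCompactSupport hc.mul_right
  have i2 : Integrable (fun x => q' x * T x) :=
    (hq'.mul hTc).integrable_of_hasCompactSupport hq'c.mul_right
  have i3 : Integrable (fun x => q x * T x) :=
    (hqc.mul hTc).integrable_of_hasCompactSupport hc.mul_right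
  have i4 : Integrable (fun x => q x * T x ^ 2) :=
    (hqc.mul (hTc.pow 2)).integrable_of_hasCompactSupport hc.mul_right
  have hibp : ∫ x, q x * T' x = - ∫ x, q' x * T x :=
    integral_mul_deriv_eq_deriv_mul_of_integrable (fun x _ => hd x) (fun x _ => hTd x) i1 i2 i3
  have hlogi : Integrable fun t => q t * Real.log (q t / m) := by
    have e : (fun t => q t * Real.log (q t / m)) =
        fun t => q t * Real.log (q t) - Real.log m * q t := by
      funext t
      rcases (h0 t).eq_or_lt with h | h
      · simp [← h]
      · rw [Real.log_div h.ne' hm.ne']; ring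
    rw [e]
    refine Integrable.sub ?_ (hqi.const_mul _)
    refine (Real.continuous_mul_log.comp hqc).integrable_of_hasCompactSupport ?_
    exact hc.comp_left (g := fun x => x * Real.log x) (by simp)
  have hpt : ∀ x, q x * Real.log (q x / m) ≤
      -(lsiConst b + Real.log (1 - 2 * δ)) * q x - q x * T x ^ 2 / 2 + b * (q x * T' x) := by
    intro x
    rcases (h0 x).eq_or_lt with h | h
    · simp [← h]
    · have hT'pos : 0 < T' x := by have := hwpos (T x); simp only [hT']; positivity
      have e1 : q x / m = w (T x) * T' x / (1 - 2 * δ) := by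
        have := (hwpos (T x)).ne'
        simp only [hT']; field_simp
      have e2 : Real.log (q x / m) = Real.log (w (T x)) + Real.log (T' x)
          - Real.log (1 - 2 * δ) := by
        rw [e1, Real.log_div (mul_ne_zero (hwpos _).ne' hT'pos.ne') hcoef.ne',
          Real.log_mul (hwpos _).ne' hT'pos.ne']
      -- This is `log s ≤ s - 1` at `s = b T'`; the scale `b` enters only here and in the matching
      -- Young inequality.
      have e3 : Real.log (T' x) ≤ b * T' x - 1 - Real.log b := by
        have := Real.log_le_sub_one_of_pos (mul_pos hb hT'pos)
        rw [Real.log_mul hb.ne' hT'pos.ne'] at this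
        linarith
      have e4 : Real.log (q x / m) ≤
          -(lsiConst b + Real.log (1 - 2 * δ)) - T x ^ 2 / 2 + b * T' x := by
        rw [e2, hwlog]; unfold lsiConst; linarith
      calc q x * Real.log (q x / m) ≤ q x * (-(lsiConst b + Real.log (1 - 2 * δ)) -
            T x ^ 2 / 2 + b * T' x) := mul_le_mul_of_nonneg_left e4 h.le
        _ = _ := by ring
  -- Young's inequality, weighted so that `q T² / 2` is exactly what the Gaussian exponent subtracts
  -- in `hpt`: the transport map drops out of the sum.
  have hpt2 : ∀ x, - (b * (q' x * T x)) ≤ q x * T x ^ 2 / 2 + b ^ 2 / 2 * (q' x ^ 2 / q x) := by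
    intro x
    rcases (h0 x).eq_or_lt with h | h
    · have := eq_zero_of_hasDerivAt_of_nonneg h0 (hd x) h.symm
      simp [← h, this]
    · have e : q x * T x ^ 2 / 2 + b ^ 2 / 2 * (q' x ^ 2 / q x) + b * (q' x * T x)
          = (q x * T x + b * q' x) ^ 2 / (2 * q x) := by field_simp; ring
      have : 0 ≤ (q x * T x + b * q' x) ^ 2 / (2 * q x) := by positivity
      linarith
  have j1 : ∫ t, q t * Real.log (q t / m) ≤ ∫ x,
      (-(lsiConst b + Real.log (1 - 2 * δ)) * q x - q x * T x ^ 2 / 2 + b * (q x * T' x)) :=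
    integral_mono hlogi (((hqi.const_mul _).sub (i4.div_const 2)).add (i1.const_mul b)) hpt
  have j2 : ∫ x, - (b * (q' x * T x)) ≤
      ∫ x, (q x * T x ^ 2 / 2 + b ^ 2 / 2 * (q' x ^ 2 / q x)) :=
    integral_mono (i2.const_mul b).neg ((i4.div_const 2).add (hF.const_mul _)) hpt2
  have k1 : Integrable fun x => -(lsiConst b + Real.log (1 - 2 * δ)) * q x - q x * T x ^ 2 / 2 :=
    (hqi.const_mul _).sub (i4.div_const 2)
  rw [integral_add k1 (i1.const_mul b), integral_sub (hqi.const_mul _) (i4.div_const 2),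
    integral_const_mul, integral_const_mul, hibp] at j1
  rw [integral_neg, integral_const_mul, integral_add (i4.div_const 2) (hF.const_mul _),
    integral_const_mul] at j2
  linarith

/-- The one-dimensional Euclidean logarithmic Sobolev inequality. -/
theorem integral_mul_log_div_le {q q' : ℝ → ℝ} {b : ℝ} (hb : 0 < b)
    (h0 : ∀ t, 0 ≤ q t) (hd : ∀ t, HasDerivAt q (q' t) t) (hc : HasCompactSupport q)
    (hq' : Continuous q') (hF : Integrable fun t => q' t ^ 2 / q t) :
    ∫ t, q t * Real.log (q t / ∫ s, q s) ≤
      b ^ 2 / 2 * (∫ t, q' t ^ 2 / q t) - lsiConst b * ∫ t, q t := by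
  rcases (integral_nonneg h0 : 0 ≤ ∫ t, q t).eq_or_lt with hm | hm
  · have : 0 ≤ ∫ t, q' t ^ 2 / q t := integral_nonneg fun t => div_nonneg (sq_nonneg _) (h0 t)
    simp only [← hm, div_zero, Real.log_zero, mul_zero, integral_zero]
    have := mul_nonneg (by positivity : 0 ≤ b ^ 2 / 2) this
    linarith
  have hlim : Tendsto (fun δ : ℝ => b ^ 2 / 2 * (∫ t, q' t ^ 2 / q t) -
      (lsiConst b + Real.log (1 - 2 * δ)) * ∫ t, q t) (𝓝[>] 0)
      (𝓝 (b ^ 2 / 2 * (∫ t, q' t ^ 2 / q t) - lsiConst b * ∫ t, q t)) := by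
    have : ContinuousAt (fun δ : ℝ => b ^ 2 / 2 * (∫ t, q' t ^ 2 / q t) -
      (lsiConst b + Real.log (1 - 2 * δ)) * ∫ t, q t) 0 := by
      have : ContinuousAt (fun δ : ℝ => Real.log (1 - 2 * δ)) 0 :=
        ContinuousAt.log (by fun_prop) (by norm_num)
      fun_prop
    have h2 := this.tendsto
    simp only [mul_zero, sub_zero, Real.log_one, add_zero] at h2
    exact h2.mono_left nhdsWithin_le_nhds
  refine ge_of_tendsto hlim ?_
  filter_upwards [Ioo_mem_nhdsGT (by norm_num : (0 : ℝ) < 1 / 2)] with δ hδ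
  exact integral_mul_log_div_le_aux hb hδ.1 hδ.2 h0 hd hc hq' hF hm

end BayesCR

namespace BayesCR

open Filter Topology Set

/-! ### The Euclidean logarithmic Sobolev inequality for smooth compactly supported densities -/

/-- A nonnegative continuous compactly supported function `p` on `ℝⁿ` with continuous compactly
supported partial derivatives `D i`. -/
structure HasCompactPartials {n : ℕ} (p : (Fin n → ℝ) → ℝ) (D : Fin n → (Fin n → ℝ) → ℝ) :
    Prop where
  nonneg : ∀ x, 0 ≤ p x
  continuous : Continuous p
  hasCompactSupport : HasCompactSupport p
  continuous_partial : ∀ i, Continuous (D i)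
  hasCompactSupport_partial : ∀ i, HasCompactSupport (D i)
  hasDerivAt : ∀ x i, HasDerivAt (fun t => p (Function.update x i t)) (D i x) (x i)

/-! ### Splitting off the first coordinate: slices and marginals. -/

section Marginal

variable {n : ℕ} {h : (Fin (n + 1) → ℝ) → ℝ}

theorem measurePreserving_finCons (n : ℕ) :
    MeasurePreserving (fun w : ℝ × (Fin n → ℝ) => (Fin.cons w.1 w.2 : Fin (n + 1) → ℝ)) := by
  have := (volume_preserving_piFinSuccAbove (fun _ : Fin (n + 1) => ℝ) 0).symm
  convert! this using 1
  funext w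
  simp [MeasurableEquiv.piFinSuccAbove, Fin.insertNthEquiv]

theorem integrable_comp_finCons (hi : Integrable h) :
    Integrable fun w : ℝ × (Fin n → ℝ) => h (Fin.cons w.1 w.2) :=
  ((measurePreserving_finCons n).integrable_comp hi.aestronglyMeasurable).2 hi

theorem integral_eq_integral_integral_finCons (hi : Integrable h) :
    ∫ x, h x = ∫ y : Fin n → ℝ, ∫ z : ℝ, h (Fin.cons z y) := by
  have e := (volume_preserving_piFinSuccAbove (fun _ : Fin (n + 1) => ℝ) 0).symm.integral_comp'
    (g := h)
  rw [← e]
  have : ∀ w : ℝ × (Fin n → ℝ), (MeasurableEquiv.piFinSuccAbove (fun _ : Fin (n + 1) => ℝ) 0).symm w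
      = Fin.cons w.1 w.2 := fun w => by
    simp [MeasurableEquiv.piFinSuccAbove, Fin.insertNthEquiv]
  simp_rw [this]
  exact integral_prod_symm _ (integrable_comp_finCons hi)

theorem integrable_marginal (hi : Integrable h) :
    Integrable fun y : Fin n → ℝ => ∫ z : ℝ, h (Fin.cons z y) :=
  (integrable_comp_finCons hi).integral_prod_right

theorem ae_integrable_slice (hi : Integrable h) :
    ∀ᵐ y : Fin n → ℝ, Integrable fun z : ℝ => h (Fin.cons z y) :=
  (integrable_comp_finCons hi).prod_left_ae

theorem exists_bound_finCons (hc : HasCompactSupport h) :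
    ∃ R : ℝ, ∀ (z : ℝ) (y : Fin n → ℝ), R < |z| ∨ R < ‖y‖ → h (Fin.cons z y) = 0 := by
  obtain ⟨R, hR⟩ := hc.isCompact.isBounded.subset_closedBall 0
  refine ⟨R, fun z y hzy => ?_⟩
  by_contra hne
  have h1 : ‖(Fin.cons z y : Fin (n + 1) → ℝ)‖ ≤ R := by
    simpa using hR (subset_tsupport _ hne)
  rcases hzy with hz | hy
  · have := norm_le_pi_norm (Fin.cons z y : Fin (n + 1) → ℝ) 0
    simp only [Fin.cons_zero, Real.norm_eq_abs] at this
    linarith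
  · have h2 : ‖y‖ ≤ ‖(Fin.cons z y : Fin (n + 1) → ℝ)‖ :=
      (pi_norm_le_iff_of_nonneg (norm_nonneg _)).2 fun i => by
        simpa using norm_le_pi_norm (Fin.cons z y : Fin (n + 1) → ℝ) i.succ
    linarith

theorem continuous_finCons : Continuous fun w : ℝ × (Fin n → ℝ) =>
    (Fin.cons w.1 w.2 : Fin (n + 1) → ℝ) :=
  continuous_pi fun i => by
    refine Fin.cases ?_ (fun j => ?_) i
    · simpa using continuous_fst
    · simp only [Fin.cons_succ]
      exact (continuous_apply j).comp continuous_snd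

theorem hasCompactSupport_slice (hc : HasCompactSupport h) (y : Fin n → ℝ) :
    HasCompactSupport fun z : ℝ => h (Fin.cons z y) := by
  obtain ⟨R, hR⟩ := exists_bound_finCons hc
  refine HasCompactSupport.intro (isCompact_closedBall (0 : ℝ) R) fun z hz => hR z y (Or.inl ?_)
  simpa using hz

theorem hasCompactSupport_marginal (hc : HasCompactSupport h) :
    HasCompactSupport fun y : Fin n → ℝ => ∫ z : ℝ, h (Fin.cons z y) := by
  obtain ⟨R, hR⟩ := exists_bound_finCons hc
  refine HasCompactSupport.intro (isCompact_closedBall 0 R) fun y hy => ?_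
  simp only [Metric.mem_closedBall, dist_zero_right, not_le] at hy
  simp [hR _ y (Or.inr hy)]

theorem continuous_slice (hc : Continuous h) (y : Fin n → ℝ) :
    Continuous fun z : ℝ => h (Fin.cons z y) :=
  hc.comp (continuous_finCons.comp (by fun_prop : Continuous fun z : ℝ => (z, y)))

theorem continuous_marginal (hcont : Continuous h) (hc : HasCompactSupport h) :
    Continuous fun y : Fin n → ℝ => ∫ z : ℝ, h (Fin.cons z y) := by
  obtain ⟨R, hR⟩ := exists_bound_finCons hc
  have e : (fun y : Fin n → ℝ => ∫ z : ℝ, h (Fin.cons z y)) =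
      fun y => ∫ z in Metric.closedBall (0 : ℝ) R, h (Fin.cons z y) := by
    funext y
    refine (setIntegral_eq_integral_of_forall_compl_eq_zero fun z hz => hR z y (Or.inl ?_)).symm
    simpa using hz
  rw [e]
  refine continuous_parametric_integral_of_continuous
    (f := fun (y : Fin n → ℝ) (z : ℝ) => h (Fin.cons z y)) ?_ (isCompact_closedBall _ _)
  exact hcont.comp (continuous_finCons.comp continuous_swap)

end Marginal

namespace HasCompactPartials

variable {n : ℕ}

theorem hasDerivAt_update {p : (Fin n → ℝ) → ℝ} {D : Fin n → (Fin n → ℝ) → ℝ}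
    (hp : HasCompactPartials p D) (x : Fin n → ℝ) (i : Fin n) (t : ℝ) :
    HasDerivAt (fun s => p (Function.update x i s)) (D i (Function.update x i t)) t := by
  have := hp.hasDerivAt (Function.update x i t) i
  simpa using this

theorem eq_zero {p : (Fin n → ℝ) → ℝ} {D : Fin n → (Fin n → ℝ) → ℝ}
    (hp : HasCompactPartials p D) {x : Fin n → ℝ} (i : Fin n) (hx : p x = 0) : D i x = 0 :=
  eq_zero_of_hasDerivAt_of_nonneg (fun t => hp.nonneg _) (hp.hasDerivAt x i) (by simpa using hx)

variable {p : (Fin (n + 1) → ℝ) → ℝ} {D : Fin (n + 1) → (Fin (n + 1) → ℝ) → ℝ}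

theorem hasDerivAt_slice (hp : HasCompactPartials p D) (y : Fin n → ℝ) (z : ℝ) :
    HasDerivAt (fun z => p (Fin.cons z y)) (D 0 (Fin.cons z y)) z := by
  have := hp.hasDerivAt (Fin.cons z y) 0
  simpa using this

/-- Stability under integrating out a coordinate is what lets the induction on the dimension run.
Differentiation under the integral is dominated by a constant on a fixed ball that contains the
support of every slice of the partial derivative. -/
theorem marginal (hp : HasCompactPartials p D) :
    HasCompactPartials (fun y : Fin n → ℝ => ∫ z : ℝ, p (Fin.cons z y))
      (fun i y => ∫ z : ℝ, D i.succ (Fin.cons z y)) where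
  nonneg y := integral_nonneg fun z => hp.nonneg _
  continuous := continuous_marginal hp.continuous hp.hasCompactSupport
  hasCompactSupport := hasCompactSupport_marginal hp.hasCompactSupport
  continuous_partial i :=
    continuous_marginal (hp.continuous_partial _) (hp.hasCompactSupport_partial _)
  hasCompactSupport_partial i := hasCompactSupport_marginal (hp.hasCompactSupport_partial _)
  hasDerivAt y i := by
    obtain ⟨R, hR⟩ := exists_bound_finCons (hp.hasCompactSupport_partial i.succ)
    obtain ⟨C, hC⟩ := (hp.hasCompactSupport_partial i.succ).exists_bound_of_continuous
      (hp.continuous_partial i.succ)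
    have hint : ∀ {k : (Fin (n + 1) → ℝ) → ℝ}, Continuous k → HasCompactSupport k →
        ∀ y : Fin n → ℝ, Integrable fun z : ℝ => k (Fin.cons z y) := fun hk hk' y =>
      (continuous_slice hk y).integrable_of_hasCompactSupport (hasCompactSupport_slice hk' y)
    have key := hasDerivAt_integral_of_dominated_loc_of_deriv_le (μ := (volume : Measure ℝ))
      (F := fun t z => p (Fin.cons z (Function.update y i t)))
      (F' := fun t z => D i.succ (Fin.cons z (Function.update y i t)))
      (bound := (Metric.closedBall (0 : ℝ) R).indicator fun _ => C)
      (x₀ := y i) (s := univ) univ_mem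
      (Eventually.of_forall fun t => (continuous_slice hp.continuous _).aestronglyMeasurable)
      (hint hp.continuous hp.hasCompactSupport _)
      (continuous_slice (hp.continuous_partial _) _).aestronglyMeasurable
      (Eventually.of_forall fun z t _ => ?_) ?_ (Eventually.of_forall fun z t _ => ?_)
    · simpa using key.2
    · by_cases hz : z ∈ Metric.closedBall (0 : ℝ) R
      · rw [indicator_of_mem hz]; exact hC _
      · rw [indicator_of_notMem hz, hR _ _ (Or.inl (by simpa using hz)), norm_zero]
    · exact (integrable_indicator_iff Metric.isClosed_closedBall.measurableSet).2
        (integrableOn_const (isCompact_closedBall _ _).measure_lt_top.ne)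
    · simpa [Fin.cons_update] using hp.hasDerivAt_update (Fin.cons z y) i.succ t

end HasCompactPartials

/-- The Cauchy-Schwarz inequality in the form `(∫ d)² / ∫ p ≤ ∫ d² / p`. -/
theorem sq_integral_div_le {α : Type*} [MeasurableSpace α] {μ : Measure α} {p d : α → ℝ}
    (hp : ∀ a, 0 ≤ p a) (hd : ∀ᵐ a ∂μ, p a = 0 → d a = 0) (hpi : Integrable p μ)
    (hdi : Integrable d μ) (hF : Integrable (fun a => d a ^ 2 / p a) μ) :
    (∫ a, d a ∂μ) ^ 2 / ∫ a, p a ∂μ ≤ ∫ a, d a ^ 2 / p a ∂μ := by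
  rcases (integral_nonneg hp : 0 ≤ ∫ a, p a ∂μ).eq_or_lt with h | h
  · rw [← h, div_zero]; exact integral_nonneg fun a => div_nonneg (sq_nonneg _) (hp a)
  -- From `(d - t p)² ≥ 0` one has `2 t d - t² p ≤ d² / p` for every `t`; this value maximises the
  -- integral of the left side.
  set t := (∫ a, d a ∂μ) / ∫ a, p a ∂μ with ht
  have key : ∫ a, (2 * t * d a - t ^ 2 * p a) ∂μ ≤ ∫ a, d a ^ 2 / p a ∂μ := by
    refine integral_mono_ae ((hdi.const_mul _).sub (hpi.const_mul _)) hF ?_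
    filter_upwards [hd] with a ha
    rcases (hp a).eq_or_lt with h' | h'
    · simp [← h', ha h'.symm]
    · rw [le_div_iff₀ h']
      nlinarith [sq_nonneg (d a - t * p a)]
  rw [integral_sub (hdi.const_mul _) (hpi.const_mul _), integral_const_mul,
    integral_const_mul] at key
  have e : (∫ a, d a ∂μ) ^ 2 / ∫ a, p a ∂μ =
      2 * t * (∫ a, d a ∂μ) - t ^ 2 * ∫ a, p a ∂μ := by
    rw [ht]; field_simp; ring
  rw [e]; exact key

/-- The Euclidean logarithmic Sobolev inequality for continuously differentiable, compactly
supported densities, in coordinates. -/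
theorem HasCompactPartials.integral_mul_log_le {b : ℝ} (hb : 0 < b) : ∀ {n : ℕ}
    {p : (Fin n → ℝ) → ℝ} {D : Fin n → (Fin n → ℝ) → ℝ}, HasCompactPartials p D →
    (∀ i, Integrable fun x => D i x ^ 2 / p x) →
    ∫ x, p x * Real.log (p x) ≤ (∫ x, p x) * Real.log (∫ x, p x) +
      b ^ 2 / 2 * (∑ i, ∫ x, D i x ^ 2 / p x) - n * lsiConst b * ∫ x, p x
  | 0, p, D, hp, hF => by
    -- In dimension zero the measure is a point mass and both sides equal `p log p`.
    have : (volume : Measure (Fin 0 → ℝ)) = Measure.dirac (default : Fin 0 → ℝ) := by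
      exact Measure.volume_pi_eq_dirac _
    simp [this]
  | n + 1, p, D, hp, hF => by
    have hlogc : Continuous fun x => p x * Real.log (p x) :=
      Real.continuous_mul_log.comp hp.continuous
    have hlogs : HasCompactSupport fun x => p x * Real.log (p x) :=
      hp.hasCompactSupport.comp_left (g := fun x => x * Real.log x) (by simp)
    have hlogi := hlogc.integrable_of_hasCompactSupport hlogs (μ := volume)
    have hpi := hp.continuous.integrable_of_hasCompactSupport hp.hasCompactSupport (μ := volume)
    have hm := hp.marginal
    set p1 : (Fin n → ℝ) → ℝ := fun y => ∫ z : ℝ, p (Fin.cons z y) with hp1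
    have hslice : ∀ {k : (Fin (n + 1) → ℝ) → ℝ}, Continuous k → HasCompactSupport k →
        ∀ y : Fin n → ℝ, Integrable fun z : ℝ => k (Fin.cons z y) := fun hk hk' y =>
      (continuous_slice hk y).integrable_of_hasCompactSupport (hasCompactSupport_slice hk' y)
    -- Fisher information in the remaining coordinates does not increase when the first one is
    -- integrated out.
    have hcs : ∀ i : Fin n, ∀ᵐ y : Fin n → ℝ,
        (∫ z : ℝ, D i.succ (Fin.cons z y)) ^ 2 / p1 y ≤
          ∫ z : ℝ, D i.succ (Fin.cons z y) ^ 2 / p (Fin.cons z y) := by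
      intro i
      filter_upwards [ae_integrable_slice (hF i.succ)] with y hy
      exact sq_integral_div_le (fun z => hp.nonneg _)
        (Eventually.of_forall fun z hz => hp.eq_zero _ hz)
        (hslice hp.continuous hp.hasCompactSupport y)
        (hslice (hp.continuous_partial _) (hp.hasCompactSupport_partial _) y) hy
    have hF1 : ∀ i : Fin n, Integrable fun y : Fin n → ℝ =>
        (∫ z : ℝ, D i.succ (Fin.cons z y)) ^ 2 / p1 y := by
      intro i
      refine (integrable_marginal (hF i.succ)).mono' ?_ ?_
      · exact (((hm.continuous_partial i).measurable.pow_const 2).div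
          hm.continuous.measurable).aestronglyMeasurable
      · filter_upwards [hcs i] with y hy
        rw [Real.norm_of_nonneg (div_nonneg (sq_nonneg _) (hm.nonneg y))]
        exact hy
    have hJ1 : ∑ i : Fin n, ∫ y, (∫ z : ℝ, D i.succ (Fin.cons z y)) ^ 2 / p1 y ≤
        ∑ i : Fin n, ∫ x, D i.succ x ^ 2 / p x := by
      refine Finset.sum_le_sum fun i _ => ?_
      rw [integral_eq_integral_integral_finCons (hF i.succ)]
      exact integral_mono_ae (hF1 i) (integrable_marginal (hF i.succ)) (hcs i)
    have hih := HasCompactPartials.integral_mul_log_le hb hm hF1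
    have hmass : ∫ y, p1 y = ∫ x, p x := (integral_eq_integral_integral_finCons hpi).symm
    have hp1i : Integrable p1 := integrable_marginal hpi
    have hp1log : Integrable fun y => p1 y * Real.log (p1 y) :=
      (Real.continuous_mul_log.comp hm.continuous).integrable_of_hasCompactSupport
        (hm.hasCompactSupport.comp_left (g := fun x => x * Real.log x) (by simp))
    -- The one-dimensional inequality on a slice of mass `p1 y`. The term `p1 log p1` is the
    -- marginal entropy in the chain rule, to be bounded by the induction hypothesis; using the same
    -- `b` in every coordinate produces the factor `n`.
    have h1d : ∀ᵐ y : Fin n → ℝ, ∫ z : ℝ, p (Fin.cons z y) * Real.log (p (Fin.cons z y)) ≤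
        p1 y * Real.log (p1 y) +
          b ^ 2 / 2 * (∫ z : ℝ, D 0 (Fin.cons z y) ^ 2 / p (Fin.cons z y)) -
          lsiConst b * p1 y := by
      filter_upwards [ae_integrable_slice (hF 0)] with y hy
      have := integral_mul_log_div_le hb (fun z => hp.nonneg (Fin.cons z y))
        (fun z => hp.hasDerivAt_slice y z) (hasCompactSupport_slice hp.hasCompactSupport y)
        (continuous_slice (hp.continuous_partial 0) y) hy
      have e : ∀ z : ℝ, p (Fin.cons z y) * Real.log (p (Fin.cons z y) / p1 y) =
          p (Fin.cons z y) * Real.log (p (Fin.cons z y)) - Real.log (p1 y) * p (Fin.cons z y) := by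
        intro z
        rcases (hp.nonneg (Fin.cons z y)).eq_or_lt with h | h
        · simp [← h]
        rcases (hm.nonneg y).eq_or_lt with h' | h'
        -- A slice of mass zero vanishes identically by continuity, so division by `p1 y = 0` does
        -- no harm.
        · have h0 := (integral_eq_zero_iff_of_nonneg (fun z => hp.nonneg (Fin.cons z y))
            (hslice hp.continuous hp.hasCompactSupport y)).1 h'.symm
          have h2 := (continuous_slice hp.continuous y).ae_eq_iff_eq volume
            continuous_const |>.1 h0
          have h3 := congrFun h2 z
          change p (Fin.cons z y) = 0 at h3
          simp [h3]
        · rw [Real.log_div h.ne' h'.ne']; ring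
      change ∫ z : ℝ, p (Fin.cons z y) * Real.log (p (Fin.cons z y) / p1 y) ≤ _ at this
      simp_rw [e] at this
      rw [integral_sub (hslice hlogc hlogs y)
        ((hslice hp.continuous hp.hasCompactSupport y).const_mul _), integral_const_mul] at this
      change _ - Real.log (p1 y) * p1 y ≤ _ - lsiConst b * p1 y at this
      linarith
    have k1 : Integrable fun y : Fin n → ℝ => p1 y * Real.log (p1 y) +
        b ^ 2 / 2 * (∫ z : ℝ, D 0 (Fin.cons z y) ^ 2 / p (Fin.cons z y)) :=
      hp1log.add ((integrable_marginal (hF 0)).const_mul _)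
    have hA := integral_mono_ae (integrable_marginal hlogi) (k1.sub (hp1i.const_mul _)) h1d
    simp only [Pi.sub_apply] at hA
    rw [integral_sub k1 (hp1i.const_mul _),
      integral_add hp1log ((integrable_marginal (hF 0)).const_mul _), integral_const_mul,
      integral_const_mul, ← integral_eq_integral_integral_finCons hlogi,
      ← integral_eq_integral_integral_finCons (hF 0), hmass] at hA
    rw [hmass] at hih
    rw [Fin.sum_univ_succ]
    have hJ2 := mul_le_mul_of_nonneg_left hJ1 (by positivity : 0 ≤ b ^ 2 / 2)
    push_cast
    linarith

open scoped Gradient in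
/-- The Euclidean logarithmic Sobolev inequality for continuously differentiable, compactly
supported densities. -/
theorem integral_mul_log_le_of_contDiff {n : ℕ} {b : ℝ} (hb : 0 < b)
    {p : EuclideanSpace ℝ (Fin n) → ℝ} (h0 : ∀ x, 0 ≤ p x) (hp : ContDiff ℝ 1 p)
    (hc : HasCompactSupport p) (hF : Integrable fun x => ‖∇ p x‖ ^ 2 / p x) :
    ∫ x, p x * Real.log (p x) ≤ (∫ x, p x) * Real.log (∫ x, p x) +
      b ^ 2 / 2 * (∫ x, ‖∇ p x‖ ^ 2 / p x) - n * lsiConst b * ∫ x, p x := by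
  have hmp := PiLp.volume_preserving_toLp (Fin n)
  have hemb : MeasurableEmbedding (@WithLp.toLp 2 (Fin n → ℝ)) :=
    (MeasurableEquiv.toLp 2 (Fin n → ℝ)).measurableEmbedding
  have hint : ∀ h : EuclideanSpace ℝ (Fin n) → ℝ, ∫ x, h x = ∫ y, h (WithLp.toLp 2 y) :=
    fun h => (hmp.integral_comp hemb h).symm
  have hgrad : ∀ x i, fderiv ℝ p x (EuclideanSpace.single i 1) = ∇ p x i := by
    intro x i
    rw [← inner_gradient_left, EuclideanSpace.inner_single_right]; simp
  have hnorm : ∀ x, ‖∇ p x‖ ^ 2 / p x = ∑ i, (∇ p x i) ^ 2 / p x := by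
    intro x
    rw [EuclideanSpace.real_norm_sq_eq, Finset.sum_div]
  have hgc : Continuous (∇ p) :=
    (InnerProductSpace.toDual ℝ _).symm.continuous.comp (hp.continuous_fderiv one_ne_zero)
  have hgs : ∀ i, HasCompactSupport fun x => ∇ p x i := fun i => by
    exact (hc.fderiv ℝ).comp_left (g := fun L : EuclideanSpace ℝ (Fin n) →L[ℝ] ℝ =>
      ((InnerProductSpace.toDual ℝ _).symm L) i) (by simp)
  have hFi : ∀ i, Integrable fun x => (∇ p x i) ^ 2 / p x := by
    intro i
    refine hF.mono' ?_ (Eventually.of_forall fun x => ?_)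
    · exact ((((by fun_prop : Continuous fun x => ∇ p x i)).measurable.pow_const 2).div
        hp.continuous.measurable).aestronglyMeasurable
    · rw [Real.norm_of_nonneg (div_nonneg (sq_nonneg _) (h0 x)), hnorm]
      exact Finset.single_le_sum (f := fun i => (∇ p x i) ^ 2 / p x)
        (fun j _ => div_nonneg (sq_nonneg _) (h0 x)) (Finset.mem_univ i)
  have hcl : Topology.IsClosedEmbedding (@WithLp.toLp 2 (Fin n → ℝ)) :=
    (PiLp.homeomorph 2 _).symm.isClosedEmbedding
  have key := HasCompactPartials.integral_mul_log_le hb (p := fun y => p (WithLp.toLp 2 y))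
    (D := fun i y => ∇ p (WithLp.toLp 2 y) i)
    { nonneg := fun y => h0 _
      continuous := hp.continuous.comp hcl.continuous
      hasCompactSupport := hc.comp_isClosedEmbedding hcl
      continuous_partial := fun i => by
        have := hgc.comp hcl.continuous
        fun_prop
      hasCompactSupport_partial := fun i => (hgs i).comp_isClosedEmbedding hcl
      hasDerivAt := fun y i => by
        have e : ∀ t, p (WithLp.toLp 2 (Function.update y i t)) =
            p (WithLp.toLp 2 y + (t - y i) • EuclideanSpace.single i (1 : ℝ)) := by
          intro t
          congr 1
          ext j
          by_cases h : j = i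
          · subst h; simp
          · simp [h]
        simp_rw [e, ← hgrad]
        have h1 : HasDerivAt (fun t => WithLp.toLp 2 y + (t - y i) •
            EuclideanSpace.single i (1 : ℝ)) (EuclideanSpace.single i (1 : ℝ)) (y i) := by
          simpa using (((hasDerivAt_id (y i)).sub_const (y i)).smul_const
            (EuclideanSpace.single i (1 : ℝ))).const_add (WithLp.toLp 2 y)
        have h2 := ((hp.differentiable one_ne_zero) (WithLp.toLp 2 y)).hasFDerivAt
        refine HasFDerivAt.comp_hasDerivAt (y i) ?_ h1
        simpa using h2 }
    (fun i => (hmp.integrable_comp_emb hemb).2 (hFi i))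
  rw [hint, hint, hint fun x => ‖∇ p x‖ ^ 2 / p x]
  simp_rw [hnorm]
  have hFi' : ∀ i, Integrable fun y : Fin n → ℝ =>
      (∇ p (WithLp.toLp 2 y) i) ^ 2 / p (WithLp.toLp 2 y) := fun i =>
    (hmp.integrable_comp_emb hemb).2 (hFi i)
  rw [integral_finsetSum _ fun i _ => hFi' i]
  exact key

end BayesCR

namespace BayesCR

open Filter Topology Set
open scoped Convolution

/-! ### Mollification -/

section Mollify

variable {n : ℕ}

/-- A sequence of bump functions shrinking to the origin. -/
noncomputable def shrinkingBump (n k : ℕ) : ContDiffBump (0 : EuclideanSpace ℝ (Fin n)) where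
  rIn := 1 / (2 * (k + 1))
  rOut := 1 / (k + 1)
  rIn_pos := by positivity
  rIn_lt_rOut := by
    rw [div_lt_div_iff_of_pos_left one_pos (by positivity) (by positivity)]
    have : (0 : ℝ) < k + 1 := by positivity
    linarith

/-- The convolution of `u` with the `k`-th bump function. -/
noncomputable def mollify (k : ℕ) (u : EuclideanSpace ℝ (Fin n) → ℝ) :
    EuclideanSpace ℝ (Fin n) → ℝ :=
  (shrinkingBump n k).normed volume ⋆[ContinuousLinearMap.lsmul ℝ ℝ, volume] u

theorem tendsto_rOut_shrinkingBump : Tendsto (fun k => (shrinkingBump n k).rOut) atTop (𝓝 0) :=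
  tendsto_one_div_add_atTop_nhds_zero_nat

theorem rOut_shrinkingBump_le_one (k : ℕ) : (shrinkingBump n k).rOut ≤ 1 := by
  change 1 / ((k : ℝ) + 1) ≤ 1
  rw [div_le_one (by positivity)]
  have : (0 : ℝ) ≤ k := by positivity
  linarith

theorem ae_tendsto_mollify {u : EuclideanSpace ℝ (Fin n) → ℝ} (hu : LocallyIntegrable u) :
    ∀ᵐ x, Tendsto (fun k => mollify k u x) atTop (𝓝 (u x)) := by
  refine ContDiffBump.ae_convolution_tendsto_right_of_locallyIntegrable (K := 2)
    tendsto_rOut_shrinkingBump (Eventually.of_forall fun k => ?_) hu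
  change 1 / ((k : ℝ) + 1) ≤ 2 * (1 / (2 * (k + 1)))
  rw [mul_one_div, div_le_div_iff₀ (by positivity) (by positivity)]
  linarith

theorem contDiff_mollify {u : EuclideanSpace ℝ (Fin n) → ℝ} (hu : LocallyIntegrable u) (k : ℕ) :
    ContDiff ℝ ∞ (mollify k u) :=
  (ContDiffBump.hasCompactSupport_normed _).contDiff_convolution_left _
    (ContDiffBump.contDiff_normed _) hu

theorem mollify_apply (u : EuclideanSpace ℝ (Fin n) → ℝ) (k : ℕ) (x : EuclideanSpace ℝ (Fin n)) :
    mollify k u x = ∫ t, (shrinkingBump n k).normed volume t * u (x - t) := rfl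

theorem integrable_mollify_integrand {u : EuclideanSpace ℝ (Fin n) → ℝ}
    (hu : LocallyIntegrable u) (k : ℕ) (x : EuclideanSpace ℝ (Fin n)) :
    Integrable fun t => (shrinkingBump n k).normed volume t * u (x - t) :=
  (ContDiffBump.hasCompactSupport_normed _).convolutionExists_left
    (ContinuousLinearMap.lsmul ℝ ℝ)
    (ContDiffBump.contDiff_normed (n := 0) _).continuous hu x

theorem normed_shrinkingBump_eq_zero {k : ℕ} {t : EuclideanSpace ℝ (Fin n)} (ht : 1 < ‖t‖) :
    (shrinkingBump n k).normed volume t = 0 := by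
  rw [← Function.notMem_support, ContDiffBump.support_normed_eq]
  simp only [Metric.mem_ball, dist_zero_right, not_lt]
  exact (rOut_shrinkingBump_le_one k).trans ht.le

theorem mollify_congr {u u' : EuclideanSpace ℝ (Fin n) → ℝ} {k : ℕ}
    {x : EuclideanSpace ℝ (Fin n)} (h : ∀ y, dist y x ≤ 1 → u y = u' y) :
    mollify k u x = mollify k u' x := by
  rw [mollify_apply, mollify_apply]
  refine integral_congr_ae (Eventually.of_forall fun t => ?_)
  by_cases ht : 1 < ‖t‖
  · simp [normed_shrinkingBump_eq_zero ht]
  · simp only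
    rw [h (x - t) (by simpa [dist_eq_norm] using not_lt.1 ht)]

theorem mollify_nonneg {u : EuclideanSpace ℝ (Fin n) → ℝ} (hu : ∀ x, 0 ≤ u x) (k : ℕ)
    (x : EuclideanSpace ℝ (Fin n)) : 0 ≤ mollify k u x :=
  integral_nonneg fun _ => mul_nonneg (ContDiffBump.nonneg_normed _ _) (hu _)

theorem abs_mollify_le (u : EuclideanSpace ℝ (Fin n) → ℝ) (k : ℕ)
    (x : EuclideanSpace ℝ (Fin n)) : |mollify k u x| ≤ mollify k (fun y => |u y|) x := by
  rw [mollify_apply, mollify_apply]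
  refine (abs_integral_le_integral_abs).trans (le_of_eq ?_)
  refine integral_congr_ae (Eventually.of_forall fun _ => ?_)
  simp only
  rw [abs_mul, abs_of_nonneg (ContDiffBump.nonneg_normed _ _)]

theorem integrable_mollify {u : EuclideanSpace ℝ (Fin n) → ℝ} (hu : Integrable u) (k : ℕ) :
    Integrable (mollify k u) :=
  Integrable.integrable_convolution _ (ContDiffBump.integrable_normed _) hu

theorem integral_mollify {u : EuclideanSpace ℝ (Fin n) → ℝ} (hu : Integrable u) (k : ℕ) :
    ∫ x, mollify k u x = ∫ x, u x := by
  unfold mollify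
  rw [integral_convolution _ (ContDiffBump.integrable_normed _) hu, ContDiffBump.integral_normed]
  simp

/-- A Scheffé argument: almost everywhere convergence together with conservation of the mass of
`|h|` forces convergence in `L¹`. -/
theorem tendsto_integral_abs_mollify_sub {h : EuclideanSpace ℝ (Fin n) → ℝ} (hh : Integrable h) :
    Tendsto (fun k => ∫ x, |mollify k h x - h x|) atTop (𝓝 0) := by
  set N : EuclideanSpace ℝ (Fin n) → ℝ := fun x => |h x| with hN
  have hNi : Integrable N := hh.abs
  have hN0 : ∀ x, 0 ≤ N x := fun x => abs_nonneg _
  have hs : ∀ k, Integrable fun x => |mollify k h x - h x| := fun k =>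
    ((integrable_mollify hh k).sub hh).abs
  have hNs : ∀ k, Integrable fun x => mollify k N x - N x := fun k =>
    (integrable_mollify hNi k).sub hNi
  have hmin : ∀ k, Integrable fun x => min |mollify k h x - h x| (2 * N x) := fun k =>
    (hs k).inf (hNi.const_mul 2)
  have hmax : ∀ k, Integrable fun x => max (N x - mollify k N x) 0 := fun k =>
    (hNi.sub (integrable_mollify hNi k)).pos_part
  have hae := ae_tendsto_mollify hh.locallyIntegrable
  have haeN := ae_tendsto_mollify hNi.locallyIntegrable
  have lim1 : Tendsto (fun k => ∫ x, min |mollify k h x - h x| (2 * N x)) atTop (𝓝 0) := by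
    have := tendsto_integral_of_dominated_convergence
      (F := fun k x => min |mollify k h x - h x| (2 * N x)) (f := fun _ => (0 : ℝ)) (fun x => 2 * N x)
      (fun k => (hmin k).aestronglyMeasurable) (hNi.const_mul 2)
      (fun k => Eventually.of_forall fun x => ?_) ?_
    · simpa using this
    · rw [Real.norm_of_nonneg (le_min (abs_nonneg _) (by have := hN0 x; positivity))]
      exact min_le_right _ _
    · filter_upwards [hae] with x hx
      have h1 : Tendsto (fun k => |mollify k h x - h x|) atTop (𝓝 0) := by
        simpa using (hx.sub_const (h x)).abs
      simpa [min_eq_left (mul_nonneg zero_le_two (hN0 x))] using h1.min (tendsto_const_nhds (x := 2 * N x))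
  have lim2 : Tendsto (fun k => ∫ x, max (N x - mollify k N x) 0) atTop (𝓝 0) := by
    have := tendsto_integral_of_dominated_convergence
      (F := fun k x => max (N x - mollify k N x) 0) (f := fun _ => (0 : ℝ)) N
      (fun k => (hmax k).aestronglyMeasurable) hNi
      (fun k => Eventually.of_forall fun x => ?_) ?_
    · simpa using this
    · rw [Real.norm_of_nonneg (le_max_right _ _)]
      exact max_le (by linarith [mollify_nonneg hN0 k x]) (hN0 x)
    · filter_upwards [haeN] with x hx
      have h1 : Tendsto (fun k => N x - mollify k N x) atTop (𝓝 0) := by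
        simpa using hx.const_sub (N x)
      simpa using h1.max (tendsto_const_nhds (x := (0 : ℝ)))
  refine squeeze_zero (fun k => integral_nonneg fun x => abs_nonneg _) (fun k => ?_)
    (by simpa using lim1.add lim2)
  have hz : ∫ x, (mollify k N x - N x) = 0 := by
    rw [integral_sub (integrable_mollify hNi k) hNi, integral_mollify hNi, sub_self]
  -- The difference is at most `2 N + (mollify k N - N)`. Its part below `2 N` and the negative part
  -- of the excess are dominated and tend to zero, while the excess `mollify k N - N` itself has
  -- integral zero.
  have hle : ∀ x, |mollify k h x - h x| ≤ min |mollify k h x - h x| (2 * N x) +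
      max (N x - mollify k N x) 0 + (mollify k N x - N x) := by
    intro x
    have h1 : |mollify k h x - h x| ≤ mollify k N x + N x :=
      (abs_sub _ _).trans (add_le_add_left (abs_mollify_le h k x) _)
    rcases le_total |mollify k h x - h x| (2 * N x) with h2 | h2
    · rw [min_eq_left h2]; linarith [le_max_left (N x - mollify k N x) 0]
    · rw [min_eq_right h2]; linarith [le_max_right (N x - mollify k N x) 0]
  have k1 : Integrable fun x => min |mollify k h x - h x| (2 * N x) +
      max (N x - mollify k N x) 0 := (hmin k).add (hmax k)
  have := integral_mono (hs k) (k1.add (hNs k)) hle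
  simp only [Pi.add_apply] at this
  rwa [integral_add k1 (hNs k), integral_add (hmin k) (hmax k), hz, add_zero] at this

/-- Integrals of `a_k · (η_k ⋆ h)` converge if the `a_k` are uniformly bounded, supported in a common
compact set, and converge almost everywhere. -/
theorem tendsto_integral_mul_mollify {h : EuclideanSpace ℝ (Fin n) → ℝ} (hh : LocallyIntegrable h)
    {a : ℕ → EuclideanSpace ℝ (Fin n) → ℝ} {a' : EuclideanSpace ℝ (Fin n) → ℝ} {C : ℝ}
    {K : Set (EuclideanSpace ℝ (Fin n))} (hK : IsCompact K) (hm : ∀ k, AEStronglyMeasurable (a k))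
    (hb : ∀ k x, |a k x| ≤ C) (hs : ∀ k, ∀ x ∉ K, a k x = 0)
    (hlim : ∀ᵐ x, Tendsto (fun k => a k x) atTop (𝓝 (a' x))) :
    Tendsto (fun k => ∫ x, a k x * mollify k h x) atTop (𝓝 (∫ x, a' x * h x)) := by
  set K' := Metric.cthickening 1 K with hK'
  -- All bumps have radius at most `1`, so on `K` mollification sees only the values of `h` on `K'`.
  -- This reduces to an integrable function.
  have hKc : IsCompact K' := hK.cthickening
  set h' : EuclideanSpace ℝ (Fin n) → ℝ := K'.indicator h with hh'
  have hi : Integrable h' :=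
    (integrable_indicator_iff hKc.isClosed.measurableSet).2 (hh.integrableOn_isCompact hKc)
  have hC : 0 ≤ C := (abs_nonneg _).trans (hb 0 0)
  have e1 : ∀ k x, a k x * mollify k h x = a k x * mollify k h' x := by
    intro k x
    by_cases hx : x ∈ K
    · congr 1
      refine mollify_congr fun y hy => (indicator_of_mem ?_ _).symm
      exact Metric.mem_cthickening_of_dist_le y x 1 K hx hy
    · rw [hs k x hx, zero_mul, zero_mul]
  have e2 : ∀ᵐ x, a' x * h x = a' x * h' x := by
    filter_upwards [hlim] with x hx
    by_cases hxK : x ∈ K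
    · rw [hh', indicator_of_mem (Metric.self_subset_cthickening K hxK)]
    · have : a' x = 0 := tendsto_nhds_unique hx (by simp [hs _ x hxK])
      simp [this]
  simp_rw [e1]
  rw [integral_congr_ae e2]
  have ia : ∀ {w : EuclideanSpace ℝ (Fin n) → ℝ}, Integrable w → ∀ k,
      Integrable fun x => a k x * w x := fun hw k =>
    hw.bdd_mul (hm k) (Eventually.of_forall fun x => (hb k x : ‖a k x‖ ≤ C))
  have l1 : Tendsto (fun k => ∫ x, a k x * h' x) atTop (𝓝 (∫ x, a' x * h' x)) := by
    refine tendsto_integral_of_dominated_convergence (fun x => C * |h' x|)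
      (fun k => (ia hi k).aestronglyMeasurable) (hi.abs.const_mul C)
      (fun k => Eventually.of_forall fun x => ?_) ?_
    · rw [Real.norm_eq_abs, abs_mul]
      exact mul_le_mul_of_nonneg_right (hb k x) (abs_nonneg _)
    · filter_upwards [hlim] with x hx using hx.mul_const _
  have l2 : Tendsto (fun k => ∫ x, a k x * (mollify k h' x - h' x)) atTop (𝓝 0) := by
    refine squeeze_zero_norm (fun k => ?_)
      (by simpa using (tendsto_integral_abs_mollify_sub hi).const_mul C)
    refine (norm_integral_le_integral_norm _).trans ?_
    rw [← integral_const_mul]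
    have hsub := (integrable_mollify hi k).sub hi
    refine integral_mono (ia hsub k).norm (hsub.abs.const_mul C) fun x => ?_
    simp only [Real.norm_eq_abs, abs_mul]
    exact mul_le_mul_of_nonneg_right (hb k x) (abs_nonneg _)
  refine (by simpa using l1.add l2 : Tendsto (fun k => (∫ x, a k x * h' x) +
    ∫ x, a k x * (mollify k h' x - h' x)) atTop _).congr fun k => ?_
  have i2 : Integrable fun x => a k x * (mollify k h' x - h' x) :=
    ia ((integrable_mollify hi k).sub hi) k
  rw [← integral_add (ia hi k) i2]
  refine integral_congr_ae (Eventually.of_forall fun x => ?_)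
  ring

end Mollify

/-! ### Weak gradients -/

namespace HasWeakGradient

variable {n : ℕ} {u v : EuclideanSpace ℝ (Fin n) → ℝ}
  {gu gv : EuclideanSpace ℝ (Fin n) → EuclideanSpace ℝ (Fin n)}

theorem locallyIntegrable_inner (hu : HasWeakGradient u gu) (w : EuclideanSpace ℝ (Fin n)) :
    LocallyIntegrable fun x => inner ℝ (gu x) w := by
  intro x
  obtain ⟨s, hs, hi⟩ := hu.2.1 x
  exact ⟨s, hs, Integrable.inner_const hi w⟩

/-- Mollification commutes with the weak gradient: the derivative falls on the bump, and `t ↦ η (x -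
t)` is an admissible test function. The sign from the reflection cancels the one in the definition.
-/
theorem fderiv_mollify (hu : HasWeakGradient u gu) (k : ℕ) (x w : EuclideanSpace ℝ (Fin n)) :
    fderiv ℝ (mollify k u) x w = mollify k (fun y => inner ℝ (gu y) w) x := by
  set η := (shrinkingBump n k).normed (volume : Measure (EuclideanSpace ℝ (Fin n))) with hη
  have hηs : HasCompactSupport η := ContDiffBump.hasCompactSupport_normed _
  have hηc : ContDiff ℝ ∞ η := ContDiffBump.contDiff_normed _
  have h1 := (hηs.hasFDerivAt_convolution_left (ContinuousLinearMap.lsmul ℝ ℝ)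
    (hηc.of_le (by exact_mod_cast le_top)) hu.1 x).fderiv
  have hφs : HasCompactSupport fun t => η (x - t) :=
    hηs.comp_homeomorph (Homeomorph.subLeft x)
  have hφc : ContDiff ℝ ∞ fun t => η (x - t) := by fun_prop
  have key := hu.2.2 (fun t => η (x - t)) hφc hφs w
  have hfd : ∀ t, fderiv ℝ (fun t => η (x - t)) t w = - fderiv ℝ η (x - t) w := by
    intro t
    have hd : HasFDerivAt η (fderiv ℝ η (x - t)) (x - t) :=
      ((hηc.differentiable (by simp)) (x - t)).hasFDerivAt
    have h2 := hd.comp t ((hasFDerivAt_id t).const_sub x)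
    rw [show (fun t => η (x - t)) = η ∘ (fun t => x - t) from rfl]
    rw [HasFDerivAt.fderiv h2]
    simp
  have hex := (hηs.fderiv ℝ).convolutionExists_left
    ((ContinuousLinearMap.lsmul ℝ ℝ).precompL (EuclideanSpace ℝ (Fin n)))
    (hηc.continuous_fderiv (by simp)) hu.1 x
  have e : fderiv ℝ (mollify k u) x w = ∫ t, fderiv ℝ η (x - t) w * u t := by
    rw [← integral_sub_left_eq_self _ volume x]
    unfold mollify
    rw [h1, convolution_def, ContinuousLinearMap.integral_apply hex]
    simp only [sub_sub_cancel]
    rfl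
  have e' : mollify k (fun y => inner ℝ (gu y) w) x = ∫ t, η (x - t) * inner ℝ (gu t) w := by
    rw [← integral_sub_left_eq_self (fun t => η (x - t) * inner ℝ (gu t) w) volume x]
    simp only [sub_sub_cancel]
    rfl
  rw [e, e', ← neg_eq_iff_eq_neg.2 key, ← integral_neg]
  refine integral_congr_ae (Eventually.of_forall fun t => ?_)
  simp only [hfd]
  ring

/-- The product rule for bounded smooth functions of two weakly differentiable functions. -/
theorem integral_comp_mul_comp_fderiv (hu : HasWeakGradient u gu) (hv : HasWeakGradient v gv)
    {T : ℝ → ℝ} {C : ℝ} (hT : ContDiff ℝ ∞ T) (hTb : ∀ s, |T s| ≤ C) (hTd : ∀ s, |deriv T s| ≤ C)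
    {φ : EuclideanSpace ℝ (Fin n) → ℝ} (hφ : ContDiff ℝ ∞ φ) (hφc : HasCompactSupport φ)
    (w : EuclideanSpace ℝ (Fin n)) :
    ∫ x, T (u x) * T (v x) * fderiv ℝ φ x w =
      - ((∫ x, φ x * deriv T (u x) * T (v x) * inner ℝ (gu x) w) +
        ∫ x, φ x * T (u x) * deriv T (v x) * inner ℝ (gv x) w) := by
  have hC : 0 ≤ C := (abs_nonneg _).trans (hTb 0)
  have hT'c : Continuous (deriv T) := hT.continuous_deriv (by simp)
  have hTc : Continuous T := hT.continuous
  have hud : ∀ k, ContDiff ℝ ∞ (mollify k u) := contDiff_mollify hu.1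
  have hvd : ∀ k, ContDiff ℝ ∞ (mollify k v) := contDiff_mollify hv.1
  obtain ⟨B, hB⟩ := hφc.exists_bound_of_continuous hφ.continuous
  have hB0 : 0 ≤ B := (norm_nonneg _).trans (hB 0)
  have hφ0 : ∀ x ∉ tsupport φ, φ x = 0 := fun x hx => image_eq_zero_of_notMem_tsupport hx
  have hφ'c : HasCompactSupport fun x => fderiv ℝ φ x w :=
    (hφc.fderiv ℝ).comp_left (g := fun L : EuclideanSpace ℝ (Fin n) →L[ℝ] ℝ => L w) (by simp)
  have hφ'cont : Continuous fun x => fderiv ℝ φ x w :=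
    (hφ.continuous_fderiv (by simp)).clm_apply continuous_const
  have hprod : ∀ k x, fderiv ℝ (fun x => T (mollify k u x) * T (mollify k v x)) x w =
      deriv T (mollify k u x) * T (mollify k v x) * mollify k (fun y => inner ℝ (gu y) w) x +
      T (mollify k u x) * deriv T (mollify k v x) * mollify k (fun y => inner ℝ (gv y) w) x := by
    intro k x
    have h1 : ∀ {z : EuclideanSpace ℝ (Fin n) → ℝ}, ContDiff ℝ ∞ z →
        HasFDerivAt (fun x => T (z x)) (deriv T (z x) • fderiv ℝ z x) x := fun hz =>
      (((hT.differentiable (by simp)) _).hasDerivAt).comp_hasFDerivAt x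
        ((hz.differentiable (by simp)) x).hasFDerivAt
    have h2 : HasFDerivAt (fun x => T (mollify k u x) * T (mollify k v x)) _ x :=
      (h1 (hud k)).mul (h1 (hvd k))
    rw [h2.fderiv]
    simp only [add_apply, smul_apply, smul_eq_mul, hu.fderiv_mollify,
      hv.fderiv_mollify]
    ring
  have hsm : ∀ k, ContDiff ℝ ∞ fun x => T (mollify k u x) * T (mollify k v x) := fun k =>
    (hT.comp (hud k)).mul (hT.comp (hvd k))
  have hcm : ∀ {h : EuclideanSpace ℝ (Fin n) → ℝ}, LocallyIntegrable h → ∀ k,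
      Continuous (mollify k h) := fun hh k => (contDiff_mollify hh k).continuous
  have iu := hu.locallyIntegrable_inner w
  have iv := hv.locallyIntegrable_inner w
  have hcu := fun k => (hud k).continuous
  have hcv := fun k => (hvd k).continuous
  -- For mollified functions this is the classical product rule and integration by parts.
  -- Boundedness of `T` and `T'` then lets `k → ∞`: the coefficients stay bounded and converge
  -- almost everywhere, the mollified gradients converge in `L¹` on compact sets.
  have hk : ∀ k, ∫ x, T (mollify k u x) * T (mollify k v x) * fderiv ℝ φ x w =
      - ((∫ x, φ x * deriv T (mollify k u x) * T (mollify k v x) *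
          mollify k (fun y => inner ℝ (gu y) w) x) +
        ∫ x, φ x * T (mollify k u x) * deriv T (mollify k v x) *
          mollify k (fun y => inner ℝ (gv y) w) x) := by
    intro k
    have hcu := hcu k
    have hcv := hcv k
    have hiu := hcm iu k
    have hiv := hcm iv k
    have hφc1 := hφ.continuous
    have j1 : Integrable fun x => φ x * deriv T (mollify k u x) * T (mollify k v x) *
        mollify k (fun y => inner ℝ (gu y) w) x := by
      refine Continuous.integrable_of_hasCompactSupport (by fun_prop) ?_
      exact (hφc.mul_right.mul_right).mul_right
    have j2 : Integrable fun x => φ x * T (mollify k u x) * deriv T (mollify k v x) *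
        mollify k (fun y => inner ℝ (gv y) w) x := by
      refine Continuous.integrable_of_hasCompactSupport (by fun_prop) ?_
      exact (hφc.mul_right.mul_right).mul_right
    rw [integral_mul_fderiv_eq_neg_fderiv_mul_of_integrable
      (f := fun x => T (mollify k u x) * T (mollify k v x))]
    · rw [← integral_add j1 j2]
      congr 1
      refine integral_congr_ae (Eventually.of_forall fun x => ?_)
      simp only [hprod]
      ring
    · refine (j1.add j2).congr (Eventually.of_forall fun x => ?_)
      simp only [hprod, Pi.add_apply]
      ring
    · exact Continuous.integrable_of_hasCompactSupport (by fun_prop) hφ'c.mul_left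
    · exact Continuous.integrable_of_hasCompactSupport (by fun_prop) hφc.mul_left
    · exact fun x _ => ((hsm k).differentiable (by simp)) x
    · exact fun x _ => (hφ.differentiable (by simp)) x
  have hau := ae_tendsto_mollify hu.1
  have hav := ae_tendsto_mollify hv.1
  have l1 := tendsto_integral_mul_mollify iu (K := tsupport φ)
    (a := fun k x => φ x * deriv T (mollify k u x) * T (mollify k v x))
    (a' := fun x => φ x * deriv T (u x) * T (v x)) (C := B * C * C) hφc
    (fun k => by
      have := hcu k; have := hcv k; have := hφ.continuous
      exact Continuous.aestronglyMeasurable (by fun_prop))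
    (fun k x => by
      rw [abs_mul, abs_mul]
      exact mul_le_mul (mul_le_mul (hB x) (hTd _) (abs_nonneg _) hB0) (hTb _) (abs_nonneg _)
        (by positivity))
    (fun k x hx => by simp [hφ0 x hx])
    (by
      filter_upwards [hau, hav] with x hx hx'
      exact ((hT'c.tendsto _ |>.comp hx).const_mul _).mul (hTc.tendsto _ |>.comp hx'))
  have l2 := tendsto_integral_mul_mollify iv (K := tsupport φ)
    (a := fun k x => φ x * T (mollify k u x) * deriv T (mollify k v x))
    (a' := fun x => φ x * T (u x) * deriv T (v x)) (C := B * C * C) hφc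
    (fun k => by
      have := hcu k; have := hcv k; have := hφ.continuous
      exact Continuous.aestronglyMeasurable (by fun_prop))
    (fun k x => by
      rw [abs_mul, abs_mul]
      exact mul_le_mul (mul_le_mul (hB x) (hTb _) (abs_nonneg _) hB0) (hTd _) (abs_nonneg _)
        (by positivity))
    (fun k x hx => by simp [hφ0 x hx])
    (by
      filter_upwards [hau, hav] with x hx hx'
      exact ((hTc.tendsto _ |>.comp hx).const_mul _).mul (hT'c.tendsto _ |>.comp hx'))
  have l0 : Tendsto (fun k => ∫ x, T (mollify k u x) * T (mollify k v x) * fderiv ℝ φ x w) atTop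
      (𝓝 (∫ x, T (u x) * T (v x) * fderiv ℝ φ x w)) := by
    refine tendsto_integral_of_dominated_convergence (fun x => C * C * |fderiv ℝ φ x w|)
      (fun k => ?_) ?_ (fun k => Eventually.of_forall fun x => ?_) ?_
    · have := hcu k; have := hcv k
      exact Continuous.aestronglyMeasurable (by fun_prop)
    · exact ((hφ'cont.integrable_of_hasCompactSupport hφ'c).abs).const_mul _
    · rw [Real.norm_eq_abs, abs_mul, abs_mul]
      exact mul_le_mul_of_nonneg_right (mul_le_mul (hTb _) (hTb _) (abs_nonneg _) hC)
        (abs_nonneg _)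
    · filter_upwards [hau, hav] with x hx hx'
      exact ((hTc.tendsto _ |>.comp hx).mul (hTc.tendsto _ |>.comp hx')).mul_const _
  simp_rw [hk] at l0
  exact tendsto_nhds_unique l0 (l1.add l2).neg

end HasWeakGradient

/-- A smooth bounded truncation of the identity at height of order `k`. -/
noncomputable def truncate (k : ℕ) (s : ℝ) : ℝ := (k + 1) * Real.arctan (s / (k + 1))

theorem hasDerivAt_truncate (k : ℕ) (s : ℝ) :
    HasDerivAt (truncate k) (1 / (1 + (s / (k + 1)) ^ 2)) s := by
  have h : (0 : ℝ) < k + 1 := by positivity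
  have := (((hasDerivAt_id s).div_const ((k : ℝ) + 1)).arctan).const_mul ((k : ℝ) + 1)
  refine HasDerivAt.congr_deriv (f := truncate k) this ?_
  simp only [id]
  field_simp

theorem deriv_truncate (k : ℕ) (s : ℝ) : deriv (truncate k) s = 1 / (1 + (s / (k + 1)) ^ 2) :=
  (hasDerivAt_truncate k s).deriv

theorem contDiff_truncate (k : ℕ) : ContDiff ℝ ∞ (truncate k) :=
  contDiff_const.mul (Real.contDiff_arctan.comp (contDiff_id.div_const _))

theorem abs_deriv_truncate_le (k : ℕ) (s : ℝ) : |deriv (truncate k) s| ≤ 1 := by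
  rw [deriv_truncate, abs_of_nonneg (by positivity), div_le_one (by positivity)]
  linarith [sq_nonneg (s / (k + 1))]

theorem abs_truncate_le_const (k : ℕ) (s : ℝ) : |truncate k s| ≤ (k + 1) * 2 := by
  unfold truncate
  rw [abs_mul, abs_of_nonneg (by positivity : (0 : ℝ) ≤ k + 1)]
  refine mul_le_mul_of_nonneg_left (abs_le.2 ⟨?_, ?_⟩) (by positivity)
  · linarith [Real.neg_pi_div_two_lt_arctan (s / (k + 1)), Real.pi_le_four]
  · linarith [Real.arctan_lt_pi_div_two (s / (k + 1)), Real.pi_le_four]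

theorem abs_truncate_le (k : ℕ) (s : ℝ) : |truncate k s| ≤ |s| := by
  have h := Convex.norm_image_sub_le_of_norm_deriv_le (f := truncate k) (C := 1) (s := univ)
    (x := 0) (y := s) (fun x _ => (hasDerivAt_truncate k x).differentiableAt)
    (fun x _ => abs_deriv_truncate_le k x) convex_univ (mem_univ _) (mem_univ _)
  simpa [truncate] using h

/-- `truncate k s` is the difference quotient of `e ↦ arctan (e s)` at `0` with step `1 / (k + 1)`.
-/
theorem tendsto_truncate (s : ℝ) : Tendsto (fun k => truncate k s) atTop (𝓝 s) := by
  have h1 : HasDerivAt (fun e : ℝ => Real.arctan (e * s)) s 0 := by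
    have := ((hasDerivAt_id (0 : ℝ)).mul_const s).arctan
    simpa using this
  have h2 := h1.tendsto_slope_zero
  have h3 : Tendsto (fun k : ℕ => 1 / ((k : ℝ) + 1)) atTop (𝓝[≠] 0) :=
    tendsto_nhdsWithin_iff.2 ⟨tendsto_one_div_add_atTop_nhds_zero_nat,
      Eventually.of_forall fun k => by
        have : (0 : ℝ) < 1 / ((k : ℝ) + 1) := by positivity
        exact this.ne'⟩
  refine (h2.comp h3).congr fun k => ?_
  simp [truncate, div_eq_inv_mul]

theorem tendsto_deriv_truncate (s : ℝ) :
    Tendsto (fun k => deriv (truncate k) s) atTop (𝓝 1) := by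
  have h3 : Tendsto (fun k : ℕ => 1 / ((k : ℝ) + 1)) atTop (𝓝 0) :=
    tendsto_one_div_add_atTop_nhds_zero_nat
  have : Tendsto (fun k : ℕ => 1 / (1 + (s * (1 / ((k : ℝ) + 1))) ^ 2)) atTop
      (𝓝 (1 / (1 + (s * 0) ^ 2))) :=
    tendsto_const_nhds.div (((h3.const_mul s).pow 2).const_add 1) (by positivity)
  simp only [mul_zero, ne_eq, OfNat.ofNat_ne_zero, not_false_eq_true, zero_pow, add_zero,
    div_one] at this
  refine this.congr fun k => ?_
  rw [deriv_truncate, mul_one_div]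

/-- The product rule for weak gradients. -/
theorem HasWeakGradient.mul {n : ℕ} {u v : EuclideanSpace ℝ (Fin n) → ℝ}
    {gu gv : EuclideanSpace ℝ (Fin n) → EuclideanSpace ℝ (Fin n)}
    (hu : HasWeakGradient u gu) (hv : HasWeakGradient v gv)
    (huv : LocallyIntegrable fun x => u x * v x) (h1 : LocallyIntegrable fun x => v x • gu x)
    (h2 : LocallyIntegrable fun x => u x • gv x) :
    HasWeakGradient (fun x => u x * v x) (fun x => v x • gu x + u x • gv x) := by
  refine ⟨huv, h1.add h2, fun φ hφ hφc w => ?_⟩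
  have hum := hu.1.aestronglyMeasurable
  have hvm := hv.1.aestronglyMeasurable
  have hgum := (hu.locallyIntegrable_inner w).aestronglyMeasurable
  have hgvm := (hv.locallyIntegrable_inner w).aestronglyMeasurable
  have hφ'c : HasCompactSupport fun x => fderiv ℝ φ x w :=
    (hφc.fderiv ℝ).comp_left (g := fun L : EuclideanSpace ℝ (Fin n) →L[ℝ] ℝ => L w) (by simp)
  have hφ'cont : Continuous fun x => fderiv ℝ φ x w :=
    (hφ.continuous_fderiv (by simp)).clm_apply continuous_const
  have hφm := hφ.continuous.aestronglyMeasurable (μ := volume)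
  have i0 : Integrable fun x => u x * v x * fderiv ℝ φ x w := by
    refine (huv.integrable_smul_left_of_hasCompactSupport hφ'cont hφ'c).congr
      (Eventually.of_forall fun x => ?_)
    simp only [smul_eq_mul]; ring
  have i1 : Integrable fun x => φ x * v x * inner ℝ (gu x) w := by
    refine ((h1.integrable_smul_left_of_hasCompactSupport hφ.continuous hφc).inner_const w).congr
      (Eventually.of_forall fun x => ?_)
    simp only [real_inner_smul_left]; ring
  have i2 : Integrable fun x => φ x * u x * inner ℝ (gv x) w := by
    refine ((h2.integrable_smul_left_of_hasCompactSupport hφ.continuous hφc).inner_const w).congr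
      (Eventually.of_forall fun x => ?_)
    simp only [real_inner_smul_left]; ring
  -- A single constant has to bound both the truncation and its derivative.
  have hb : ∀ k : ℕ, (1 : ℝ) ≤ (k + 1) * 2 := fun k => by
    have : (0 : ℝ) ≤ k := by positivity
    linarith
  have hk := fun k => hu.integral_comp_mul_comp_fderiv hv (contDiff_truncate k)
    (abs_truncate_le_const k) (fun s => (abs_deriv_truncate_le k s).trans (hb k)) hφ hφc w
  have hTc : ∀ k, Continuous (truncate k) := fun k => (contDiff_truncate k).continuous
  have hT'c : ∀ k, Continuous (deriv (truncate k)) := fun k =>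
    (contDiff_truncate k).continuous_deriv (by simp)
  -- Since truncation shrinks absolute values and has slope at most `1`, each integrand is dominated
  -- by its own limit. This is where the local integrability of the three products is needed.
  have l0 : Tendsto (fun k => ∫ x, truncate k (u x) * truncate k (v x) * fderiv ℝ φ x w) atTop
      (𝓝 (∫ x, u x * v x * fderiv ℝ φ x w)) := by
    refine tendsto_integral_of_dominated_convergence _ (fun k => ?_) i0.norm
      (fun k => Eventually.of_forall fun x => ?_) (Eventually.of_forall fun x => ?_)
    · exact (((hTc k).comp_aestronglyMeasurable hum).mul
        ((hTc k).comp_aestronglyMeasurable hvm)).mul hφ'cont.aestronglyMeasurable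
    · simp only [norm_mul, Real.norm_eq_abs]
      exact mul_le_mul_of_nonneg_right (mul_le_mul (abs_truncate_le _ _) (abs_truncate_le _ _)
        (abs_nonneg _) (abs_nonneg _)) (abs_nonneg _)
    · exact ((tendsto_truncate _).mul (tendsto_truncate _)).mul_const _
  have l1 : Tendsto (fun k => ∫ x, φ x * deriv (truncate k) (u x) * truncate k (v x) *
      inner ℝ (gu x) w) atTop (𝓝 (∫ x, φ x * v x * inner ℝ (gu x) w)) := by
    refine tendsto_integral_of_dominated_convergence _ (fun k => ?_) i1.norm
      (fun k => Eventually.of_forall fun x => ?_) (Eventually.of_forall fun x => ?_)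
    · exact ((hφm.mul ((hT'c k).comp_aestronglyMeasurable hum)).mul
        ((hTc k).comp_aestronglyMeasurable hvm)).mul hgum
    · simp only [norm_mul, Real.norm_eq_abs]
      have := mul_le_of_le_one_right (abs_nonneg (φ x)) (abs_deriv_truncate_le k (u x))
      exact mul_le_mul_of_nonneg_right (mul_le_mul this (abs_truncate_le _ _)
        (abs_nonneg _) (abs_nonneg _)) (abs_nonneg _)
    · have := (((tendsto_deriv_truncate (u x)).const_mul (φ x)).mul
        (tendsto_truncate (v x))).mul_const (inner ℝ (gu x) w)
      simpa using this
  have l2 : Tendsto (fun k => ∫ x, φ x * truncate k (u x) * deriv (truncate k) (v x) *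
      inner ℝ (gv x) w) atTop (𝓝 (∫ x, φ x * u x * inner ℝ (gv x) w)) := by
    refine tendsto_integral_of_dominated_convergence _ (fun k => ?_) i2.norm
      (fun k => Eventually.of_forall fun x => ?_) (Eventually.of_forall fun x => ?_)
    · exact ((hφm.mul ((hTc k).comp_aestronglyMeasurable hum)).mul
        ((hT'c k).comp_aestronglyMeasurable hvm)).mul hgvm
    · simp only [norm_mul, Real.norm_eq_abs]
      have h3 := mul_le_mul_of_nonneg_left (abs_truncate_le k (u x)) (abs_nonneg (φ x))
      have h4 := mul_le_of_le_one_right (a := |φ x| * |truncate k (u x)|) (by positivity)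
        (abs_deriv_truncate_le k (v x))
      exact mul_le_mul_of_nonneg_right (h4.trans h3) (abs_nonneg _)
    · have := (((tendsto_truncate (u x)).const_mul (φ x)).mul
        (tendsto_deriv_truncate (v x))).mul_const (inner ℝ (gv x) w)
      simpa using this
  simp_rw [hk] at l0
  rw [tendsto_nhds_unique l0 (l1.add l2).neg, ← integral_add i1 i2]
  congr 1
  refine integral_congr_ae (Eventually.of_forall fun x => ?_)
  simp only [inner_add_left, real_inner_smul_left]
  ring

end BayesCR

namespace BayesCR

open Filter Topology Set
open scoped Convolution Gradient

/-! ### The Euclidean logarithmic Sobolev inequality for weakly differentiable densities -/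

/-- The map `s ↦ s² / (1 + s)`. -/
noncomputable def damp (s : ℝ) : ℝ := s ^ 2 / (1 + s)

/-- `damp` is quadratic near `0` and comparable to the identity near infinity. Thus `damp s * log
(damp s)` is at least `-3 s` for `s ≤ 1`, while for large `s` it still controls `s log s`. The
possibly divergent contribution of small densities to `∫ p log p` is thereby removed. -/
theorem mul_posLog_le_damp {s : ℝ} (hs : 0 ≤ s) :
    s * max (Real.log s) 0 ≤ 2 * (damp s * Real.log (damp s)) + 6 * s := by
  rcases hs.eq_or_lt with rfl | hs
  · simp [damp]
  have hd : 0 < damp s := by unfold damp; positivity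
  have hlog : Real.log (damp s) = 2 * Real.log s - Real.log (1 + s) := by
    unfold damp
    rw [Real.log_div (by positivity) (by positivity), Real.log_pow]; norm_num
  rcases le_total s 1 with h1 | h1
  · rw [max_eq_right (Real.log_nonpos hs.le h1), mul_zero]
    have h2 : -(1 / s) ≤ Real.log s := by
      have := Real.log_le_sub_one_of_pos (inv_pos.2 hs)
      rw [Real.log_inv] at this
      rw [one_div]; linarith
    have h3 : Real.log (1 + s) ≤ s := by
      have := Real.log_le_sub_one_of_pos (by linarith : 0 < 1 + s); linarith
    have h4 : -(2 / s) - s ≤ Real.log (damp s) := by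
      rw [hlog]; have : 2 / s = 2 * (1 / s) := by ring
      linarith
    have h5 := mul_le_mul_of_nonneg_left h4 hd.le
    have h6 : damp s ≤ s ^ 2 := by
      unfold damp; rw [div_le_iff₀ (by linarith)]; nlinarith [sq_nonneg s]
    have h7 : 0 ≤ 2 / s + s := by positivity
    have h8 : damp s * (2 / s + s) ≤ s ^ 2 * (2 / s + s) := mul_le_mul_of_nonneg_right h6 h7
    have h9 : s ^ 2 * (2 / s + s) = 2 * s + s ^ 3 := by field_simp
    have h10 : s ^ 3 ≤ s := by nlinarith
    linarith
  · have hls := Real.log_nonneg h1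
    rw [max_eq_left hls]
    have h2 : s ≤ 2 * damp s := by
      unfold damp; rw [mul_div_assoc', le_div_iff₀ (by linarith)]; nlinarith
    have h3 : damp s ≤ s := by
      unfold damp; rw [div_le_iff₀ (by linarith)]; nlinarith
    have h4 : Real.log s ≤ Real.log 2 + Real.log (damp s) := by
      rw [← Real.log_mul two_ne_zero hd.ne']; exact Real.log_le_log hs h2
    have h5 : Real.log 2 ≤ 1 := by linarith [Real.log_two_lt_d9]
    have h6 : s * Real.log s ≤ 2 * damp s * Real.log s := mul_le_mul_of_nonneg_right h2 hls
    have h7 : damp s * Real.log s ≤ damp s * (1 + Real.log (damp s)) :=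
      mul_le_mul_of_nonneg_left (by linarith) hd.le
    nlinarith

theorem lsiConst_one_nonneg : 0 ≤ lsiConst 1 := by
  have : 0 ≤ Real.log (2 * Real.pi) := Real.log_nonneg (by linarith [Real.pi_gt_three])
  simp only [lsiConst, Real.log_one]
  linarith

theorem continuous_gradient {n : ℕ} {p : EuclideanSpace ℝ (Fin n) → ℝ} (hp : ContDiff ℝ 1 p) :
    Continuous (∇ p) :=
  (InnerProductSpace.toDual ℝ _).symm.continuous.comp (hp.continuous_fderiv one_ne_zero)

/-- The logarithmic Sobolev inequality with `b = 1` is applied to `damp ∘ p`, whose mass is at most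
`1` and whose Fisher information is at most twice that of `p`. The bound depends neither on the
dimension nor on the support, so it survives mollification and the removal of cutoffs. -/
theorem integral_mul_posLog_le_of_contDiff {n : ℕ} {p : EuclideanSpace ℝ (Fin n) → ℝ}
    (h0 : ∀ x, 0 ≤ p x) (hp : ContDiff ℝ 1 p) (hc : HasCompactSupport p)
    (hF : Integrable fun x => ‖∇ p x‖ ^ 2 / p x) (hm : ∫ x, p x ≤ 1) :
    ∫ x, p x * max (Real.log (p x)) 0 ≤ 2 * (∫ x, ‖∇ p x‖ ^ 2 / p x) + 6 := by
  set q : EuclideanSpace ℝ (Fin n) → ℝ := fun x => damp (p x) with hq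
  have hpos : ∀ x, 0 < 1 + p x := fun x => by linarith [h0 x]
  have hq0 : ∀ x, 0 ≤ q x := fun x => div_nonneg (sq_nonneg _) (hpos x).le
  have hqd : ContDiff ℝ 1 q := (hp.pow 2).div (contDiff_const.add hp) fun x => (hpos x).ne'
  have hqc : HasCompactSupport q := hc.comp_left (g := damp) (by simp [damp])
  have hgrad : ∀ x, ∇ q x = (p x * (p x + 2) / (1 + p x) ^ 2) • ∇ p x := by
    intro x
    have h1 : HasDerivAt damp (p x * (p x + 2) / (1 + p x) ^ 2) (p x) := by
      have := ((hasDerivAt_id (p x)).pow 2).div ((hasDerivAt_id (p x)).const_add 1) (hpos x).ne'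
      refine HasDerivAt.congr_deriv (f := damp) this ?_
      simp only [id]
      congr 1; simp; ring
    have h2 := h1.comp_hasFDerivAt x ((hp.differentiable one_ne_zero) x).hasFDerivAt
    have h3 : fderiv ℝ q x = _ := h2.fderiv
    rw [gradient, h3, map_smul, gradient]
  have hqF : ∀ x, ‖∇ q x‖ ^ 2 / q x ≤ 2 * (‖∇ p x‖ ^ 2 / p x) := by
    intro x
    rcases (h0 x).eq_or_lt with h | h
    · simp [hgrad, ← h]
    · have e : ‖∇ q x‖ ^ 2 / q x =
          p x * (p x + 2) ^ 2 / (1 + p x) ^ 3 * (‖∇ p x‖ ^ 2 / p x) := by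
        have := hpos x
        rw [hgrad, norm_smul, mul_pow, Real.norm_eq_abs, sq_abs]
        simp only [hq, damp]
        field_simp
      rw [e]
      refine mul_le_mul_of_nonneg_right ?_ (by positivity)
      rw [div_le_iff₀ (by have := hpos x; positivity)]
      nlinarith [pow_pos h 2, pow_pos h 3]
  have hqFi : Integrable fun x => ‖∇ q x‖ ^ 2 / q x := by
    refine (hF.const_mul 2).mono' ?_ (Eventually.of_forall fun x => ?_)
    · exact (((continuous_gradient hqd).measurable.norm.pow_const 2).div
        hqd.continuous.measurable).aestronglyMeasurable
    · rw [Real.norm_of_nonneg (div_nonneg (sq_nonneg _) (hq0 x))]; exact hqF x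
  have hpi : Integrable p := hp.continuous.integrable_of_hasCompactSupport hc
  have hqi : Integrable q := hqd.continuous.integrable_of_hasCompactSupport hqc
  have hqp : ∫ x, q x ≤ 1 := by
    refine le_trans (integral_mono hqi hpi fun x => ?_) hm
    simp only [hq, damp]
    rw [div_le_iff₀ (hpos x)]
    nlinarith [h0 x]
  have hq0' : 0 ≤ ∫ x, q x := integral_nonneg hq0
  have key := integral_mul_log_le_of_contDiff one_pos hq0 hqd hqc hqFi
  have h1 : (∫ x, q x) * Real.log (∫ x, q x) ≤ 0 :=
    mul_nonpos_of_nonneg_of_nonpos hq0' (Real.log_nonpos hq0' hqp)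
  have h2 : ∫ x, ‖∇ q x‖ ^ 2 / q x ≤ 2 * ∫ x, ‖∇ p x‖ ^ 2 / p x := by
    rw [← integral_const_mul]; exact integral_mono hqFi (hF.const_mul 2) hqF
  have h3 : 0 ≤ n * lsiConst 1 * ∫ x, q x :=
    mul_nonneg (mul_nonneg (Nat.cast_nonneg _) lsiConst_one_nonneg) hq0'
  have hlogq : Integrable fun x => q x * Real.log (q x) :=
    (Real.continuous_mul_log.comp hqd.continuous).integrable_of_hasCompactSupport
      (hqc.comp_left (g := fun x => x * Real.log x) (by simp))
  have hlogp : Integrable fun x => p x * max (Real.log (p x)) 0 := by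
    have e : (fun x => p x * max (Real.log (p x)) 0) =
        fun x => max (p x * Real.log (p x)) 0 := by
      funext x; rw [mul_max_of_nonneg _ _ (h0 x), mul_zero]
    rw [e]
    refine Integrable.pos_part ?_
    exact (Real.continuous_mul_log.comp hp.continuous).integrable_of_hasCompactSupport
      (hc.comp_left (g := fun x => x * Real.log x) (by simp))
  have h4 := integral_mono hlogp ((hlogq.const_mul 2).add (hpi.const_mul 6))
    fun x => mul_posLog_le_damp (h0 x)
  simp only [Pi.add_apply] at h4
  rw [integral_add (hlogq.const_mul 2) (hpi.const_mul 6), integral_const_mul,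
    integral_const_mul] at h4
  linarith

/-- Fatou's lemma for real-valued functions. -/
theorem integrable_and_integral_le_of_tendsto {α : Type*} [MeasurableSpace α] {μ : Measure α}
    {F : ℕ → α → ℝ} {F' : α → ℝ} {C : ℕ → ℝ} {C' : ℝ} (hF : ∀ k, Integrable (F k) μ)
    (h0 : ∀ k x, 0 ≤ F k x) (hlim : ∀ᵐ x ∂μ, Tendsto (fun k => F k x) atTop (𝓝 (F' x)))
    (hle : ∀ k, ∫ x, F k x ∂μ ≤ C k) (hC : Tendsto C atTop (𝓝 C')) :
    Integrable F' μ ∧ ∫ x, F' x ∂μ ≤ C' := by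
  have hF'0 : ∀ᵐ x ∂μ, 0 ≤ F' x := by
    filter_upwards [hlim] with x hx using ge_of_tendsto' hx fun k => h0 k x
  have hm : AEStronglyMeasurable F' μ :=
    aestronglyMeasurable_of_tendsto_ae atTop (fun k => (hF k).aestronglyMeasurable) hlim
  have hC0 : 0 ≤ C' := ge_of_tendsto' hC fun k => (integral_nonneg (h0 k)).trans (hle k)
  have key : ∫⁻ x, ENNReal.ofReal (F' x) ∂μ ≤ ENNReal.ofReal C' := by
    have h1 : ∫⁻ x, ENNReal.ofReal (F' x) ∂μ =
        ∫⁻ x, liminf (fun k => ENNReal.ofReal (F k x)) atTop ∂μ := by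
      refine lintegral_congr_ae ?_
      filter_upwards [hlim] with x hx
      exact ((ENNReal.continuous_ofReal.tendsto _).comp hx).liminf_eq.symm
    rw [h1]
    refine (lintegral_liminf_le' fun k => (hF k).aestronglyMeasurable.aemeasurable.ennreal_ofReal).trans ?_
    rw [← ((ENNReal.continuous_ofReal.tendsto _).comp hC).liminf_eq]
    refine liminf_le_liminf (Eventually.of_forall fun k => ?_)
    rw [← ofReal_integral_eq_lintegral_ofReal (hF k) (Eventually.of_forall (h0 k))]
    exact ENNReal.ofReal_le_ofReal (hle k)
  have hi : Integrable F' μ := ⟨hm, by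
    rw [hasFiniteIntegral_iff_ofReal hF'0]; exact key.trans_lt ENNReal.ofReal_lt_top⟩
  refine ⟨hi, ?_⟩
  rw [← ofReal_integral_eq_lintegral_ofReal hi hF'0] at key
  exact (ENNReal.ofReal_le_ofReal_iff hC0).1 key

/-- A nonnegative integrable function `p` on `ℝⁿ` with weak gradient `g` and finite Fisher
information `∫ |g|² / p`. -/
structure HasFiniteFisherInfo {n : ℕ} (p : EuclideanSpace ℝ (Fin n) → ℝ)
    (g : EuclideanSpace ℝ (Fin n) → EuclideanSpace ℝ (Fin n)) : Prop where
  nonneg : ∀ x, 0 ≤ p x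
  integrable : Integrable p
  hasWeakGradient : HasWeakGradient p g
  integrable_fisher : Integrable fun x => ‖g x‖ ^ 2 / p x
  -- Real division by zero gives zero, so without this clause `‖g‖² / p` would not see a gradient
  -- living on the zero set of `p`.
  ae_eq_zero : ∀ᵐ x, p x = 0 → g x = 0

namespace HasFiniteFisherInfo

variable {n : ℕ} {p : EuclideanSpace ℝ (Fin n) → ℝ}
  {g : EuclideanSpace ℝ (Fin n) → EuclideanSpace ℝ (Fin n)}

/-- Joint convexity of `(g, p) ↦ |g|² / p`, in the form of Cauchy–Schwarz with the bump as weight.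
It is tested in the direction `w` of the mollified gradient itself, which gives `‖w‖⁴` on the left
and allows division by `‖w‖²`. -/
theorem fisher_mollify_le (h : HasFiniteFisherInfo p g) (k : ℕ) (x : EuclideanSpace ℝ (Fin n)) :
    ‖∇ (mollify k p) x‖ ^ 2 / mollify k p x ≤ mollify k (fun y => ‖g y‖ ^ 2 / p y) x := by
  set w := ∇ (mollify k p) x with hw
  rcases eq_or_ne w 0 with h0 | h0
  · rw [h0]; simpa using mollify_nonneg (fun y => div_nonneg (sq_nonneg _) (h.nonneg y)) k x
  set η := (shrinkingBump n k).normed (volume : Measure (EuclideanSpace ℝ (Fin n))) with hη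
  have hη0 : ∀ t, 0 ≤ η t := ContDiffBump.nonneg_normed _
  have e1 : mollify k (fun y => inner ℝ (g y) w) x = ‖w‖ ^ 2 := by
    rw [← h.hasWeakGradient.fderiv_mollify, ← inner_gradient_left, real_inner_self_eq_norm_sq]
  have hli := h.integrable_fisher.locallyIntegrable
  have hpt : ∀ t, (η t * inner ℝ (g (x - t)) w) ^ 2 / (η t * p (x - t)) ≤
      ‖w‖ ^ 2 * (η t * (‖g (x - t)‖ ^ 2 / p (x - t))) := by
    intro t
    rcases (hη0 t).eq_or_lt with ht | ht
    · simp [← ht]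
    have e : (η t * inner ℝ (g (x - t)) w) ^ 2 / (η t * p (x - t)) =
        η t * ((inner ℝ (g (x - t)) w) ^ 2 / p (x - t)) := by
      rw [mul_pow, mul_div_mul_comm, sq (η t), mul_self_div_self]
    have h1 : (inner ℝ (g (x - t)) w) ^ 2 ≤ ‖g (x - t)‖ ^ 2 * ‖w‖ ^ 2 := by
      rw [← mul_pow, ← sq_abs (inner ℝ _ _)]
      exact pow_le_pow_left₀ (abs_nonneg _) (abs_real_inner_le_norm _ _) 2
    have h2 := div_le_div_of_nonneg_right h1 (h.nonneg (x - t))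
    have h3 := mul_le_mul_of_nonneg_left h2 ht.le
    rw [e]
    calc _ ≤ _ := h3
      _ = _ := by ring
  have hqmp : Measure.QuasiMeasurePreserving (fun t : EuclideanSpace ℝ (Fin n) => x - t) :=
    (Measure.measurePreserving_sub_left volume x).quasiMeasurePreserving
  have hdm : Integrable fun t => η t * inner ℝ (g (x - t)) w :=
    integrable_mollify_integrand (h.hasWeakGradient.locallyIntegrable_inner w) k x
  have hpm : Integrable fun t => η t * p (x - t) :=
    integrable_mollify_integrand h.integrable.locallyIntegrable k x
  have hFm := (integrable_mollify_integrand hli k x).const_mul (‖w‖ ^ 2)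
  have hFi : Integrable fun t => (η t * inner ℝ (g (x - t)) w) ^ 2 / (η t * p (x - t)) := by
    refine hFm.mono' ?_ (Eventually.of_forall fun t => ?_)
    · exact ((hdm.aestronglyMeasurable.aemeasurable.pow_const 2).div
        hpm.aestronglyMeasurable.aemeasurable).aestronglyMeasurable
    · rw [Real.norm_of_nonneg (div_nonneg (sq_nonneg _) (mul_nonneg (hη0 t) (h.nonneg _)))]
      exact hpt t
  have key := sq_integral_div_le (fun t => mul_nonneg (hη0 t) (h.nonneg (x - t))) (by
      filter_upwards [hqmp.ae h.ae_eq_zero] with t ht h2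
      rcases mul_eq_zero.1 h2 with h3 | h3
      · simp [h3]
      · simp [ht h3]) hpm hdm hFi
  have key2 := key.trans (integral_mono hFi hFm hpt)
  rw [integral_const_mul] at key2
  change (mollify k (fun y => inner ℝ (g y) w) x) ^ 2 / mollify k p x ≤
    ‖w‖ ^ 2 * mollify k (fun y => ‖g y‖ ^ 2 / p y) x at key2
  rw [e1, sq (‖w‖ ^ 2), mul_div_assoc] at key2
  exact le_of_mul_le_mul_left key2 (by positivity)

theorem integrable_fisher_mollify (h : HasFiniteFisherInfo p g) (k : ℕ) :
    Integrable fun x => ‖∇ (mollify k p) x‖ ^ 2 / mollify k p x := by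
  have hd := contDiff_mollify h.integrable.locallyIntegrable k
  refine (integrable_mollify h.integrable_fisher k).mono' ?_ (Eventually.of_forall fun x => ?_)
  · exact (((continuous_gradient (hd.of_le (by exact_mod_cast le_top))).measurable.norm.pow_const
      2).div hd.continuous.measurable).aestronglyMeasurable
  · rw [Real.norm_of_nonneg (div_nonneg (sq_nonneg _) (mollify_nonneg h.nonneg k x))]
    exact h.fisher_mollify_le k x

theorem integral_fisher_mollify_le (h : HasFiniteFisherInfo p g) (k : ℕ) :
    ∫ x, ‖∇ (mollify k p) x‖ ^ 2 / mollify k p x ≤ ∫ x, ‖g x‖ ^ 2 / p x := by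
  rw [← integral_mollify h.integrable_fisher k]
  exact integral_mono (h.integrable_fisher_mollify k) (integrable_mollify h.integrable_fisher k)
    (h.fisher_mollify_le k)

theorem mollify_eq_zero_of_notMem (k : ℕ) {x : EuclideanSpace ℝ (Fin n)}
    (hx : x ∉ Metric.cthickening 1 (tsupport p)) : mollify k p x = 0 := by
  have : mollify k p x = mollify k (fun _ => 0) x := mollify_congr fun y hy => by
    by_contra hne
    exact hx (Metric.mem_cthickening_of_dist_le x y 1 _ (subset_tsupport _ hne) (by rwa [dist_comm]))
  rw [this, mollify_apply]; simp

theorem hasCompactSupport_mollify (hc : HasCompactSupport p) (k : ℕ) :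
    HasCompactSupport (mollify k p) :=
  HasCompactSupport.intro (IsCompact.cthickening hc) fun _ => mollify_eq_zero_of_notMem k

/-- Mollification preserves the mass and does not increase the Fisher information, so the smooth
inequality passes to the limit by Fatou. As `s log s ≥ -1` and all supports lie in one compact set
`B`, adding the indicator of `B` makes the integrands nonnegative. -/
theorem integral_mul_log_le_of_hasCompactSupport (h : HasFiniteFisherInfo p g)
    (hc : HasCompactSupport p) {b : ℝ} (hb : 0 < b) :
    (Integrable fun x => p x * Real.log (p x)) ∧ ∫ x, p x * Real.log (p x) ≤
      (∫ x, p x) * Real.log (∫ x, p x) + b ^ 2 / 2 * (∫ x, ‖g x‖ ^ 2 / p x) -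
        n * lsiConst b * ∫ x, p x := by
  set B := Metric.cthickening 1 (tsupport p) with hB
  have hBc : IsCompact B := IsCompact.cthickening hc
  have hBi : Integrable (B.indicator fun _ => (1 : ℝ)) :=
    (integrable_indicator_iff hBc.isClosed.measurableSet).2
      (integrableOn_const hBc.measure_lt_top.ne)
  have hd := fun k => contDiff_mollify h.integrable.locallyIntegrable k
  have hlogi : ∀ k, Integrable fun x => mollify k p x * Real.log (mollify k p x) := fun k =>
    (Real.continuous_mul_log.comp (hd k).continuous).integrable_of_hasCompactSupport
      ((hasCompactSupport_mollify hc k).comp_left (g := fun x => x * Real.log x) (by simp))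
  have key := integrable_and_integral_le_of_tendsto
    (F := fun k x => mollify k p x * Real.log (mollify k p x) + B.indicator (fun _ => (1 : ℝ)) x)
    (F' := fun x => p x * Real.log (p x) + B.indicator (fun _ => (1 : ℝ)) x)
    (C := fun _ => ((∫ x, p x) * Real.log (∫ x, p x) + b ^ 2 / 2 * (∫ x, ‖g x‖ ^ 2 / p x) -
        n * lsiConst b * ∫ x, p x) + ∫ x, B.indicator (fun _ => (1 : ℝ)) x)
    (fun k => (hlogi k).add hBi) (fun k x => ?_) ?_ (fun k => ?_) tendsto_const_nhds
  · have hi : Integrable fun x => p x * Real.log (p x) := by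
      refine (key.1.sub hBi).congr (Eventually.of_forall fun x => ?_)
      simp
    refine ⟨hi, ?_⟩
    have := key.2
    rw [integral_add hi hBi] at this
    linarith
  · by_cases hx : x ∈ B
    · rw [indicator_of_mem hx]
      have h1 := Real.negMulLog_le_one_sub_self (mollify_nonneg h.nonneg k x)
      rw [Real.negMulLog, neg_mul] at h1
      linarith [mollify_nonneg h.nonneg k x]
    · rw [indicator_of_notMem hx, mollify_eq_zero_of_notMem k hx]; simp
  · filter_upwards [ae_tendsto_mollify h.integrable.locallyIntegrable] with x hx
    exact ((Real.continuous_mul_log.tendsto _).comp hx).add_const _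
  · rw [integral_add (hlogi k) hBi]
    refine add_le_add_left ?_ _
    have := integral_mul_log_le_of_contDiff hb (mollify_nonneg h.nonneg k)
      ((hd k).of_le (by exact_mod_cast le_top)) (hasCompactSupport_mollify hc k)
      (h.integrable_fisher_mollify k)
    rw [integral_mollify h.integrable] at this
    have h2 := mul_le_mul_of_nonneg_left (h.integral_fisher_mollify_le k)
      (by positivity : 0 ≤ b ^ 2 / 2)
    linarith

theorem integral_mul_posLog_le_of_hasCompactSupport (h : HasFiniteFisherInfo p g)
    (hc : HasCompactSupport p) (hm : ∫ x, p x ≤ 1) :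
    (Integrable fun x => p x * max (Real.log (p x)) 0) ∧
      ∫ x, p x * max (Real.log (p x)) 0 ≤ 2 * (∫ x, ‖g x‖ ^ 2 / p x) + 6 := by
  have hd := fun k => contDiff_mollify h.integrable.locallyIntegrable k
  have e : ∀ s : ℝ, 0 ≤ s → s * max (Real.log s) 0 = max (s * Real.log s) 0 := fun s hs => by
    rw [mul_max_of_nonneg _ _ hs, mul_zero]
  refine integrable_and_integral_le_of_tendsto
    (F := fun k x => mollify k p x * max (Real.log (mollify k p x)) 0)
    (C := fun _ => 2 * (∫ x, ‖g x‖ ^ 2 / p x) + 6)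
    (fun k => ?_) (fun k x => ?_) ?_ (fun k => ?_) tendsto_const_nhds
  · simp_rw [e _ (mollify_nonneg h.nonneg k _)]
    refine Integrable.pos_part ?_
    exact (Real.continuous_mul_log.comp (hd k).continuous).integrable_of_hasCompactSupport
      ((hasCompactSupport_mollify hc k).comp_left (g := fun x => x * Real.log x) (by simp))
  · exact mul_nonneg (mollify_nonneg h.nonneg k x) (le_max_right _ _)
  · filter_upwards [ae_tendsto_mollify h.integrable.locallyIntegrable] with x hx
    simp_rw [e _ (mollify_nonneg h.nonneg _ _), e _ (h.nonneg x)]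
    exact ((Real.continuous_mul_log.tendsto _).comp hx).max tendsto_const_nhds
  · have := integral_mul_posLog_le_of_contDiff (mollify_nonneg h.nonneg k)
      ((hd k).of_le (by exact_mod_cast le_top)) (hasCompactSupport_mollify hc k)
      (h.integrable_fisher_mollify k) (by rwa [integral_mollify h.integrable])
    linarith [h.integral_fisher_mollify_le k]

end HasFiniteFisherInfo
end BayesCR

namespace BayesCR

open Filter Topology Set
open scoped Convolution Gradient

/-! ### Smooth cutoffs and removal of the compact support assumption. -/

section Cutoff

variable {n : ℕ} {p : EuclideanSpace ℝ (Fin n) → ℝ}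
  {g : EuclideanSpace ℝ (Fin n) → EuclideanSpace ℝ (Fin n)}

theorem fderiv_apply_eq_inner_gradient (χ : EuclideanSpace ℝ (Fin n) → ℝ)
    (x w : EuclideanSpace ℝ (Fin n)) : fderiv ℝ χ x w = inner ℝ (∇ χ x) w :=
  inner_gradient_left.symm

/-- With a smooth factor no truncation is needed: `χ φ` is again a test function. -/
theorem HasWeakGradient.smooth_mul (hp : HasWeakGradient p g)
    {χ : EuclideanSpace ℝ (Fin n) → ℝ} (hχ : ContDiff ℝ ∞ χ) :
    HasWeakGradient (fun x => χ x * p x) (fun x => χ x • g x + p x • ∇ χ x) := by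
  have hχ1 : ContDiff ℝ 1 χ := hχ.of_le (by exact_mod_cast le_top)
  have hgc := continuous_gradient hχ1
  have l2 : LocallyIntegrable fun x => χ x • g x := by
    rw [locallyIntegrable_iff]
    intro K hK
    exact (hp.2.1.integrableOn_isCompact hK).continuousOn_smul hχ.continuous.continuousOn hK
  have l3 : LocallyIntegrable fun x => p x • ∇ χ x := by
    rw [locallyIntegrable_iff]
    intro K hK
    exact (hp.1.integrableOn_isCompact hK).smul_continuousOn hgc.continuousOn hK
  refine ⟨?_, l2.add l3, fun φ hφ hφc w => ?_⟩
  · rw [locallyIntegrable_iff]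
    intro K hK
    exact (hp.1.integrableOn_isCompact hK).continuousOn_mul hχ.continuous.continuousOn hK
  have key := hp.2.2 (fun x => χ x * φ x) (hχ.mul hφ) hφc.mul_left w
  have hfd : ∀ x, fderiv ℝ (fun x => χ x * φ x) x w =
      χ x * fderiv ℝ φ x w + φ x * inner ℝ (∇ χ x) w := by
    intro x
    have := ((hχ.differentiable (by simp)) x).hasFDerivAt.mul
      ((hφ.differentiable (by simp)) x).hasFDerivAt
    have h2 : fderiv ℝ (fun x => χ x * φ x) x = _ := this.fderiv
    rw [h2, ← fderiv_apply_eq_inner_gradient]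
    simp
  have hφ'c : HasCompactSupport fun x => fderiv ℝ φ x w :=
    (hφc.fderiv ℝ).comp_left (g := fun L : EuclideanSpace ℝ (Fin n) →L[ℝ] ℝ => L w) (by simp)
  have hφ'cont : Continuous fun x => fderiv ℝ φ x w :=
    (hφ.continuous_fderiv (by simp)).clm_apply continuous_const
  have hφcont := hφ.continuous
  have hχcont := hχ.continuous
  have i1 : Integrable fun x => χ x * p x * fderiv ℝ φ x w := by
    refine (hp.1.integrable_smul_left_of_hasCompactSupport
      (g := fun x => χ x * fderiv ℝ φ x w) (by fun_prop) hφ'c.mul_left).congr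
      (Eventually.of_forall fun x => ?_)
    simp only [smul_eq_mul]; ring
  have i2 : Integrable fun x => φ x * (p x * inner ℝ (∇ χ x) w) := by
    refine (hp.1.integrable_smul_left_of_hasCompactSupport
      (g := fun x => φ x * inner ℝ (∇ χ x) w) (by fun_prop) hφc.mul_right).congr
      (Eventually.of_forall fun x => ?_)
    simp only [smul_eq_mul]; ring
  have i3 : Integrable fun x => χ x * φ x * inner ℝ (g x) w := by
    refine ((hp.2.1.integrable_smul_left_of_hasCompactSupport
      (g := fun x => χ x * φ x) (by fun_prop) hφc.mul_left).inner_const w).congr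
      (Eventually.of_forall fun x => ?_)
    simp only [real_inner_smul_left]
  have e1 : ∫ x, p x * fderiv ℝ (fun x => χ x * φ x) x w =
      (∫ x, χ x * p x * fderiv ℝ φ x w) + ∫ x, φ x * (p x * inner ℝ (∇ χ x) w) := by
    rw [← integral_add i1 i2]
    refine integral_congr_ae (Eventually.of_forall fun x => ?_)
    simp only [hfd]; ring
  have e2 : ∫ x, φ x * inner ℝ (χ x • g x + p x • ∇ χ x) w =
      (∫ x, χ x * φ x * inner ℝ (g x) w) + ∫ x, φ x * (p x * inner ℝ (∇ χ x) w) := by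
    rw [← integral_add i3 i2]
    refine integral_congr_ae (Eventually.of_forall fun x => ?_)
    simp only [inner_add_left, real_inner_smul_left]; ring
  linarith

/-- A smooth compactly supported function equal to `1` on the ball of radius `k + 1`. -/
noncomputable def cutoff (n k : ℕ) (x : EuclideanSpace ℝ (Fin n)) : ℝ :=
  (⟨1, 2, one_pos, one_lt_two⟩ : ContDiffBump (0 : EuclideanSpace ℝ (Fin n)))
    (((k : ℝ) + 1)⁻¹ • x)

theorem contDiff_cutoff (n k : ℕ) : ContDiff ℝ ∞ (cutoff n k) :=
  (ContDiffBump.contDiff _).comp (contDiff_const_smul _)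

theorem cutoff_nonneg (n k : ℕ) (x : EuclideanSpace ℝ (Fin n)) : 0 ≤ cutoff n k x :=
  ContDiffBump.nonneg _

theorem cutoff_le_one (n k : ℕ) (x : EuclideanSpace ℝ (Fin n)) : cutoff n k x ≤ 1 :=
  ContDiffBump.le_one _

theorem hasCompactSupport_cutoff (n k : ℕ) : HasCompactSupport (cutoff n k) :=
  (ContDiffBump.hasCompactSupport _).comp_smul (by positivity : ((k : ℝ) + 1)⁻¹ ≠ 0)

theorem tendsto_cutoff (x : EuclideanSpace ℝ (Fin n)) :
    Tendsto (fun k => cutoff n k x) atTop (𝓝 1) := by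
  refine tendsto_const_nhds.congr' ?_
  filter_upwards [eventually_ge_atTop ⌈‖x‖⌉₊] with k hk
  refine (ContDiffBump.one_of_mem_closedBall _ ?_).symm
  have h1 : ‖x‖ ≤ k := Nat.ceil_le.1 hk
  have h2 : (0 : ℝ) < k + 1 := by positivity
  simp only [Metric.mem_closedBall, dist_zero_right, norm_smul, norm_inv, Real.norm_eq_abs,
    abs_of_pos h2]
  rw [inv_mul_le_iff₀ h2]
  linarith

theorem exists_norm_gradient_cutoff_le (n : ℕ) :
    ∃ C : ℝ, ∀ k x, ‖∇ (cutoff n k) x‖ ≤ C / (k + 1) := by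
  set ζ : ContDiffBump (0 : EuclideanSpace ℝ (Fin n)) := ⟨1, 2, one_pos, one_lt_two⟩ with hζ
  obtain ⟨C, hC⟩ := (ζ.hasCompactSupport.fderiv ℝ).exists_bound_of_continuous
    ((ζ.contDiff (n := 1)).continuous_fderiv one_ne_zero)
  refine ⟨C, fun k x => ?_⟩
  have h2 : (0 : ℝ) < k + 1 := by positivity
  have h1 : fderiv ℝ (cutoff n k) x = ((k : ℝ) + 1)⁻¹ • fderiv ℝ ζ (((k : ℝ) + 1)⁻¹ • x) :=
    fderiv_comp_smul _
  rw [gradient, LinearIsometryEquiv.norm_map, h1, norm_smul, norm_inv, Real.norm_of_nonneg h2.le,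
    div_eq_inv_mul]
  exact mul_le_mul_of_nonneg_left (hC _) (by positivity)

theorem gradient_cutoff_sq (k : ℕ) (x : EuclideanSpace ℝ (Fin n)) :
    ∇ (fun x => cutoff n k x ^ 2) x = (2 * cutoff n k x) • ∇ (cutoff n k) x := by
  have := (((contDiff_cutoff n k).differentiable (by simp)) x).hasFDerivAt.pow 2
  have h2 : fderiv ℝ (fun x => cutoff n k x ^ 2) x = _ := this.fderiv
  rw [gradient, h2]
  simp [gradient]

namespace HasFiniteFisherInfo

/-- Cutting off a density increases its Fisher information only slightly. -/
theorem cutoff_mul (h : HasFiniteFisherInfo p g) {C : ℝ}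
    (hCb : ∀ k x, ‖∇ (cutoff n k) x‖ ≤ C / (k + 1)) (k : ℕ) :
    ∃ G, HasFiniteFisherInfo (fun x => cutoff n k x ^ 2 * p x) G ∧
      ∫ x, ‖G x‖ ^ 2 / (cutoff n k x ^ 2 * p x) ≤
        (1 + 1 / (k + 1)) * (∫ x, ‖g x‖ ^ 2 / p x) + 8 * C ^ 2 * (1 / (k + 1)) * ∫ x, p x := by
  have hk : (0 : ℝ) < k + 1 := by positivity
  -- The cutoff is squared because `∇ χ² = 2 χ ∇ χ` then carries a factor `χ`, which cancels the
  -- `χ²` in the denominator of the Fisher information.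
  have hsq : ContDiff ℝ ∞ fun x => cutoff n k x ^ 2 := (contDiff_cutoff n k).pow 2
  have hw := h.hasWeakGradient.smooth_mul hsq
  set G := fun x => cutoff n k x ^ 2 • g x + p x • ∇ (fun x => cutoff n k x ^ 2) x with hG
  have h0 : ∀ x, 0 ≤ cutoff n k x ^ 2 * p x := fun x => mul_nonneg (sq_nonneg _) (h.nonneg x)
  have hGe : ∀ x, G x = cutoff n k x • (cutoff n k x • g x + (2 * p x) • ∇ (cutoff n k) x) := by
    intro x
    simp only [hG, gradient_cutoff_sq, smul_add, smul_smul]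
    congr 2 <;> ring_nf
  have hpt : ∀ x, ‖G x‖ ^ 2 / (cutoff n k x ^ 2 * p x) ≤
      (1 + 1 / (k + 1)) * (‖g x‖ ^ 2 / p x) + 8 * C ^ 2 * (1 / (k + 1)) * p x := by
    intro x
    have hp0 := h.nonneg x
    have hr : 0 ≤ (1 + 1 / ((k : ℝ) + 1)) * (‖g x‖ ^ 2 / p x) + 8 * C ^ 2 * (1 / (k + 1)) * p x := by
      positivity
    rcases (cutoff_nonneg n k x).eq_or_lt with hz | hz
    · simpa [← hz] using hr
    rcases hp0.eq_or_lt with hp | hp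
    · simp [← hp]
    set z := cutoff n k x with hzdef
    have e : ‖G x‖ ^ 2 / (z ^ 2 * p x) = ‖z • g x + (2 * p x) • ∇ (cutoff n k) x‖ ^ 2 / p x := by
      rw [hGe, ← hzdef, norm_smul, mul_pow, Real.norm_of_nonneg hz.le]
      field_simp
    set A := ‖g x‖ with hA
    set D := ‖∇ (cutoff n k) x‖ with hD
    have hn : ‖z • g x + (2 * p x) • ∇ (cutoff n k) x‖ ≤ A + 2 * p x * D := by
      refine (norm_add_le _ _).trans (add_le_add ?_ ?_)
      · rw [norm_smul, Real.norm_of_nonneg hz.le]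
        exact mul_le_of_le_one_left (norm_nonneg _) (cutoff_le_one n k x)
      · rw [norm_smul, Real.norm_of_nonneg (by positivity)]
    have hDC : D * (k + 1) ≤ C := by
      have := hCb k x
      rwa [le_div_iff₀ hk] at this
    have hA0 : 0 ≤ A := norm_nonneg _
    have hD0 : 0 ≤ D := norm_nonneg _
    rw [e, div_le_iff₀ hp]
    have e2 : ((1 + 1 / ((k : ℝ) + 1)) * (A ^ 2 / p x) + 8 * C ^ 2 * (1 / (k + 1)) * p x) * p x =
        (1 + 1 / ((k : ℝ) + 1)) * A ^ 2 + 8 * C ^ 2 * (1 / (k + 1)) * p x ^ 2 := by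
      field_simp
    rw [e2]
    refine (pow_le_pow_left₀ (norm_nonneg _) hn 2).trans ?_
    set K : ℝ := (k : ℝ) + 1 with hKdef
    have hK1 : 1 ≤ K := by rw [hKdef]; linarith [(Nat.cast_nonneg k : (0 : ℝ) ≤ k)]
    -- Young's inequality with weight `K = k + 1`: its loss `1 / K` on the main term vanishes, and
    -- the factor `1 + K ≤ 2 K` on the error is beaten by `D² ≤ C² / K²`.
    have h1 : (A + 2 * p x * D) ^ 2 ≤ (1 + 1 / K) * A ^ 2 + (1 + K) * (2 * p x * D) ^ 2 := by
      have : (1 + 1 / K) * A ^ 2 + (1 + K) * (2 * p x * D) ^ 2 - (A + 2 * p x * D) ^ 2 =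
          (A - K * (2 * p x * D)) ^ 2 / K := by field_simp; ring
      have h2 : 0 ≤ (A - K * (2 * p x * D)) ^ 2 / K := by positivity
      linarith
    have h3 : (1 + K) * (2 * p x * D) ^ 2 ≤ 8 * C ^ 2 * (1 / K) * p x ^ 2 := by
      have h4 : (D * K) ^ 2 ≤ C ^ 2 := pow_le_pow_left₀ (by positivity) hDC 2
      have h5 : (1 + K) * (2 * p x * D) ^ 2 ≤ (2 * K) * (2 * p x * D) ^ 2 :=
        mul_le_mul_of_nonneg_right (by linarith) (sq_nonneg _)
      have h6 : (2 * K) * (2 * p x * D) ^ 2 = 8 * (D * K) ^ 2 * (1 / K) * p x ^ 2 := by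
        field_simp; ring
      rw [h6] at h5
      refine h5.trans ?_
      gcongr
    linarith
  have hgm := h.hasWeakGradient.2.1.aestronglyMeasurable
  have hFi : Integrable fun x => ‖G x‖ ^ 2 / (cutoff n k x ^ 2 * p x) := by
    refine ((h.integrable_fisher.const_mul (1 + 1 / ((k : ℝ) + 1))).add
      (h.integrable.const_mul (8 * C ^ 2 * (1 / (k + 1))))).mono' ?_
      (Eventually.of_forall fun x => ?_)
    · exact ((hw.2.1.aestronglyMeasurable.norm.aemeasurable.pow_const 2).div
        hw.1.aestronglyMeasurable.aemeasurable).aestronglyMeasurable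
    · rw [Real.norm_of_nonneg (div_nonneg (sq_nonneg _) (h0 x))]; exact hpt x
  refine ⟨G, ⟨h0, ?_, hw, hFi, ?_⟩, ?_⟩
  · refine h.integrable.mono' hw.1.aestronglyMeasurable (Eventually.of_forall fun x => ?_)
    rw [Real.norm_of_nonneg (h0 x)]
    exact mul_le_of_le_one_left (h.nonneg x) (pow_le_one₀ (cutoff_nonneg n k x) (cutoff_le_one n k x))
  · filter_upwards [h.ae_eq_zero] with x hx h1
    rcases mul_eq_zero.1 h1 with h2 | h2
    · rw [hGe, pow_eq_zero_iff two_ne_zero |>.1 h2, zero_smul]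
    · rw [hGe, hx h2, h2]; simp
  · refine (integral_mono hFi ((h.integrable_fisher.const_mul (1 + 1 / ((k : ℝ) + 1))).add
      (h.integrable.const_mul (8 * C ^ 2 * (1 / (k + 1))))) hpt).trans (le_of_eq ?_)
    simp only [Pi.add_apply]
    rw [integral_add (h.integrable_fisher.const_mul _) (h.integrable.const_mul _),
      integral_const_mul, integral_const_mul]

theorem integral_cutoff_mul_le (h : HasFiniteFisherInfo p g) (k : ℕ) :
    ∫ x, cutoff n k x ^ 2 * p x ≤ ∫ x, p x := by
  refine integral_mono_of_nonneg
    (Eventually.of_forall fun x => mul_nonneg (sq_nonneg _) (h.nonneg x)) h.integrable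
    (Eventually.of_forall fun x => ?_)
  exact mul_le_of_le_one_left (h.nonneg x) (pow_le_one₀ (cutoff_nonneg n k x) (cutoff_le_one n k x))

theorem tendsto_cutoff_bound (C J m : ℝ) :
    Tendsto (fun k : ℕ => (1 + 1 / ((k : ℝ) + 1)) * J + 8 * C ^ 2 * (1 / (k + 1)) * m) atTop
      (𝓝 J) := by
  have h : Tendsto (fun k : ℕ => 1 / ((k : ℝ) + 1)) atTop (𝓝 0) :=
    tendsto_one_div_add_atTop_nhds_zero_nat
  simpa using ((h.const_add 1).mul_const J).add ((h.const_mul (8 * C ^ 2)).mul_const m)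

theorem integral_mul_posLog_le (h : HasFiniteFisherInfo p g) (hm : ∫ x, p x ≤ 1) :
    (Integrable fun x => p x * max (Real.log (p x)) 0) ∧
      ∫ x, p x * max (Real.log (p x)) 0 ≤ 2 * (∫ x, ‖g x‖ ^ 2 / p x) + 6 := by
  obtain ⟨C, hCb⟩ := exists_norm_gradient_cutoff_le n
  choose G hG hGJ using h.cutoff_mul hCb
  have hcs : ∀ k, HasCompactSupport fun x => cutoff n k x ^ 2 * p x := fun k =>
    ((hasCompactSupport_cutoff n k).comp_left (g := fun s : ℝ => s ^ 2) (by simp)).mul_right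
  have key := fun k => (hG k).integral_mul_posLog_le_of_hasCompactSupport (hcs k)
    ((h.integral_cutoff_mul_le k).trans hm)
  have e : ∀ s : ℝ, 0 ≤ s → s * max (Real.log s) 0 = max (s * Real.log s) 0 := fun s hs => by
    rw [mul_max_of_nonneg _ _ hs, mul_zero]
  refine integrable_and_integral_le_of_tendsto (fun k => (key k).1)
    (fun k x => mul_nonneg ((hG k).nonneg x) (le_max_right _ _))
    (Eventually.of_forall fun x => ?_)
    (fun k => (key k).2.trans (add_le_add_left (mul_le_mul_of_nonneg_left (hGJ k) two_pos.le) 6))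
    (((tendsto_cutoff_bound C _ _).const_mul 2).add_const 6)
  rw [e _ (h.nonneg x)]
  simp_rw [fun k => e _ ((hG k).nonneg x)]
  have hx : Tendsto (fun k => cutoff n k x ^ 2 * p x) atTop (𝓝 (p x)) := by
    simpa using ((tendsto_cutoff x).pow 2).mul_const (p x)
  exact ((Real.continuous_mul_log.tendsto _).comp hx).max tendsto_const_nhds

/-- The cutoff is removed by dominated convergence. For `0 < s ≤ 1` and `p > 0`, `s p log (s p) = s
(p log p) + p (s log s)` with `|s log s| ≤ 1`, so `|p log p| + p` dominates. Hence the integrability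
hypothesis on `p log p`. -/
theorem integral_mul_log_le (h : HasFiniteFisherInfo p g) (hm : ∫ x, p x = 1)
    (hlog : Integrable fun x => p x * Real.log (p x)) {b : ℝ} (hb : 0 < b) :
    ∫ x, p x * Real.log (p x) ≤ b ^ 2 / 2 * (∫ x, ‖g x‖ ^ 2 / p x) - n * lsiConst b := by
  obtain ⟨C, hCb⟩ := exists_norm_gradient_cutoff_le n
  choose G hG hGJ using h.cutoff_mul hCb
  have hcs : ∀ k, HasCompactSupport fun x => cutoff n k x ^ 2 * p x := fun k =>
    ((hasCompactSupport_cutoff n k).comp_left (g := fun s : ℝ => s ^ 2) (by simp)).mul_right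
  have key := fun k => (hG k).integral_mul_log_le_of_hasCompactSupport (hcs k) hb
  have hx : ∀ x, Tendsto (fun k => cutoff n k x ^ 2 * p x) atTop (𝓝 (p x)) := fun x => by
    simpa using ((tendsto_cutoff x).pow 2).mul_const (p x)
  have hsq1 : ∀ k x, cutoff n k x ^ 2 ≤ 1 := fun k x =>
    pow_le_one₀ (cutoff_nonneg n k x) (cutoff_le_one n k x)
  have lm : Tendsto (fun k => ∫ x, cutoff n k x ^ 2 * p x) atTop (𝓝 1) := by
    rw [← hm]
    refine tendsto_integral_of_dominated_convergence p
      (fun k => (hG k).integrable.aestronglyMeasurable) h.integrable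
      (fun k => Eventually.of_forall fun x => ?_) (Eventually.of_forall hx)
    rw [Real.norm_of_nonneg ((hG k).nonneg x)]
    exact mul_le_of_le_one_left (h.nonneg x) (hsq1 k x)
  have ll : Tendsto (fun k => ∫ x, cutoff n k x ^ 2 * p x * Real.log (cutoff n k x ^ 2 * p x))
      atTop (𝓝 (∫ x, p x * Real.log (p x))) := by
    refine tendsto_integral_of_dominated_convergence (fun x => |p x * Real.log (p x)| + p x)
      (fun k => (key k).1.aestronglyMeasurable) (hlog.abs.add h.integrable)
      (fun k => Eventually.of_forall fun x => ?_)
      (Eventually.of_forall fun x => (Real.continuous_mul_log.tendsto _).comp (hx x))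
    have hc0 := sq_nonneg (cutoff n k x)
    have hp0 := h.nonneg x
    have hc1 := hsq1 k x
    set s := cutoff n k x ^ 2 with hs
    rcases hc0.eq_or_lt with h1 | h1
    · rw [← h1]; simp; positivity
    rcases hp0.eq_or_lt with h2 | h2
    · rw [← h2]; simp
    have e : s * p x * Real.log (s * p x) = s * (p x * Real.log (p x)) + p x * (s * Real.log s) := by
      rw [Real.log_mul h1.ne' h2.ne']; ring
    have h3 : |s * Real.log s| ≤ 1 := by
      have h4 := Real.negMulLog_le_one_sub_self hc0
      rw [Real.negMulLog, neg_mul] at h4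
      rw [abs_of_nonpos (mul_nonpos_of_nonneg_of_nonpos hc0 (Real.log_nonpos hc0 hc1))]
      linarith
    rw [e, Real.norm_eq_abs]
    refine (abs_add_le _ _).trans (add_le_add ?_ ?_)
    · rw [abs_mul s, abs_of_nonneg hc0]
      exact mul_le_of_le_one_left (abs_nonneg _) hc1
    · rw [abs_mul (p x) (s * Real.log s), abs_of_nonneg hp0]
      exact mul_le_of_le_one_right hp0 h3
  have lr := (((Real.continuous_mul_log.tendsto _).comp lm).add
    ((tendsto_cutoff_bound C (∫ x, ‖g x‖ ^ 2 / p x) (∫ x, p x)).const_mul (b ^ 2 / 2))).sub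
    (lm.const_mul (n * lsiConst b))
  simp only [Real.log_one, mul_zero, zero_add, mul_one] at lr
  refine le_of_tendsto_of_tendsto' ll lr fun k => (key k).2.trans ?_
  have := mul_le_mul_of_nonneg_left (hGJ k) (by positivity : 0 ≤ b ^ 2 / 2)
  simp only [Function.comp_apply]
  linarith

end HasFiniteFisherInfo

end Cutoff

end BayesCR

namespace BayesCR

open Filter Topology Set

/-! ### Densities of arbitrary mass, and inequalities in `[0, ∞]`. -/

section Density

variable {n : ℕ} {q : EuclideanSpace ℝ (Fin n) → ℝ}
  {G : EuclideanSpace ℝ (Fin n) → EuclideanSpace ℝ (Fin n)}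

theorem HasWeakGradient.const_mul (h : HasWeakGradient q G) (c : ℝ) :
    HasWeakGradient (fun x => c * q x) (fun x => c • G x) := by
  refine ⟨h.1.smul c, h.2.1.smul c, fun φ hφ hφc w => ?_⟩
  have e1 : (fun x => c * q x * fderiv ℝ φ x w) = fun x => c * (q x * fderiv ℝ φ x w) := by
    funext x; ring
  have e2 : (fun x => φ x * inner ℝ (c • G x) w) = fun x => c * (φ x * inner ℝ (G x) w) := by
    funext x; rw [real_inner_smul_left]; ring
  rw [e1, e2, integral_const_mul, integral_const_mul, h.2.2 φ hφ hφc w]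
  ring

theorem HasWeakGradient.congr_right {G' : EuclideanSpace ℝ (Fin n) → EuclideanSpace ℝ (Fin n)}
    (h : HasWeakGradient q G) (hG : G =ᵐ[volume] G') : HasWeakGradient q G' := by
  refine ⟨h.1, h.2.1.congr hG, fun φ hφ hφc w => ?_⟩
  rw [h.2.2 φ hφ hφc w]
  congr 1
  refine integral_congr_ae ?_
  filter_upwards [hG] with x hx
  rw [hx]

theorem HasFiniteFisherInfo.const_mul (h : HasFiniteFisherInfo q G) {c : ℝ} (hc : 0 < c) :
    HasFiniteFisherInfo (fun x => c * q x) (fun x => c • G x) ∧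
      ∫ x, ‖c • G x‖ ^ 2 / (c * q x) = c * ∫ x, ‖G x‖ ^ 2 / q x := by
  have e : ∀ x, ‖c • G x‖ ^ 2 / (c * q x) = c * (‖G x‖ ^ 2 / q x) := by
    intro x
    rw [norm_smul, mul_pow, Real.norm_of_nonneg hc.le, mul_div_mul_comm, sq c, mul_self_div_self]
  refine ⟨⟨fun x => mul_nonneg hc.le (h.nonneg x), h.integrable.const_mul c,
    h.hasWeakGradient.const_mul c, ?_, ?_⟩, ?_⟩
  · simp_rw [e]; exact h.integrable_fisher.const_mul c
  · filter_upwards [h.ae_eq_zero] with x hx hx0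
    rw [hx ((mul_eq_zero.1 hx0).resolve_left hc.ne'), smul_zero]
  · simp_rw [e]; exact integral_const_mul _ _

/-- The negative part of the entropy of a density is controlled by its Fisher information. -/
theorem HasFiniteFisherInfo.lintegral_mul_log_le (h : HasFiniteFisherInfo q G) :
    ∫⁻ x, ENNReal.ofReal (q x) * ENNReal.ofReal (Real.log (q x / ∫ y, q y)) ≤
      6 * ENNReal.ofReal (∫ x, q x) + 2 * ENNReal.ofReal (∫ x, ‖G x‖ ^ 2 / q x) := by
  set m := ∫ x, q x with hm
  have hm' : 0 ≤ m := integral_nonneg h.nonneg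
  rcases hm'.eq_or_lt with h0 | h0
  · rw [← h0]; simp
  obtain ⟨hp, hJ⟩ := h.const_mul (inv_pos.2 h0)
  have hmass : ∫ x, m⁻¹ * q x = 1 := by rw [integral_const_mul, ← hm, inv_mul_cancel₀ h0.ne']
  obtain ⟨hi, hle⟩ := hp.integral_mul_posLog_le hmass.le
  have e : ∀ x, ENNReal.ofReal (q x) * ENNReal.ofReal (Real.log (q x / m)) =
      ENNReal.ofReal (m * (m⁻¹ * q x * max (Real.log (m⁻¹ * q x)) 0)) := by
    intro x
    have e1 : m * (m⁻¹ * q x * max (Real.log (m⁻¹ * q x)) 0) =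
        q x * max (Real.log (q x / m)) 0 := by
      rw [div_eq_inv_mul, ← mul_assoc, ← mul_assoc, mul_inv_cancel₀ h0.ne', one_mul]
    rw [e1, ENNReal.ofReal_mul (h.nonneg x), ENNReal.ofReal_max, ENNReal.ofReal_zero, max_eq_left zero_le]
  simp_rw [e]
  rw [← ofReal_integral_eq_lintegral_ofReal (hi.const_mul m) (Eventually.of_forall fun x =>
      mul_nonneg h0.le (mul_nonneg (hp.nonneg x) (le_max_right _ _))), integral_const_mul]
  have hJ0 : 0 ≤ ∫ x, ‖G x‖ ^ 2 / q x :=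
    integral_nonneg fun x => div_nonneg (sq_nonneg _) (h.nonneg x)
  rw [hJ] at hle
  calc _ ≤ ENNReal.ofReal (6 * m + 2 * ∫ x, ‖G x‖ ^ 2 / q x) := by
        refine ENNReal.ofReal_le_ofReal ?_
        calc _ ≤ m * (2 * (m⁻¹ * ∫ x, ‖G x‖ ^ 2 / q x) + 6) :=
              mul_le_mul_of_nonneg_left hle h0.le
          _ = _ := by field_simp; ring
    _ = _ := by
        rw [ENNReal.ofReal_add (by positivity) (by positivity), ENNReal.ofReal_mul (by norm_num),
          ENNReal.ofReal_mul (by norm_num), ENNReal.ofReal_ofNat, ENNReal.ofReal_ofNat]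

/-- The Euclidean logarithmic Sobolev inequality, with the positive and the negative part of the
entropy separated. -/
theorem HasFiniteFisherInfo.lintegral_mul_log_add_le (h : HasFiniteFisherInfo q G) {b : ℝ}
    (hb : 0 < b) :
    (∫⁻ x, ENNReal.ofReal (q x) * ENNReal.ofReal (Real.log (q x / ∫ y, q y))) +
        ENNReal.ofReal (n * lsiConst b) * ENNReal.ofReal (∫ x, q x) ≤
      (∫⁻ x, ENNReal.ofReal (q x) * ENNReal.ofReal (-Real.log (q x / ∫ y, q y))) +
        ENNReal.ofReal (b ^ 2 / 2) * ENNReal.ofReal (∫ x, ‖G x‖ ^ 2 / q x) +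
        ENNReal.ofReal (-(n * lsiConst b)) * ENNReal.ofReal (∫ x, q x) := by
  have hneg := h.lintegral_mul_log_le
  set m := ∫ x, q x with hm
  have hJ0 : 0 ≤ ∫ x, ‖G x‖ ^ 2 / q x :=
    integral_nonneg fun x => div_nonneg (sq_nonneg _) (h.nonneg x)
  have hm' : 0 ≤ m := integral_nonneg h.nonneg
  rcases hm'.eq_or_lt with h0 | h0
  · rw [← h0]; simp
  set N := ∫⁻ x, ENNReal.ofReal (q x) * ENNReal.ofReal (Real.log (q x / m)) with hN
  set P := ∫⁻ x, ENNReal.ofReal (q x) * ENNReal.ofReal (-Real.log (q x / m)) with hP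
  -- If `P` is infinite there is nothing to prove. Otherwise `N` is finite by the preceding bound,
  -- so `q log (q / m)` is integrable and the real inequality applies to `q / m`.
  rcases eq_or_ne P ⊤ with hPt | hPt
  · rw [hPt]; simp
  have hNt : N ≠ ⊤ := (hneg.trans_lt (by finiteness)).ne
  obtain ⟨hp, hJ⟩ := h.const_mul (inv_pos.2 h0)
  have hmass : ∫ x, m⁻¹ * q x = 1 := by rw [integral_const_mul, ← hm, inv_mul_cancel₀ h0.ne']
  have hqm := h.integrable.aestronglyMeasurable.aemeasurable
  have hN' : N = ∫⁻ x, ENNReal.ofReal (q x * Real.log (q x / m)) :=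
    lintegral_congr fun x => (ENNReal.ofReal_mul (h.nonneg x)).symm
  have hP' : P = ∫⁻ x, ENNReal.ofReal (-(q x * Real.log (q x / m))) :=
    lintegral_congr fun x => by
      rw [← mul_neg]; exact (ENNReal.ofReal_mul (h.nonneg x)).symm
  have hmeas : AEStronglyMeasurable fun x => q x * Real.log (q x / m) :=
    (hqm.mul (Real.measurable_log.comp_aemeasurable (hqm.div_const m))).aestronglyMeasurable
  have hint : Integrable fun x => q x * Real.log (q x / m) := by
    refine ⟨hmeas, ?_⟩
    rw [HasFiniteIntegral]
    have e : ∀ x, ‖q x * Real.log (q x / m)‖ₑ = ENNReal.ofReal (q x * Real.log (q x / m)) +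
        ENNReal.ofReal (-(q x * Real.log (q x / m))) := by
      intro x
      rw [Real.enorm_eq_ofReal_abs]
      rcases le_total 0 (q x * Real.log (q x / m)) with h1 | h1
      · rw [abs_of_nonneg h1, ENNReal.ofReal_of_nonpos (neg_nonpos.2 h1), add_zero]
      · rw [abs_of_nonpos h1, ENNReal.ofReal_of_nonpos h1, zero_add]
    simp_rw [e]
    rw [lintegral_add_left' hmeas.aemeasurable.ennreal_ofReal, ← hN', ← hP']
    exact ENNReal.add_lt_top.2 ⟨hNt.lt_top, hPt.lt_top⟩
  have hval : ∫ x, q x * Real.log (q x / m) = N.toReal - P.toReal := by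
    rw [integral_eq_lintegral_pos_part_sub_lintegral_neg_part hint, ← hN', ← hP']
  have e : ∀ x, m⁻¹ * q x * Real.log (m⁻¹ * q x) = m⁻¹ * (q x * Real.log (q x / m)) := by
    intro x; rw [div_eq_inv_mul, mul_assoc]
  have key := hp.integral_mul_log_le hmass (by simp_rw [e]; exact hint.const_mul _) hb
  simp_rw [e] at key
  rw [integral_const_mul, hval, hJ] at key
  have key2 : N.toReal + n * lsiConst b * m ≤
      P.toReal + b ^ 2 / 2 * ∫ x, ‖G x‖ ^ 2 / q x := by
    have := mul_le_mul_of_nonneg_left key h0.le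
    have e1 : m * (m⁻¹ * (N.toReal - P.toReal)) = N.toReal - P.toReal := by field_simp
    have e2 : m * (b ^ 2 / 2 * (m⁻¹ * ∫ x, ‖G x‖ ^ 2 / q x) - n * lsiConst b) =
        b ^ 2 / 2 * (∫ x, ‖G x‖ ^ 2 / q x) - n * lsiConst b * m := by field_simp
    rw [e1, e2] at this
    linarith
  -- For small `b` the constant is negative. Its two signs are kept on opposite sides, so nothing is
  -- subtracted in `[0, ∞]`.
  set c := n * lsiConst b with hc
  rw [← ENNReal.ofReal_toReal hNt, ← ENNReal.ofReal_toReal hPt,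
    ← ENNReal.ofReal_mul (p := b ^ 2 / 2) (by positivity)]
  have hbJ := mul_nonneg (by positivity : 0 ≤ b ^ 2 / 2) hJ0
  rcases le_total 0 c with hc0 | hc0
  · rw [ENNReal.ofReal_of_nonpos (neg_nonpos.2 hc0), zero_mul, add_zero, ← ENNReal.ofReal_mul hc0,
      ← ENNReal.ofReal_add ENNReal.toReal_nonneg (by positivity),
      ← ENNReal.ofReal_add ENNReal.toReal_nonneg hbJ]
    exact ENNReal.ofReal_le_ofReal key2
  · have hc1 : 0 ≤ -c := neg_nonneg.2 hc0
    rw [ENNReal.ofReal_of_nonpos hc0, zero_mul, add_zero, ← ENNReal.ofReal_mul hc1,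
      ← ENNReal.ofReal_add ENNReal.toReal_nonneg hbJ,
      ← ENNReal.ofReal_add (by positivity) (by positivity)]
    refine ENNReal.ofReal_le_ofReal ?_
    linarith

theorem ofReal_div_ofReal_of_ne_zero {a b : ℝ} (hb : 0 ≤ b) (h : b = 0 → a = 0) :
    ENNReal.ofReal a / ENNReal.ofReal b = ENNReal.ofReal (a / b) := by
  rcases hb.eq_or_lt with h0 | h0
  · simp [← h0, h h0.symm]
  · rw [ENNReal.ofReal_div_of_pos h0]

/-- In `[0, ∞]` a positive number over zero is `∞`. Finiteness of the extended Fisher integrand is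
thus what supplies the vanishing that real division cannot detect. -/
theorem eq_zero_of_ofReal_div_ne_top {F : Type*} [NormedAddCommGroup F] {v : F} {b : ℝ}
    (h : ENNReal.ofReal (‖v‖ ^ 2) / ENNReal.ofReal b ≠ ⊤) (hb : b = 0) : v = 0 := by
  by_contra hv
  apply h
  have : 0 < ‖v‖ := norm_pos_iff.2 hv
  rw [hb, ENNReal.ofReal_zero, ENNReal.div_zero]
  simpa using hv

/-- A weakly differentiable density with finite Fisher information `∫⁻ |G|² / q`. -/
theorem HasWeakGradient.hasFiniteFisherInfo (h : HasWeakGradient q G) (h0 : ∀ x, 0 ≤ q x)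
    (hm : ∫⁻ x, ENNReal.ofReal (q x) ≠ ⊤)
    (hJ : ∫⁻ x, ENNReal.ofReal (‖G x‖ ^ 2) / ENNReal.ofReal (q x) ≠ ⊤) :
    HasFiniteFisherInfo q G ∧ ENNReal.ofReal (∫ x, ‖G x‖ ^ 2 / q x) =
      ∫⁻ x, ENNReal.ofReal (‖G x‖ ^ 2) / ENNReal.ofReal (q x) := by
  have hq := h.1.aestronglyMeasurable
  have hG := h.2.1.aestronglyMeasurable
  have hGm := hG.norm.aemeasurable.pow_const 2
  have hz : ∀ᵐ x, q x = 0 → G x = 0 := by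
    filter_upwards [ae_lt_top' (hGm.ennreal_ofReal.div hq.aemeasurable.ennreal_ofReal) hJ]
      with x hx using eq_zero_of_ofReal_div_ne_top hx.ne
  have e : ∫⁻ x, ENNReal.ofReal (‖G x‖ ^ 2) / ENNReal.ofReal (q x) =
      ∫⁻ x, ENNReal.ofReal (‖G x‖ ^ 2 / q x) := by
    refine lintegral_congr_ae ?_
    filter_upwards [hz] with x hx
    exact ofReal_div_ofReal_of_ne_zero (h0 x) fun h => by simp [hx h]
  have hn : ∀ x, 0 ≤ ‖G x‖ ^ 2 / q x := fun x => div_nonneg (sq_nonneg _) (h0 x)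
  have hFi : Integrable fun x => ‖G x‖ ^ 2 / q x :=
    ⟨(hGm.div hq.aemeasurable).aestronglyMeasurable, by
      rw [hasFiniteIntegral_iff_ofReal (Eventually.of_forall hn), ← e]; exact hJ.lt_top⟩
  refine ⟨⟨h0, ⟨hq, ?_⟩, h, hFi, hz⟩, ?_⟩
  · rw [hasFiniteIntegral_iff_ofReal (Eventually.of_forall h0)]; exact hm.lt_top
  · rw [e, ofReal_integral_eq_lintegral_ofReal hFi (Eventually.of_forall hn)]

end Density

/-! ### Gibbs' inequality: entropy against second moments. -/

section Gibbs

variable {n : ℕ}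

/-- The density of the Gaussian measure with mean `c` and covariance `a • 1`. -/
noncomputable def isoGaussian (a : ℝ) (c x : EuclideanSpace ℝ (Fin n)) : ℝ :=
  Real.exp (-(n / 2 * Real.log (2 * Real.pi * a)) - ‖x - c‖ ^ 2 / (2 * a))

theorem lintegral_isoGaussian {a : ℝ} (ha : 0 < a) (c : EuclideanSpace ℝ (Fin n)) :
    ∫⁻ x, ENNReal.ofReal (isoGaussian a c x) = 1 := by
  have hpa : 0 < 2 * Real.pi * a := by positivity
  have hb : 0 < 1 / (2 * a) := by positivity
  have e : ∀ x, isoGaussian a c x = Real.exp (-(n / 2 * Real.log (2 * Real.pi * a))) *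
      Real.exp (-(1 / (2 * a)) * ‖x - c‖ ^ 2) := by
    intro x
    rw [isoGaussian, ← Real.exp_add]
    congr 1; ring
  have hI : ∫ v : EuclideanSpace ℝ (Fin n), Real.exp (-(1 / (2 * a)) * ‖v‖ ^ 2) =
      Real.exp (n / 2 * Real.log (2 * Real.pi * a)) := by
    rw [GaussianFourier.integral_rexp_neg_mul_sq_norm hb, finrank_euclideanSpace, Fintype.card_fin,
      Real.rpow_def_of_pos (by positivity), mul_comm]
    congr 3
    field_simp
  -- A Bochner integral with nonzero value forces integrability.
  have hi : Integrable fun v : EuclideanSpace ℝ (Fin n) => Real.exp (-(1 / (2 * a)) * ‖v‖ ^ 2) := by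
    by_contra hni
    rw [integral_undef hni] at hI
    exact (Real.exp_pos _).ne hI
  have hi2 : Integrable (isoGaussian a c) := by
    rw [funext e]; exact (hi.comp_sub_right c).const_mul _
  rw [← ofReal_integral_eq_lintegral_ofReal hi2 (Eventually.of_forall fun x => (Real.exp_pos _).le)]
  simp_rw [e]
  rw [integral_const_mul, integral_sub_right_eq_self
    (fun v : EuclideanSpace ℝ (Fin n) => Real.exp (-(1 / (2 * a)) * ‖v‖ ^ 2)) c, hI,
    ← Real.exp_add, neg_add_cancel, Real.exp_zero, ENNReal.ofReal_one]

/-- Gibbs' inequality against a Gaussian measure. -/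
theorem lintegral_mul_neg_log_add_le {q : EuclideanSpace ℝ (Fin n) → ℝ} (hq : Measurable q)
    (h0 : ∀ x, 0 ≤ q x) (hi : Integrable q) {a : ℝ} (ha : 0 < a) (c : EuclideanSpace ℝ (Fin n)) :
    (∫⁻ x, ENNReal.ofReal (q x) * ENNReal.ofReal (-Real.log (q x / ∫ y, q y))) +
        ENNReal.ofReal (-(n / 2 * Real.log (2 * Real.pi * a))) * ENNReal.ofReal (∫ x, q x) ≤
      (∫⁻ x, ENNReal.ofReal (q x) * ENNReal.ofReal (Real.log (q x / ∫ y, q y))) +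
        ENNReal.ofReal (1 / (2 * a)) * (∫⁻ x, ENNReal.ofReal (‖x - c‖ ^ 2) * ENNReal.ofReal (q x)) +
        ENNReal.ofReal (n / 2 * Real.log (2 * Real.pi * a)) * ENNReal.ofReal (∫ x, q x) := by
  set m := ∫ x, q x with hm
  set κ := n / 2 * Real.log (2 * Real.pi * a) with hκ
  have hm' : 0 ≤ m := integral_nonneg h0
  rcases hm'.eq_or_lt with hm0 | hm0
  · rw [← hm0]; simp
  have hM : ENNReal.ofReal m = ∫⁻ x, ENNReal.ofReal (q x) :=
    ofReal_integral_eq_lintegral_ofReal hi (Eventually.of_forall h0)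
  -- Pointwise this is `log t ≤ t - 1` at `t = m γ / q`, multiplied by `q`, with `γ` the Gaussian
  -- density. The extra terms `q` and `m γ` both integrate to `m` and cancel.
  have hpt : ∀ x, ENNReal.ofReal (q x) * ENNReal.ofReal (-Real.log (q x / m)) +
      ENNReal.ofReal (-κ) * ENNReal.ofReal (q x) + ENNReal.ofReal (q x) ≤
      ENNReal.ofReal (q x) * ENNReal.ofReal (Real.log (q x / m)) +
      ENNReal.ofReal (1 / (2 * a)) * (ENNReal.ofReal (‖x - c‖ ^ 2) * ENNReal.ofReal (q x)) +
      ENNReal.ofReal κ * ENNReal.ofReal (q x) +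
      ENNReal.ofReal m * ENNReal.ofReal (isoGaussian a c x) := by
    intro x
    rcases (h0 x).eq_or_lt with hx | hx
    · simp [← hx]
    have hγ : 0 < isoGaussian a c x := Real.exp_pos _
    have hlog : Real.log (isoGaussian a c x) = -κ - ‖x - c‖ ^ 2 / (2 * a) := by
      rw [isoGaussian, Real.log_exp]
    have h1 := Real.log_le_sub_one_of_pos (div_pos (mul_pos hm0 hγ) hx)
    have h2 : Real.log (m * isoGaussian a c x / q x) = -Real.log (q x / m) +
        (-κ - ‖x - c‖ ^ 2 / (2 * a)) := by
      rw [Real.log_div (mul_pos hm0 hγ).ne' hx.ne', Real.log_mul hm0.ne' hγ.ne',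
        Real.log_div hx.ne' hm0.ne', hlog]
      ring
    rw [h2] at h1
    have h3 : q x * (-Real.log (q x / m)) + (-κ) * q x + q x ≤
        1 / (2 * a) * (‖x - c‖ ^ 2 * q x) + m * isoGaussian a c x := by
      have := mul_le_mul_of_nonneg_left h1 hx.le
      have e : q x * (m * isoGaussian a c x / q x - 1) = m * isoGaussian a c x - q x := by
        field_simp
      rw [e] at this
      have e2 : 1 / (2 * a) * (‖x - c‖ ^ 2 * q x) = q x * (‖x - c‖ ^ 2 / (2 * a)) := by ring
      rw [e2]
      linarith
    have hs : ∀ t : ℝ, ENNReal.ofReal t = ENNReal.ofReal (max t 0) := fun t => by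
      rw [ENNReal.ofReal_max]; simp
    rw [hs (-Real.log (q x / m)), hs (-κ), hs (Real.log (q x / m)), hs κ]
    have n1 := le_max_right (-Real.log (q x / m)) 0
    have n2 := le_max_right (-κ) 0
    have n3 := le_max_right (Real.log (q x / m)) 0
    have n4 := le_max_right κ 0
    have e1 : max (-Real.log (q x / m)) 0 - max (Real.log (q x / m)) 0 = -Real.log (q x / m) := by
      rw [max_comm, max_comm _ (0 : ℝ)]; have := max_zero_sub_eq_self (-Real.log (q x / m)); simpa [max_comm] using this
    have e2 : max (-κ) 0 - max κ 0 = -κ := by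
      have := max_zero_sub_eq_self (-κ); simpa [max_comm] using this
    rw [← ENNReal.ofReal_mul hx.le, ← ENNReal.ofReal_mul n2, ← ENNReal.ofReal_mul hx.le,
      ← ENNReal.ofReal_mul (sq_nonneg _), ← ENNReal.ofReal_mul (by positivity),
      ← ENNReal.ofReal_mul n4, ← ENNReal.ofReal_mul hm0.le,
      ← ENNReal.ofReal_add (by positivity) (by positivity),
      ← ENNReal.ofReal_add (by positivity) (by positivity),
      ← ENNReal.ofReal_add (by positivity) (by positivity),
      ← ENNReal.ofReal_add (by positivity) (by positivity),
      ← ENNReal.ofReal_add (by positivity) (by positivity)]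
    refine ENNReal.ofReal_le_ofReal ?_
    rw [← e1, ← e2] at h3
    linarith
  have mq : Measurable fun x => ENNReal.ofReal (q x) := hq.ennreal_ofReal
  have ml : Measurable fun x => Real.log (q x / m) := Real.measurable_log.comp (hq.div_const m)
  have md : Measurable fun x : EuclideanSpace ℝ (Fin n) => ENNReal.ofReal (‖x - c‖ ^ 2) := by
    fun_prop
  have mA : Measurable fun x => ENNReal.ofReal (q x) * ENNReal.ofReal (Real.log (q x / m)) :=
    mq.mul ml.ennreal_ofReal
  have mB : Measurable fun x => ENNReal.ofReal (‖x - c‖ ^ 2) * ENNReal.ofReal (q x) := md.mul mq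
  have mC : Measurable fun x => ENNReal.ofReal κ * ENNReal.ofReal (q x) := mq.const_mul _
  have mD : Measurable fun x => ENNReal.ofReal (isoGaussian a c x) := by
    unfold isoGaussian; fun_prop
  have key := lintegral_mono (μ := volume) hpt
  rw [lintegral_add_right _ mq, lintegral_add_right _ (mq.const_mul _),
    lintegral_const_mul _ mq, lintegral_add_right _ (mD.const_mul _), lintegral_add_right _ mC,
    lintegral_add_left mA, lintegral_const_mul _ mq, lintegral_const_mul _ mB,
    lintegral_const_mul _ mD, lintegral_isoGaussian ha, mul_one, ← hM] at key
  exact (ENNReal.add_le_add_iff_right ENNReal.ofReal_ne_top).1 key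

end Gibbs

end BayesCR

namespace BayesCR

open Filter Topology Set

/-! ### The joint density of parameter and observation -/

section Prior

variable {n : ℕ} (π : Measure (EuclideanSpace ℝ (Fin n)))

theorem measurable_priorDensity : Measurable (priorDensity π) :=
  (Measure.measurable_rnDeriv _ _).ennreal_toReal

theorem priorDensity_nonneg (θ : EuclideanSpace ℝ (Fin n)) : 0 ≤ priorDensity π θ :=
  ENNReal.toReal_nonneg

variable {π}

/-- A finite infimum is not over the empty set. A measurable representative is chosen so that
Tonelli applies to the joint integrands. -/
theorem exists_measurable_gradient_priorDensity (h : priorFisherInfo π ≠ ⊤) :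
    ∃ r : EuclideanSpace ℝ (Fin n) → EuclideanSpace ℝ (Fin n), Measurable r ∧
      HasWeakGradient (priorDensity π) r := by
  have : ∃ g, HasWeakGradient (priorDensity π) g := by
    by_contra hne
    push Not at hne
    exact h (by simp [priorFisherInfo, hne])
  obtain ⟨g, hg⟩ := this
  have hm := hg.2.1.aestronglyMeasurable
  exact ⟨hm.mk g, hm.stronglyMeasurable_mk.measurable, hg.congr_right hm.ae_eq_mk⟩

variable [IsProbabilityMeasure π]

theorem lintegral_prior (hπ : π ≪ volume) {F : EuclideanSpace ℝ (Fin n) → ℝ≥0∞}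
    (hF : Measurable F) : ∫⁻ θ, F θ ∂π = ∫⁻ θ, ENNReal.ofReal (priorDensity π θ) * F θ := by
  rw [← lintegral_rnDeriv_mul hπ hF.aemeasurable]
  refine lintegral_congr_ae ?_
  filter_upwards [Measure.rnDeriv_lt_top π volume] with θ hθ
  rw [priorDensity, ENNReal.ofReal_toReal hθ.ne]

theorem integral_prior (hπ : π ≪ volume) (F : EuclideanSpace ℝ (Fin n) → ℝ) :
    ∫ θ, F θ ∂π = ∫ θ, priorDensity π θ * F θ :=
  (integral_rnDeriv_smul hπ).symm

theorem lintegral_priorDensity (hπ : π ≪ volume) :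
    ∫⁻ θ, ENNReal.ofReal (priorDensity π θ) = 1 := by
  have := lintegral_prior hπ (F := fun _ => 1) measurable_const
  simpa using this.symm

end Prior

/-! ### Pointwise estimates for the joint gradient. -/

section Pointwise

variable {F : Type*} [NormedAddCommGroup F] [InnerProductSpace ℝ F]

theorem le_sq_div_add (a b : ℝ≥0∞) : a ≤ a ^ 2 / b + b := by
  rcases eq_or_ne b ⊤ with hb' | hb'
  · simp [hb']
  rcases le_total a b with h | h
  · exact h.trans le_add_self
  refine le_add_right ?_
  rcases eq_or_ne b 0 with hb | hb
  · rcases eq_or_ne a 0 with ha | ha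
    · simp [ha]
    · simp [hb, ENNReal.div_zero (pow_ne_zero 2 ha)]
  have : 1 ≤ a / b := by
    rw [ENNReal.le_div_iff_mul_le (Or.inl hb) (Or.inl hb'), one_mul]
    exact h
  rw [sq, mul_div_assoc]
  exact le_mul_of_one_le_right zero_le this

/-- Bounds each summand of the joint gradient by its Fisher integrand plus the joint density, which
yields its integrability. -/
theorem enorm_smul_le_add {s c : ℝ} (hs : 0 ≤ s) (v : F) :
    ‖s • v‖ₑ ≤ ENNReal.ofReal s * (ENNReal.ofReal (‖v‖ ^ 2) / ENNReal.ofReal c) +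
      ENNReal.ofReal (c * s) := by
  rw [enorm_smul, Real.enorm_of_nonneg hs, mul_comm c, ENNReal.ofReal_mul hs, ← mul_add]
  refine mul_le_mul_right ?_ _
  have := le_sq_div_add (ENNReal.ofReal ‖v‖) (ENNReal.ofReal c)
  rwa [← ENNReal.ofReal_pow (norm_nonneg _), ofReal_norm] at this

/-- The square is expanded and the cross term split by sign. The second conclusion is the
arithmetic–geometric mean inequality; it makes the integrated cross term finite, hence cancellable.
The hypotheses `h1` and `h2` handle the degenerate cases `ρ = 0` and `s = 0`. -/
theorem norm_add_sq_div_mul {ρ s : ℝ} {r g : F} (hρ : 0 ≤ ρ) (hs : 0 ≤ s) (h1 : ρ = 0 → r = 0)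
    (h2 : ENNReal.ofReal ρ * (ENNReal.ofReal (‖g‖ ^ 2) / ENNReal.ofReal s) ≠ ⊤) :
    ENNReal.ofReal (‖s • r + ρ • g‖ ^ 2) / ENNReal.ofReal (ρ * s) +
        ENNReal.ofReal (-(2 * inner ℝ r g)) =
      ENNReal.ofReal s * (ENNReal.ofReal (‖r‖ ^ 2) / ENNReal.ofReal ρ) +
        ENNReal.ofReal ρ * (ENNReal.ofReal (‖g‖ ^ 2) / ENNReal.ofReal s) +
        ENNReal.ofReal (2 * inner ℝ r g) ∧
    ENNReal.ofReal (2 * inner ℝ r g) ≤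
      ENNReal.ofReal s * (ENNReal.ofReal (‖r‖ ^ 2) / ENNReal.ofReal ρ) +
        ENNReal.ofReal ρ * (ENNReal.ofReal (‖g‖ ^ 2) / ENNReal.ofReal s) := by
  rcases hρ.eq_or_lt with h | hρ'
  · simp [← h, h1 h.symm]
  rcases hs.eq_or_lt with h | hs'
  · have hg : g = 0 := by
      refine eq_zero_of_ofReal_div_ne_top (b := s) (fun ht => h2 ?_) h.symm
      rw [ht]; exact ENNReal.mul_top (by simpa using hρ')
    simp [← h, hg]
  have hi := abs_le.1 (abs_real_inner_le_norm r g)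
  have hA : 0 ≤ s * (‖r‖ ^ 2 / ρ) := by positivity
  have hB : 0 ≤ ρ * (‖g‖ ^ 2 / s) := by positivity
  rw [← ENNReal.ofReal_div_of_pos hρ', ← ENNReal.ofReal_div_of_pos hs',
    ← ENNReal.ofReal_div_of_pos (mul_pos hρ' hs'), ← ENNReal.ofReal_mul hs, ← ENNReal.ofReal_mul hρ,
    ← ENNReal.ofReal_add hA hB]
  have hAB : 2 * (‖r‖ * ‖g‖) ≤ s * (‖r‖ ^ 2 / ρ) + ρ * (‖g‖ ^ 2 / s) := by
    have e : s * (‖r‖ ^ 2 / ρ) + ρ * (‖g‖ ^ 2 / s) - 2 * (‖r‖ * ‖g‖) =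
        (s * ‖r‖ - ρ * ‖g‖) ^ 2 / (ρ * s) := by field_simp; ring
    have : 0 ≤ (s * ‖r‖ - ρ * ‖g‖) ^ 2 / (ρ * s) := by positivity
    linarith
  have hX : ‖s • r + ρ • g‖ ^ 2 / (ρ * s) =
      s * (‖r‖ ^ 2 / ρ) + ρ * (‖g‖ ^ 2 / s) + 2 * inner ℝ r g := by
    rw [norm_add_sq_real, norm_smul, norm_smul, real_inner_smul_left, real_inner_smul_right,
      Real.norm_of_nonneg hs, Real.norm_of_nonneg hρ]
    field_simp
    ring
  refine ⟨?_, ENNReal.ofReal_le_ofReal (by linarith)⟩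
  have hX0 : 0 ≤ ‖s • r + ρ • g‖ ^ 2 / (ρ * s) := by positivity
  rcases le_total 0 (2 * inner ℝ r g : ℝ) with h | h
  · rw [ENNReal.ofReal_of_nonpos (neg_nonpos.2 h), add_zero,
      ← ENNReal.ofReal_add (by positivity) h, hX]
  · rw [ENNReal.ofReal_of_nonpos h, add_zero, ← ENNReal.ofReal_add hX0 (neg_nonneg.2 h), hX]
    congr 1; ring

theorem lintegral_ofReal_eq_of_integral_eq_zero {α : Type*} [MeasurableSpace α] {μ : Measure α}
    {u : α → ℝ} (hu : Integrable u μ) (h0 : ∫ a, u a ∂μ = 0) :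
    ∫⁻ a, ENNReal.ofReal (u a) ∂μ = ∫⁻ a, ENNReal.ofReal (-u a) ∂μ := by
  have h1 : ∫⁻ a, ENNReal.ofReal (u a) ∂μ ≠ ⊤ := (hu.lintegral_lt_top).ne
  have h2 : ∫⁻ a, ENNReal.ofReal (-u a) ∂μ ≠ ⊤ := (hu.neg.lintegral_lt_top).ne
  rw [integral_eq_lintegral_pos_part_sub_lintegral_neg_part hu, sub_eq_zero] at h0
  exact (ENNReal.toReal_eq_toReal_iff' h1 h2).1 h0

end Pointwise

section Joint

variable {n : ℕ} {𝓧 : Type*} [MeasurableSpace 𝓧] {lam : Measure 𝓧} [SigmaFinite lam]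
  {f : 𝓧 → EuclideanSpace ℝ (Fin n) → ℝ}
  {g : 𝓧 → EuclideanSpace ℝ (Fin n) → EuclideanSpace ℝ (Fin n)}
  {π : Measure (EuclideanSpace ℝ (Fin n))}
  {r : EuclideanSpace ℝ (Fin n) → EuclideanSpace ℝ (Fin n)}

theorem lintegral_joint_mass [IsProbabilityMeasure π]
    (hf_meas : Measurable (Function.uncurry f))
    (hf_prob : ∀ θ, ∫⁻ x, ENNReal.ofReal (f x θ) ∂lam = 1) (hπ : π ≪ volume) :
    ∫⁻ x, (∫⁻ θ, ENNReal.ofReal (priorDensity π θ * f x θ)) ∂lam = 1 := by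
  have hρm := measurable_priorDensity π
  rw [lintegral_lintegral_swap (by fun_prop)]
  simp_rw [fun θ x => ENNReal.ofReal_mul (q := f x θ) (priorDensity_nonneg π θ)]
  simp_rw [fun θ => lintegral_const_mul (μ := lam) (ENNReal.ofReal (priorDensity π θ))
    (by fun_prop : Measurable fun x => ENNReal.ofReal (f x θ)), hf_prob, mul_one]
  exact lintegral_priorDensity hπ

theorem lintegral_joint_prior_fisher (hf_meas : Measurable (Function.uncurry f))
    (hf_prob : ∀ θ, ∫⁻ x, ENNReal.ofReal (f x θ) ∂lam = 1) (hr : Measurable r)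
    (hw : HasWeakGradient (priorDensity π) r) :
    ∫⁻ x, (∫⁻ θ, ENNReal.ofReal (f x θ) *
      (ENNReal.ofReal (‖r θ‖ ^ 2) / ENNReal.ofReal (priorDensity π θ))) ∂lam =
      priorFisherInfo π := by
  have hρm := measurable_priorDensity π
  rw [lintegral_lintegral_swap (by fun_prop), priorFisherInfo_eq π r hw]
  simp_rw [fun θ => lintegral_mul_const (μ := lam)
    (ENNReal.ofReal (‖r θ‖ ^ 2) / ENNReal.ofReal (priorDensity π θ))
    (by fun_prop : Measurable fun x => ENNReal.ofReal (f x θ)), hf_prob, one_mul]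

theorem lintegral_joint_family_fisher [IsProbabilityMeasure π]
    (hf_meas : Measurable (Function.uncurry f))
    (hg_meas : Measurable (Function.uncurry g)) (hπ : π ≪ volume) :
    ∫⁻ x, (∫⁻ θ, ENNReal.ofReal (priorDensity π θ) *
      (ENNReal.ofReal (‖g x θ‖ ^ 2) / ENNReal.ofReal (f x θ))) ∂lam =
      ∫⁻ θ, familyFisherInfo lam f g θ ∂π := by
  have hρm := measurable_priorDensity π
  have hm : Measurable fun z : 𝓧 × EuclideanSpace ℝ (Fin n) =>
      ENNReal.ofReal (‖g z.1 z.2‖ ^ 2) / ENNReal.ofReal (f z.1 z.2) := by fun_prop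
  have hI : Measurable (familyFisherInfo lam f g) := by
    unfold familyFisherInfo
    exact Measurable.lintegral_prod_left' hm
  rw [lintegral_lintegral_swap (by fun_prop), lintegral_prior hπ hI]
  refine lintegral_congr fun θ => ?_
  rw [lintegral_const_mul _ (by fun_prop)]
  rfl

/-- By Tonelli, finite total information makes both Fisher integrals and the mass finite on almost
every section. These provide the local integrability required by the product rule. -/
theorem ae_hasWeakGradient_joint [IsProbabilityMeasure π]
    (hf_meas : Measurable (Function.uncurry f))
    (hf_nonneg : ∀ x θ, 0 ≤ f x θ) (hf_prob : ∀ θ, ∫⁻ x, ENNReal.ofReal (f x θ) ∂lam = 1)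
    (hg_meas : Measurable (Function.uncurry g)) (hg : ∀ᵐ x ∂lam, HasWeakGradient (f x) (g x))
    (hπ : π ≪ volume) (hr : Measurable r) (hw : HasWeakGradient (priorDensity π) r)
    (hS : totalInfo lam f g π ≠ ⊤) :
    ∀ᵐ x ∂lam, HasWeakGradient (fun θ => priorDensity π θ * f x θ)
      (fun θ => f x θ • r θ + priorDensity π θ • g x θ) := by
  have hρm := measurable_priorDensity π
  have hρ0 := priorDensity_nonneg π
  obtain ⟨hS1, hS2⟩ := ENNReal.add_ne_top.1 hS
  rw [← lintegral_joint_prior_fisher hf_meas hf_prob hr hw] at hS1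
  rw [← lintegral_joint_family_fisher hf_meas hg_meas hπ] at hS2
  have hM := lintegral_joint_mass hf_meas hf_prob hπ
  filter_upwards [hg, ae_lt_top (by exact Measurable.lintegral_prod_right (by fun_prop)) hS1,
    ae_lt_top (by exact Measurable.lintegral_prod_right (by fun_prop)) hS2,
    ae_lt_top (by exact Measurable.lintegral_prod_right (by fun_prop)) (hM.trans_ne ENNReal.one_ne_top)]
    with x hx hA hB hMx
  have hfx : Measurable (f x) := by fun_prop
  have hgx : Measurable (g x) := by fun_prop
  refine hw.mul hx ?_ ?_ ?_
  · refine Integrable.locallyIntegrable ⟨(hρm.mul hfx).aestronglyMeasurable, ?_⟩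
    rw [hasFiniteIntegral_iff_ofReal (Eventually.of_forall fun θ =>
      mul_nonneg (hρ0 θ) (hf_nonneg x θ))]
    exact hMx
  · refine Integrable.locallyIntegrable ⟨(hfx.smul hr).aestronglyMeasurable, ?_⟩
    refine (lintegral_mono fun θ =>
      enorm_smul_le_add (c := priorDensity π θ) (hf_nonneg x θ) (r θ)).trans_lt ?_
    rw [lintegral_add_left (by fun_prop)]
    exact ENNReal.add_lt_top.2 ⟨hA, hMx⟩
  · refine Integrable.locallyIntegrable ⟨(hρm.smul hgx).aestronglyMeasurable, ?_⟩
    refine (lintegral_mono fun θ =>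
      enorm_smul_le_add (c := f x θ) (hρ0 θ) (g x θ)).trans_lt ?_
    rw [lintegral_add_left (by fun_prop)]
    refine ENNReal.add_lt_top.2 ⟨hB, ?_⟩
    simpa only [mul_comm] using hMx

/-- The Fisher information of the joint density in `θ`, integrated over `x`, is the total
information: the cross term vanishes by the regularity condition. -/
theorem lintegral_joint_fisher [IsProbabilityMeasure π]
    (hf_meas : Measurable (Function.uncurry f))
    (hf_nonneg : ∀ x θ, 0 ≤ f x θ) (hf_prob : ∀ θ, ∫⁻ x, ENNReal.ofReal (f x θ) ∂lam = 1)
    (hg_meas : Measurable (Function.uncurry g))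
    (hreg : ∀ᵐ θ ∂(volume : Measure (EuclideanSpace ℝ (Fin n))),
      Integrable (fun x => g x θ) lam ∧ ∫ x, g x θ ∂lam = 0)
    (hπ : π ≪ volume) (hr : Measurable r) (hw : HasWeakGradient (priorDensity π) r)
    (hS : totalInfo lam f g π ≠ ⊤) :
    ∫⁻ x, (∫⁻ θ, ENNReal.ofReal (‖f x θ • r θ + priorDensity π θ • g x θ‖ ^ 2) /
      ENNReal.ofReal (priorDensity π θ * f x θ)) ∂lam = totalInfo lam f g π := by
  have hρm := measurable_priorDensity π
  have hρ0 := priorDensity_nonneg π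
  obtain ⟨hS1, hS2⟩ := ENNReal.add_ne_top.1 hS
  have hr0 : ∀ᵐ θ, priorDensity π θ = 0 → r θ = 0 := by
    rw [priorFisherInfo_eq π r hw] at hS1
    filter_upwards [ae_lt_top (by fun_prop) hS1] with θ hθ
      using eq_zero_of_ofReal_div_ne_top hθ.ne
  have hA := lintegral_joint_prior_fisher hf_meas hf_prob hr hw
  have hB := lintegral_joint_family_fisher (lam := lam) hf_meas hg_meas hπ
  have hB' := hB.trans_ne hS2
  have hBae := ae_lt_top (by exact Measurable.lintegral_prod_right (by fun_prop)) hB'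
  have key : ∀ᵐ x ∂lam, ∀ᵐ θ, (priorDensity π θ = 0 → r θ = 0) ∧
      ENNReal.ofReal (priorDensity π θ) *
        (ENNReal.ofReal (‖g x θ‖ ^ 2) / ENNReal.ofReal (f x θ)) ≠ ⊤ := by
    filter_upwards [hBae] with x hx
    filter_upwards [hr0, ae_lt_top (by fun_prop) hx.ne] with θ h1 h2
    exact ⟨h1, h2.ne⟩
  -- Integrating over `x` first, the regularity condition makes `⟪r θ, g x θ⟫` have mean zero for
  -- almost every `θ`, so its positive and negative parts have equal integrals.
  have hcross : ∫⁻ x, (∫⁻ θ, ENNReal.ofReal (-(2 * inner ℝ (r θ) (g x θ)))) ∂lam =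
      ∫⁻ x, (∫⁻ θ, ENNReal.ofReal (2 * inner ℝ (r θ) (g x θ))) ∂lam := by
    have h1 := lintegral_lintegral_swap (μ := lam)
      (ν := (volume : Measure (EuclideanSpace ℝ (Fin n))))
      (f := fun x θ => ENNReal.ofReal (-(2 * inner ℝ (r θ) (g x θ)))) (by fun_prop)
    have h2 := lintegral_lintegral_swap (μ := lam)
      (ν := (volume : Measure (EuclideanSpace ℝ (Fin n))))
      (f := fun x θ => ENNReal.ofReal (2 * inner ℝ (r θ) (g x θ))) (by fun_prop)
    rw [h1, h2]
    refine lintegral_congr_ae ?_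
    filter_upwards [hreg] with θ hθ
    refine (lintegral_ofReal_eq_of_integral_eq_zero ((hθ.1.const_inner (r θ)).const_mul 2) ?_).symm
    rw [integral_const_mul, integral_inner hθ.1, hθ.2, inner_zero_right, mul_zero]
  have hfin : ∫⁻ x, (∫⁻ θ, ENNReal.ofReal (2 * inner ℝ (r θ) (g x θ))) ∂lam ≠ ⊤ := by
    refine ne_top_of_le_ne_top hS ?_
    rw [totalInfo, ← hA, ← hB, ← lintegral_add_left (Measurable.lintegral_prod_right (by fun_prop))]
    refine lintegral_mono_ae ?_
    filter_upwards [key] with x hx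
    rw [← lintegral_add_left (by fun_prop)]
    refine lintegral_mono_ae ?_
    filter_upwards [hx] with θ hθ
      using (norm_add_sq_div_mul (hρ0 θ) (hf_nonneg x θ) hθ.1 hθ.2).2
  have hsum : (∫⁻ x, (∫⁻ θ, ENNReal.ofReal (‖f x θ • r θ + priorDensity π θ • g x θ‖ ^ 2) /
      ENNReal.ofReal (priorDensity π θ * f x θ)) ∂lam) +
      ∫⁻ x, (∫⁻ θ, ENNReal.ofReal (-(2 * inner ℝ (r θ) (g x θ)))) ∂lam =
      totalInfo lam f g π + ∫⁻ x, (∫⁻ θ, ENNReal.ofReal (2 * inner ℝ (r θ) (g x θ))) ∂lam := by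
    rw [totalInfo, ← hA, ← hB, ← lintegral_add_left (Measurable.lintegral_prod_right (by fun_prop)),
      ← lintegral_add_left (Measurable.lintegral_prod_right (by fun_prop)),
      ← lintegral_add_right _ (Measurable.lintegral_prod_right (by fun_prop))]
    refine lintegral_congr_ae ?_
    filter_upwards [key] with x hx
    rw [← lintegral_add_left (by fun_prop), ← lintegral_add_left (by fun_prop),
      ← lintegral_add_left (by fun_prop)]
    refine lintegral_congr_ae ?_
    filter_upwards [hx] with θ hθ
      using (norm_add_sq_div_mul (hρ0 θ) (hf_nonneg x θ) hθ.1 hθ.2).1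
  rw [hcross] at hsum
  exact (ENNReal.add_left_inj hfin).1 hsum

end Joint

end BayesCR

namespace BayesCR

open Filter Topology Set

/-! ### Bounds for the conditional entropy -/

/-! ### From additive inequalities in `[0, ∞]` to differences in `[-∞, ∞]`. -/

section ERealArithmetic

theorem coe_sub_toReal_le_sub {P N s : ℝ≥0∞} {κ : ℝ} (hN : N ≠ ⊤) (hs : s ≠ ⊤)
    (h : N + ENNReal.ofReal κ ≤ P + s + ENNReal.ofReal (-κ)) :
    ((κ - s.toReal : ℝ) : EReal) ≤ (P : EReal) - (N : EReal) := by
  lift N to NNReal using hN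
  lift s to NNReal using hs
  rcases eq_or_ne P ⊤ with hP | hP
  · subst hP
    rw [EReal.coe_ennreal_top, EReal.coe_nnreal_eq_coe_real, EReal.top_sub_coe]
    exact le_top
  lift P to NNReal using hP
  have h' := ENNReal.toReal_mono (by finiteness) h
  rw [ENNReal.toReal_add (by finiteness) (by finiteness),
    ENNReal.toReal_add (by finiteness) (by finiteness),
    ENNReal.toReal_add (by finiteness) (by finiteness), ENNReal.toReal_ofReal',
    ENNReal.toReal_ofReal'] at h'
  simp only [ENNReal.coe_toReal] at h' ⊢
  rw [EReal.coe_nnreal_eq_coe_real, EReal.coe_nnreal_eq_coe_real, ← EReal.coe_sub,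
    EReal.coe_le_coe_iff]
  have := max_zero_sub_max_neg_zero_eq_self κ
  linarith

theorem sub_le_coe_add_toReal {P N s : ℝ≥0∞} {κ : ℝ} (hN : N ≠ ⊤) (hs : s ≠ ⊤)
    (h : P + ENNReal.ofReal (-κ) ≤ N + s + ENNReal.ofReal κ) :
    (P : EReal) - (N : EReal) ≤ ((κ + s.toReal : ℝ) : EReal) := by
  have hP : P ≠ ⊤ := by
    rintro rfl
    rw [top_add, top_le_iff] at h
    exact absurd h (by finiteness)
  lift N to NNReal using hN
  lift s to NNReal using hs
  lift P to NNReal using hP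
  have h' := ENNReal.toReal_mono (by finiteness) h
  rw [ENNReal.toReal_add (by finiteness) (by finiteness),
    ENNReal.toReal_add (by finiteness) (by finiteness),
    ENNReal.toReal_add (by finiteness) (by finiteness), ENNReal.toReal_ofReal',
    ENNReal.toReal_ofReal'] at h'
  simp only [ENNReal.coe_toReal] at h' ⊢
  rw [EReal.coe_nnreal_eq_coe_real, EReal.coe_nnreal_eq_coe_real, ← EReal.coe_sub,
    EReal.coe_le_coe_iff]
  have := max_zero_sub_max_neg_zero_eq_self κ
  linarith

end ERealArithmetic

section Entropy

variable {n : ℕ} {𝓧 : Type*} [MeasurableSpace 𝓧] {lam : Measure 𝓧}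
  {f : 𝓧 → EuclideanSpace ℝ (Fin n) → ℝ}
  {g : 𝓧 → EuclideanSpace ℝ (Fin n) → EuclideanSpace ℝ (Fin n)}
  {π : Measure (EuclideanSpace ℝ (Fin n))} [IsProbabilityMeasure π]

/-- Passing from `π` to Lebesgue measure turns the inner integral into an entropy integral of the
unnormalised density `q_x`, to which the one-density inequalities apply. -/
theorem condEntropyPos_eq (hf_meas : Measurable (Function.uncurry f)) (hπ : π ≪ volume) :
    condEntropyPos lam f π = ∫⁻ x, (∫⁻ θ, ENNReal.ofReal (priorDensity π θ * f x θ) *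
      ENNReal.ofReal (-Real.log (priorDensity π θ * f x θ /
        ∫ y, priorDensity π y * f x y))) ∂lam := by
  have hρm := measurable_priorDensity π
  refine lintegral_congr fun x => ?_
  have hfx : Measurable (f x) := by fun_prop
  simp only [posteriorDensity, integral_prior hπ]
  rw [lintegral_prior hπ (by fun_prop)]
  refine lintegral_congr fun θ => ?_
  rw [ENNReal.ofReal_mul (priorDensity_nonneg π θ), mul_assoc]

theorem condEntropyNeg_eq (hf_meas : Measurable (Function.uncurry f)) (hπ : π ≪ volume) :
    condEntropyNeg lam f π = ∫⁻ x, (∫⁻ θ, ENNReal.ofReal (priorDensity π θ * f x θ) *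
      ENNReal.ofReal (Real.log (priorDensity π θ * f x θ /
        ∫ y, priorDensity π y * f x y))) ∂lam := by
  have hρm := measurable_priorDensity π
  refine lintegral_congr fun x => ?_
  have hfx : Measurable (f x) := by fun_prop
  simp only [posteriorDensity, integral_prior hπ]
  rw [lintegral_prior hπ (by fun_prop)]
  refine lintegral_congr fun θ => ?_
  rw [ENNReal.ofReal_mul (priorDensity_nonneg π θ), mul_assoc]

variable [SigmaFinite lam]

theorem bayesMSE_eq (hf_meas : Measurable (Function.uncurry f)) (hπ : π ≪ volume)
    {T : 𝓧 → EuclideanSpace ℝ (Fin n)} (hT : Measurable T) :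
    bayesMSE lam f π T = ∫⁻ x, (∫⁻ θ, ENNReal.ofReal (‖θ - T x‖ ^ 2) *
      ENNReal.ofReal (priorDensity π θ * f x θ)) ∂lam := by
  have hρm := measurable_priorDensity π
  have hm : Measurable fun θ => ∫⁻ x, ENNReal.ofReal (‖θ - T x‖ ^ 2) * ENNReal.ofReal (f x θ) ∂lam :=
    Measurable.lintegral_prod_right (by fun_prop)
  rw [bayesMSE, lintegral_prior hπ hm, lintegral_lintegral_swap (by fun_prop)]
  refine lintegral_congr fun θ => ?_
  rw [← lintegral_const_mul _ (by fun_prop)]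
  refine lintegral_congr fun x => ?_
  rw [ENNReal.ofReal_mul (priorDensity_nonneg π θ)]
  ring

/-- For almost every observation the joint density has finite Fisher information in `θ`. -/
theorem ae_hasFiniteFisherInfo_joint
    (hf_meas : Measurable (Function.uncurry f))
    (hf_nonneg : ∀ x θ, 0 ≤ f x θ) (hf_prob : ∀ θ, ∫⁻ x, ENNReal.ofReal (f x θ) ∂lam = 1)
    (hg_meas : Measurable (Function.uncurry g)) (hg : ∀ᵐ x ∂lam, HasWeakGradient (f x) (g x))
    (hreg : ∀ᵐ θ ∂(volume : Measure (EuclideanSpace ℝ (Fin n))),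
      Integrable (fun x => g x θ) lam ∧ ∫ x, g x θ ∂lam = 0)
    (hπ : π ≪ volume) {r : EuclideanSpace ℝ (Fin n) → EuclideanSpace ℝ (Fin n)}
    (hr : Measurable r) (hw : HasWeakGradient (priorDensity π) r)
    (hS : totalInfo lam f g π ≠ ⊤) :
    ∀ᵐ x ∂lam, HasFiniteFisherInfo (fun θ => priorDensity π θ * f x θ)
        (fun θ => f x θ • r θ + priorDensity π θ • g x θ) ∧
      ENNReal.ofReal (∫ θ, ‖f x θ • r θ + priorDensity π θ • g x θ‖ ^ 2 /
        (priorDensity π θ * f x θ)) =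
      ∫⁻ θ, ENNReal.ofReal (‖f x θ • r θ + priorDensity π θ • g x θ‖ ^ 2) /
        ENNReal.ofReal (priorDensity π θ * f x θ) := by
  have hρm := measurable_priorDensity π
  have hM := lintegral_joint_mass hf_meas hf_prob hπ
  have hJ := (lintegral_joint_fisher hf_meas hf_nonneg hf_prob hg_meas hreg hπ hr hw hS).trans_ne hS
  filter_upwards [ae_hasWeakGradient_joint hf_meas hf_nonneg hf_prob hg_meas hg hπ hr hw hS,
    ae_lt_top (by exact Measurable.lintegral_prod_right (by fun_prop)) hJ,
    ae_lt_top (by exact Measurable.lintegral_prod_right (by fun_prop)) (hM.trans_ne ENNReal.one_ne_top)]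
    with x h1 h2 h3
  exact h1.hasFiniteFisherInfo (fun θ => mul_nonneg (priorDensity_nonneg π θ) (hf_nonneg x θ))
    h3.ne h2.ne

theorem HasFiniteFisherInfo.ofReal_integral {q : EuclideanSpace ℝ (Fin n) → ℝ}
    {G : EuclideanSpace ℝ (Fin n) → EuclideanSpace ℝ (Fin n)} (h : HasFiniteFisherInfo q G) :
    ENNReal.ofReal (∫ x, q x) = ∫⁻ x, ENNReal.ofReal (q x) :=
  ofReal_integral_eq_lintegral_ofReal h.integrable (Eventually.of_forall h.nonneg)

/-- The negative part of the conditional entropy is controlled by the total information. -/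
theorem condEntropyNeg_le
    (hf_meas : Measurable (Function.uncurry f))
    (hf_nonneg : ∀ x θ, 0 ≤ f x θ) (hf_prob : ∀ θ, ∫⁻ x, ENNReal.ofReal (f x θ) ∂lam = 1)
    (hg_meas : Measurable (Function.uncurry g)) (hg : ∀ᵐ x ∂lam, HasWeakGradient (f x) (g x))
    (hreg : ∀ᵐ θ ∂(volume : Measure (EuclideanSpace ℝ (Fin n))),
      Integrable (fun x => g x θ) lam ∧ ∫ x, g x θ ∂lam = 0)
    (hπ : π ≪ volume) :
    condEntropyNeg lam f π ≤ 6 + 2 * totalInfo lam f g π := by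
  rcases eq_or_ne (totalInfo lam f g π) ⊤ with hS | hS
  · simp [hS]
  obtain ⟨r, hr, hw⟩ := exists_measurable_gradient_priorDensity (ENNReal.add_ne_top.1 hS).1
  have hρm := measurable_priorDensity π
  rw [condEntropyNeg_eq hf_meas hπ,
    ← lintegral_joint_fisher hf_meas hf_nonneg hf_prob hg_meas hreg hπ hr hw hS]
  conv_rhs => rw [← mul_one 6, ← lintegral_joint_mass hf_meas hf_prob hπ]
  rw [← lintegral_const_mul _ (Measurable.lintegral_prod_right (by fun_prop)),
    ← lintegral_const_mul _ (Measurable.lintegral_prod_right (by fun_prop)),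
    ← lintegral_add_left (Measurable.const_mul (Measurable.lintegral_prod_right (by fun_prop)) _)]
  refine lintegral_mono_ae ?_
  filter_upwards [ae_hasFiniteFisherInfo_joint hf_meas hf_nonneg hf_prob hg_meas hg hreg hπ hr hw hS]
    with x ⟨hx, hJ⟩
  rw [← hJ, ← hx.ofReal_integral]
  exact hx.lintegral_mul_log_le

/-- The logarithmic Sobolev inequality for the posterior densities, averaged over the observation. -/
theorem le_condEntropy
    (hf_meas : Measurable (Function.uncurry f))
    (hf_nonneg : ∀ x θ, 0 ≤ f x θ) (hf_prob : ∀ θ, ∫⁻ x, ENNReal.ofReal (f x θ) ∂lam = 1)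
    (hg_meas : Measurable (Function.uncurry g)) (hg : ∀ᵐ x ∂lam, HasWeakGradient (f x) (g x))
    (hreg : ∀ᵐ θ ∂(volume : Measure (EuclideanSpace ℝ (Fin n))),
      Integrable (fun x => g x θ) lam ∧ ∫ x, g x θ ∂lam = 0)
    (hπ : π ≪ volume) (hS : totalInfo lam f g π ≠ ⊤) {b : ℝ} (hb : 0 < b) :
    ((n * lsiConst b - b ^ 2 / 2 * (totalInfo lam f g π).toReal : ℝ) : EReal) ≤
      condEntropy lam f π := by
  have hN := condEntropyNeg_le hf_meas hf_nonneg hf_prob hg_meas hg hreg hπ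
  have hN' : condEntropyNeg lam f π ≠ ⊤ := ne_top_of_le_ne_top (by finiteness) hN
  have e : b ^ 2 / 2 * (totalInfo lam f g π).toReal =
      (ENNReal.ofReal (b ^ 2 / 2) * totalInfo lam f g π).toReal := by
    rw [ENNReal.toReal_mul, ENNReal.toReal_ofReal (by positivity)]
  rw [e]
  refine coe_sub_toReal_le_sub hN' (by finiteness) ?_
  obtain ⟨r, hr, hw⟩ := exists_measurable_gradient_priorDensity (ENNReal.add_ne_top.1 hS).1
  have hρm := measurable_priorDensity π
  have hM := lintegral_joint_mass hf_meas hf_prob hπ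
  rw [condEntropyNeg_eq hf_meas hπ, condEntropyPos_eq hf_meas hπ,
    ← lintegral_joint_fisher hf_meas hf_nonneg hf_prob hg_meas hreg hπ hr hw hS]
  -- Each constant is multiplied by the total joint mass `1`, so that it too becomes an integral
  -- over `x` and the inequality can be checked for each `x` separately.
  rw [← mul_one (ENNReal.ofReal (n * lsiConst b)), ← mul_one (ENNReal.ofReal (-(n * lsiConst b))),
    ← hM,
    ← lintegral_const_mul _ (Measurable.lintegral_prod_right (by fun_prop)),
    ← lintegral_const_mul _ (Measurable.lintegral_prod_right (by fun_prop)),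
    ← lintegral_const_mul _ (Measurable.lintegral_prod_right (by fun_prop)),
    ← lintegral_add_right _ (Measurable.const_mul (Measurable.lintegral_prod_right (by fun_prop)) _),
    ← lintegral_add_right _ (Measurable.const_mul (Measurable.lintegral_prod_right (by fun_prop)) _),
    ← lintegral_add_right _ (Measurable.const_mul (Measurable.lintegral_prod_right (by fun_prop)) _)]
  refine lintegral_mono_ae ?_
  filter_upwards [ae_hasFiniteFisherInfo_joint hf_meas hf_nonneg hf_prob hg_meas hg hreg hπ hr hw hS]
    with x ⟨hx, hJ⟩
  rw [← hJ, ← hx.ofReal_integral]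
  exact hx.lintegral_mul_log_add_le hb

/-- The Gaussian upper bound for the conditional entropy in terms of the mean square error. -/
theorem condEntropy_le (hf_meas : Measurable (Function.uncurry f))
    (hf_nonneg : ∀ x θ, 0 ≤ f x θ) (hf_prob : ∀ θ, ∫⁻ x, ENNReal.ofReal (f x θ) ∂lam = 1)
    (hπ : π ≪ volume) {T : 𝓧 → EuclideanSpace ℝ (Fin n)} (hT : Measurable T)
    (hD : bayesMSE lam f π T ≠ ⊤) {a : ℝ} (ha : 0 < a) :
    condEntropy lam f π ≤ ((n / 2 * Real.log (2 * Real.pi * a) +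
      1 / (2 * a) * (bayesMSE lam f π T).toReal : ℝ) : EReal) := by
  -- Whatever the positive part, the entropy is then `-∞` by convention.
  rcases eq_or_ne (condEntropyNeg lam f π) ⊤ with hN | hN
  · rw [condEntropy, hN, EReal.coe_ennreal_top, EReal.sub_top]
    exact bot_le
  have e : 1 / (2 * a) * (bayesMSE lam f π T).toReal =
      (ENNReal.ofReal (1 / (2 * a)) * bayesMSE lam f π T).toReal := by
    rw [ENNReal.toReal_mul, ENNReal.toReal_ofReal (by positivity)]
  rw [e]
  refine sub_le_coe_add_toReal hN (by finiteness) ?_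
  have hρm := measurable_priorDensity π
  have hM := lintegral_joint_mass hf_meas hf_prob hπ
  rw [condEntropyNeg_eq hf_meas hπ, condEntropyPos_eq hf_meas hπ, bayesMSE_eq hf_meas hπ hT,
    ← mul_one (ENNReal.ofReal (n / 2 * Real.log (2 * Real.pi * a))),
    ← mul_one (ENNReal.ofReal (-(n / 2 * Real.log (2 * Real.pi * a)))), ← hM,
    ← lintegral_const_mul _ (Measurable.lintegral_prod_right (by fun_prop)),
    ← lintegral_const_mul _ (Measurable.lintegral_prod_right (by fun_prop)),
    ← lintegral_const_mul _ (Measurable.lintegral_prod_right (by fun_prop)),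
    ← lintegral_add_right _ (Measurable.const_mul (Measurable.lintegral_prod_right (by fun_prop)) _),
    ← lintegral_add_right _ (Measurable.const_mul (Measurable.lintegral_prod_right (by fun_prop)) _),
    ← lintegral_add_right _ (Measurable.const_mul (Measurable.lintegral_prod_right (by fun_prop)) _)]
  refine lintegral_mono_ae ?_
  filter_upwards [ae_lt_top (by exact Measurable.lintegral_prod_right (by fun_prop))
    (hM.trans_ne ENNReal.one_ne_top)] with x hx
  have hqx : Measurable fun θ => priorDensity π θ * f x θ :=
    hρm.mul (by fun_prop : Measurable (f x))
  have h0 : ∀ θ, 0 ≤ priorDensity π θ * f x θ :=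
    fun θ => mul_nonneg (priorDensity_nonneg π θ) (hf_nonneg x θ)
  have hi : Integrable fun θ => priorDensity π θ * f x θ := by
    refine ⟨hqx.aestronglyMeasurable, ?_⟩
    rwa [hasFiniteIntegral_iff_ofReal (Eventually.of_forall h0)]
  rw [← ofReal_integral_eq_lintegral_ofReal hi (Eventually.of_forall h0)]
  exact lintegral_mul_neg_log_add_le hqx h0 hi ha (T x)

end Entropy

end BayesCR

namespace BayesCR

open Filter Topology Set

/-! ### The entropy power inequalities -/

section Power

variable {n : ℕ} {𝓧 : Type*} [MeasurableSpace 𝓧] {lam : Measure 𝓧}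
  {f : 𝓧 → EuclideanSpace ℝ (Fin n) → ℝ}
  {g : 𝓧 → EuclideanSpace ℝ (Fin n) → EuclideanSpace ℝ (Fin n)}
  {π : Measure (EuclideanSpace ℝ (Fin n))}

theorem ofReal_exp_le_condEntropyPower {t : ℝ} (h : (t : EReal) ≤ condEntropy lam f π) :
    ENNReal.ofReal (1 / (2 * Real.pi * Real.exp 1) * Real.exp (2 / n * t)) ≤
      condEntropyPower lam f π := by
  rw [ENNReal.ofReal_mul (by positivity), condEntropyPower, ← EReal.exp_coe, EReal.coe_mul]
  refine mul_le_mul_right (EReal.exp_monotone ?_) _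
  exact mul_le_mul_of_nonneg_left h (EReal.coe_nonneg.2 (by positivity))

theorem condEntropyPower_le_ofReal_exp {t : ℝ} (h : condEntropy lam f π ≤ (t : EReal)) :
    condEntropyPower lam f π ≤
      ENNReal.ofReal (1 / (2 * Real.pi * Real.exp 1) * Real.exp (2 / n * t)) := by
  rw [ENNReal.ofReal_mul (by positivity), condEntropyPower, ← EReal.exp_coe, EReal.coe_mul]
  refine mul_le_mul_right (EReal.exp_monotone ?_) _
  exact mul_le_mul_of_nonneg_left h (EReal.coe_nonneg.2 (by positivity))

variable [SigmaFinite lam] [IsProbabilityMeasure π]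

/-- The entropic form of the Bayesian Cramér-Rao inequality. -/
theorem entropic_inequality (hn : 1 ≤ n)
    (hf_meas : Measurable (Function.uncurry f))
    (hf_nonneg : ∀ x θ, 0 ≤ f x θ) (hf_prob : ∀ θ, ∫⁻ x, ENNReal.ofReal (f x θ) ∂lam = 1)
    (hg_meas : Measurable (Function.uncurry g)) (hg : ∀ᵐ x ∂lam, HasWeakGradient (f x) (g x))
    (hreg : ∀ᵐ θ ∂(volume : Measure (EuclideanSpace ℝ (Fin n))),
      Integrable (fun x => g x θ) lam ∧ ∫ x, g x θ ∂lam = 0)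
    (hπ : π ≪ volume) (h : totalInfo lam f g π ≠ ⊤ ∨ condEntropy lam f π ≠ ⊥) :
    ((1 + Real.log (2 * Real.pi * Real.exp 1) : ℝ) : EReal) ≤
      ((2 / n : ℝ) : EReal) * condEntropy lam f π +
        ((totalInfo lam f g π / n : ℝ≥0∞) : EReal) := by
  have hn0 : (0 : ℝ) < n := by exact_mod_cast hn
  rcases eq_or_ne (totalInfo lam f g π) ⊤ with hS | hS
  -- With infinite information the right-hand side is `∞`, except for `-∞ + ∞`, which is `-∞` in
  -- `EReal`; the hypothesis excludes that case.
  · have hb : ((2 / n : ℝ) : EReal) * condEntropy lam f π ≠ ⊥ := by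
      have hne := h.resolve_left (not_not_intro hS)
      have h2 : (0 : ℝ) < 2 / n := by positivity
      induction hc : condEntropy lam f π with
      | bot => exact absurd hc hne
      | top => rw [EReal.coe_mul_top_of_pos h2]; simp
      | coe t => rw [← EReal.coe_mul]; exact EReal.coe_ne_bot _
    rw [hS, ENNReal.top_div_of_ne_top (ENNReal.natCast_ne_top n), EReal.coe_ennreal_top,
      EReal.add_top_of_ne_bot hb]
    exact le_top
  -- At `b = 1` the information terms cancel exactly, and `2 · lsiConst 1 = 2 + log (2π) = 1 + log
  -- (2πe)`.
  have key := le_condEntropy hf_meas hf_nonneg hf_prob hg_meas hg hreg hπ hS one_pos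
  have e : ((totalInfo lam f g π / n : ℝ≥0∞) : EReal) =
      (((totalInfo lam f g π).toReal / n : ℝ) : EReal) := by
    rw [← EReal.coe_ennreal_toReal (ENNReal.div_ne_top hS (by positivity)), ENNReal.toReal_div,
      ENNReal.toReal_natCast]
  rw [e]
  refine le_trans (le_of_eq ?_) (add_le_add_left (mul_le_mul_of_nonneg_left key
    (EReal.coe_nonneg.2 (by positivity : (0 : ℝ) ≤ 2 / n))) _)
  rw [← EReal.coe_mul, ← EReal.coe_add, EReal.coe_eq_coe_iff, lsiConst,
    Real.log_mul (by positivity) (by positivity), Real.log_exp, Real.log_one]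
  field_simp
  ring

/-- The multidimensional Efroimovich inequality. -/
theorem efroimovich_inequality (hn : 1 ≤ n)
    (hf_meas : Measurable (Function.uncurry f))
    (hf_nonneg : ∀ x θ, 0 ≤ f x θ) (hf_prob : ∀ θ, ∫⁻ x, ENNReal.ofReal (f x θ) ∂lam = 1)
    (hg_meas : Measurable (Function.uncurry g)) (hg : ∀ᵐ x ∂lam, HasWeakGradient (f x) (g x))
    (hreg : ∀ᵐ θ ∂(volume : Measure (EuclideanSpace ℝ (Fin n))),
      Integrable (fun x => g x θ) lam ∧ ∫ x, g x θ ∂lam = 0)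
    (hπ : π ≪ volume) :
    (n : ℝ≥0∞) / totalInfo lam f g π ≤ condEntropyPower lam f π := by
  have hn0 : (0 : ℝ) < n := by exact_mod_cast hn
  rcases eq_or_ne (totalInfo lam f g π) ⊤ with hS | hS
  · simp [hS]
  rcases eq_or_ne (condEntropyPower lam f π) ⊤ with hP | hP
  · simp [hP]
  -- The optimal scale is `b = √(n / S)`, but `S = 0` has not been excluded. Any `s > S` is used
  -- instead, costing nothing since the leftover factor `exp (1 - S / s)` is at least `1`; then `s`
  -- decreases to `S`.
  have key : ∀ s : ℝ, (totalInfo lam f g π).toReal < s →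
      ENNReal.ofReal (n / s) ≤ condEntropyPower lam f π := by
    intro s hs
    have hs0 : 0 < s := ENNReal.toReal_nonneg.trans_lt hs
    have hb : 0 < √(n / s) := by positivity
    refine le_trans (ENNReal.ofReal_le_ofReal ?_) (ofReal_exp_le_condEntropyPower
      (le_condEntropy hf_meas hf_nonneg hf_prob hg_meas hg hreg hπ hS hb))
    have h1 : (totalInfo lam f g π).toReal / s ≤ 1 := (div_le_one hs0).2 hs.le
    have e : 2 / n * (n * lsiConst √(n / s) - √(n / s) ^ 2 / 2 * (totalInfo lam f g π).toReal) =
        Real.log (2 * Real.pi * Real.exp 1 * (n / s)) +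
          (1 - (totalInfo lam f g π).toReal / s) := by
      rw [lsiConst, Real.sq_sqrt (by positivity), Real.log_sqrt (by positivity),
        Real.log_mul (x := 2 * Real.pi * Real.exp 1) (by positivity) (by positivity),
        Real.log_mul (x := 2 * Real.pi) (by positivity) (by positivity), Real.log_exp]
      field_simp
      ring
    rw [e, Real.exp_add, Real.exp_log (by positivity), ← mul_assoc, ← mul_assoc,
      one_div_mul_cancel (by positivity), one_mul]
    exact le_mul_of_one_le_right (by positivity) (Real.one_le_exp (by linarith))
  have hP0 : condEntropyPower lam f π ≠ 0 := by
    refine (lt_of_lt_of_le ?_ (key _ (lt_add_one _))).ne'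
    rw [ENNReal.ofReal_pos]
    positivity
  rw [ENNReal.div_le_iff_le_mul (Or.inr hP) (Or.inl hS), mul_comm,
    ← ENNReal.div_le_iff_le_mul (Or.inl hP0) (Or.inl hP)]
  refine le_of_forall_gt_imp_ge_of_dense fun s hs => ?_
  rcases eq_or_ne s ⊤ with hst | hst
  · simp [hst]
  have hs' := (ENNReal.toReal_lt_toReal hS hst).2 hs
  have hs0 : 0 < s.toReal := ENNReal.toReal_nonneg.trans_lt hs'
  have h := key _ hs'
  rw [ENNReal.ofReal_div_of_pos hs0, ENNReal.ofReal_toReal hst, ENNReal.ofReal_natCast,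
    ENNReal.div_le_iff_le_mul (Or.inr hP) (Or.inl hst), mul_comm] at h
  rwa [ENNReal.div_le_iff_le_mul (Or.inl hP0) (Or.inl hP)]

/-- The entropy power is at most the mean square error per coordinate. -/
theorem condEntropyPower_le_bayesMSE_div (hn : 1 ≤ n) (hf_meas : Measurable (Function.uncurry f))
    (hf_nonneg : ∀ x θ, 0 ≤ f x θ) (hf_prob : ∀ θ, ∫⁻ x, ENNReal.ofReal (f x θ) ∂lam = 1)
    (hπ : π ≪ volume) {T : 𝓧 → EuclideanSpace ℝ (Fin n)} (hT : Measurable T) :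
    condEntropyPower lam f π ≤ bayesMSE lam f π T / n := by
  have hn0 : (0 : ℝ) < n := by exact_mod_cast hn
  have hn1 : (n : ℝ≥0∞) ≠ 0 := by positivity
  rw [ENNReal.le_div_iff_mul_le (Or.inl hn1) (Or.inl (ENNReal.natCast_ne_top n))]
  -- The optimal variance is the mean square error divided by `n`, which might be zero. Any larger
  -- `s` gives the variance `s / n`; an infinite error has no such `s`, so that case is vacuous.
  refine le_of_forall_gt_imp_ge_of_dense fun s hs => ?_
  rcases eq_or_ne s ⊤ with hst | hst
  · simp [hst]
  have hD : bayesMSE lam f π T ≠ ⊤ := hs.ne_top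
  have hs' := (ENNReal.toReal_lt_toReal hD hst).2 hs
  have hs0 : 0 < s.toReal := ENNReal.toReal_nonneg.trans_lt hs'
  rw [← ENNReal.le_div_iff_mul_le (Or.inl hn1) (Or.inl (ENNReal.natCast_ne_top n))]
  refine (condEntropyPower_le_ofReal_exp (condEntropy_le hf_meas hf_nonneg hf_prob hπ hT hD
    (div_pos hs0 hn0))).trans ?_
  rw [← ENNReal.ofReal_toReal hst, ← ENNReal.ofReal_natCast n, ← ENNReal.ofReal_div_of_pos hn0]
  refine ENNReal.ofReal_le_ofReal ?_
  rw [ENNReal.toReal_ofReal hs0.le]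
  have e : 2 / n * (n / 2 * Real.log (2 * Real.pi * (s.toReal / n)) +
      1 / (2 * (s.toReal / n)) * (bayesMSE lam f π T).toReal) =
      Real.log (2 * Real.pi * (s.toReal / n)) + (bayesMSE lam f π T).toReal / s.toReal := by
    field_simp
  have h1 : Real.exp ((bayesMSE lam f π T).toReal / s.toReal) ≤ Real.exp 1 :=
    Real.exp_le_exp.2 ((div_le_one hs0).2 hs'.le)
  rw [e, Real.exp_add, Real.exp_log (by positivity)]
  calc 1 / (2 * Real.pi * Real.exp 1) * (2 * Real.pi * (s.toReal / n) *
        Real.exp ((bayesMSE lam f π T).toReal / s.toReal))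
      ≤ 1 / (2 * Real.pi * Real.exp 1) * (2 * Real.pi * (s.toReal / n) * Real.exp 1) := by gcongr
    _ = s.toReal / n := by field_simp

end Power

end BayesCR

/-! ### The main theorem. -/

theorem mainTheorem4 {n : ℕ} (hn : 1 ≤ n) {𝓧 : Type*} [MeasurableSpace 𝓧]
    -- the dominating measure and the densities `f x θ = f(x;θ)` of the family `(P_θ)`
    (lam : Measure 𝓧) [SigmaFinite lam]
    (f : 𝓧 → EuclideanSpace ℝ (Fin n) → ℝ)
    (hf_meas : Measurable (Function.uncurry f))
    (hf_nonneg : ∀ x θ, 0 ≤ f x θ)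
    (hf_prob : ∀ θ, ∫⁻ x, ENNReal.ofReal (f x θ) ∂lam = 1)
    -- the gradient `g x θ = ∇_θ f(x;θ)`
    (g : 𝓧 → EuclideanSpace ℝ (Fin n) → EuclideanSpace ℝ (Fin n))
    (hg_meas : Measurable (Function.uncurry g))
    (hg : ∀ᵐ x ∂lam, BayesCR.HasWeakGradient (f x) (g x))
    -- the regularity condition; "Lebesgue-a.e." and "a.e. for the standard Gaussian" are the same
    (hreg : ∀ᵐ θ ∂(volume : Measure (EuclideanSpace ℝ (Fin n))),
      Integrable (fun x => g x θ) lam ∧ ∫ x, g x θ ∂lam = 0)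
    -- the prior
    (π : Measure (EuclideanSpace ℝ (Fin n))) [IsProbabilityMeasure π]
    (hπ : π ≪ volume) :
    -- `h(θ|X)` is well defined and not `-∞` when the total information is finite
    (BayesCR.totalInfo lam f g π ≠ ⊤ → BayesCR.condEntropyNeg lam f π ≠ ⊤) ∧
    -- the entropic inequality, wherever its right-hand side is not of the form `-∞ + ∞`,
    -- with the sharp factor `1 / n` and without it
    (BayesCR.totalInfo lam f g π ≠ ⊤ ∨ BayesCR.condEntropy lam f π ≠ ⊥ →
      ((1 + Real.log (2 * Real.pi * Real.exp 1) : ℝ) : EReal) ≤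
          ((2 / n : ℝ) : EReal) * BayesCR.condEntropy lam f π +
            ((BayesCR.totalInfo lam f g π / n : ℝ≥0∞) : EReal) ∧
      ((1 + Real.log (2 * Real.pi * Real.exp 1) : ℝ) : EReal) ≤
          ((2 / n : ℝ) : EReal) * BayesCR.condEntropy lam f π +
            (BayesCR.totalInfo lam f g π : EReal)) ∧
    -- the multidimensional Efroimovich inequality
    (n : ℝ≥0∞) / BayesCR.totalInfo lam f g π ≤ BayesCR.condEntropyPower lam f π ∧
    -- it is stronger than, and hence implies, the van Trees inequality
    (∀ T : 𝓧 → EuclideanSpace ℝ (Fin n), Measurable T →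
      BayesCR.condEntropyPower lam f π ≤ BayesCR.bayesMSE lam f π T / n ∧
      (n : ℝ≥0∞) ^ 2 / BayesCR.totalInfo lam f g π ≤ BayesCR.bayesMSE lam f π T) := by
  have hn1 : (n : ℝ≥0∞) ≠ 0 := by positivity
  have hne := BayesCR.condEntropyNeg_le hf_meas hf_nonneg hf_prob hg_meas hg hreg hπ
  have hef := BayesCR.efroimovich_inequality hn hf_meas hf_nonneg hf_prob hg_meas hg hreg hπ
  refine ⟨fun hS => ne_top_of_le_ne_top (by finiteness) hne, fun h => ?_, hef, fun T hT => ?_⟩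
  · have h1 := BayesCR.entropic_inequality hn hf_meas hf_nonneg hf_prob hg_meas hg hreg hπ h
    refine ⟨h1, h1.trans (add_le_add_right (EReal.coe_ennreal_le_coe_ennreal_iff.2 ?_) _)⟩
    exact ENNReal.div_le_of_le_mul (le_mul_of_one_le_right zero_le (by exact_mod_cast hn))
  · have h2 := BayesCR.condEntropyPower_le_bayesMSE_div hn hf_meas hf_nonneg hf_prob hπ hT
    refine ⟨h2, ?_⟩
    -- The entropy power lies between `n / S` and the mean square error divided by `n`; multiplying
    -- the outer inequality by `n` gives van Trees.
    have h3 := (ENNReal.le_div_iff_mul_le (Or.inl hn1) (Or.inl (ENNReal.natCast_ne_top n))).1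
      (hef.trans h2)
    calc (n : ℝ≥0∞) ^ 2 / BayesCR.totalInfo lam f g π
        = n / BayesCR.totalInfo lam f g π * n := by simp only [div_eq_mul_inv]; ring
      _ ≤ _ := h3
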